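/- Let $\frac19<\alpha\le 1$, $\beta=\frac{1-\alpha}{2}$, $$z_\pm=(1+\sqrt\alpha)\left(-\frac{1+\sqrt\alpha}{8}\pm\frac{3i}{8}\sqrt{\Bigl(1-\frac{\sqrt\alpha}{3}\Bigr)(3\sqrt\alpha-1)}\right),\qquad Q_\alpha(z)=\frac{(z-z_+)(z-z_-)\bigl(z+\frac{(1-\sqrt\alpha)^2}{2}\bigr)^2}{(z-\beta)^2(z+\beta)^2(z+\alpha+\beta)^2}.$$ Let $\Sigma_0$ be the critical trajectory of the quadratic differential $Q_\alpha(z)\,dz^2$ that connects the simple zeros $z_-$ and $z_+$ and intersects the positive real axis; that is, $\Sigma_0$ is a simple arc, with endpoints $z_\pm$ included, that is continuously differentiable away from its endpoints and along which $Q_\alpha(z)\,dz^2<0$. Let $\mu_0$ be the positive measure on $\Sigma_0$ given by $d\mu_0(s)=\frac{1}{\pi i}Q_\alpha(s)^{1/2}ds=\frac1\pi|Q_\alpha(s)|^{1/2}|ds|$, and let $g(z)=\int\log(z-s)\,d\mu_0(s)$, so that $\operatorname{Re}g(z)=\int\log|z-s|\,d\mu_0(s)$ for every $z\in\mathbb C$.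 Let $\Omega_0$ be the bounded domain enclosed by the part of $\Sigma_0$ in the right half-plane $\{\operatorname{Re}z\ge0\}$ together with the part of $-\Sigma_0$ in the left half-plane $\{\operatorname{Re}z\le0\}$. Suppose that the part of $\Sigma_0$ in the open left half-plane is contained in $\Omega_0$. Then, for every $z\in\mathbb C$, the integral defining $g(z)$ converges absolutely, and $$\operatorname{Re}g(-z)>\operatorname{Re}g(z)\qquad\text{for all } z\in\mathbb C \text{ with }\operatorname{Re}z>0.$$ -/

import Mathlib

open MeasureTheory Set

noncomputable section

namespace HexagonMVOP

/-- `β = (1 - α) / 2`. -/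
def beta (α : ℝ) : ℝ := (1 - α) / 2

/-- The point `z₊(α)` (for `1/9 < α ≤ 1` it lies in the upper half-plane). -/
def zPlus (α : ℝ) : ℂ :=
  ((1 + √α : ℝ) : ℂ) *
    (((-(1 + √α) / 8 : ℝ) : ℂ)
      + 3 * Complex.I / 8 * ((√((1 - √α / 3) * (3 * √α - 1)) : ℝ) : ℂ))

/-- The point `z₋(α)`, the complex conjugate of `z₊(α)`. -/
def zMinus (α : ℝ) : ℂ :=
  ((1 + √α : ℝ) : ℂ) *
    (((-(1 + √α) / 8 : ℝ) : ℂ)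
      - 3 * Complex.I / 8 * ((√((1 - √α / 3) * (3 * √α - 1)) : ℝ) : ℂ))

/-- The rational function `Q_α`. By the conventions for division it takes the value `0` at its
poles; this plays no role below, since trajectories stay where the value is nonzero. -/
def Q (α : ℝ) (z : ℂ) : ℂ :=
  ((z - zPlus α) * (z - zMinus α) * (z + (((1 - √α) ^ 2 / 2 : ℝ) : ℂ)) ^ 2) /
    ((z - (beta α : ℂ)) ^ 2 * (z + (beta α : ℂ)) ^ 2 * (z + (α : ℂ) + (beta α : ℂ)) ^ 2)

/-- `γ`, restricted to `[0, 1]`, is a simple arc from `a` to `b` whose interior part is a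
trajectory of the quadratic differential `q(z) dz²`: it is continuously differentiable there and
`q(γ(t)) γ'(t)² < 0` (a negative real number). -/
structure IsTrajectoryArc (q : ℂ → ℂ) (a b : ℂ) (γ : ℝ → ℂ) : Prop where
  continuousOn : ContinuousOn γ (Icc 0 1)
  injOn : InjOn γ (Icc 0 1)
  source : γ 0 = a
  target : γ 1 = b
  contDiffOn : ContDiffOn ℝ 1 γ (Ioo 0 1)
  im_eq_zero : ∀ t ∈ Ioo (0 : ℝ) 1, (q (γ t) * deriv γ t ^ 2).im = 0
  re_neg : ∀ t ∈ Ioo (0 : ℝ) 1, (q (γ t) * deriv γ t ^ 2).re < 0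

/-- `γ` parametrizes `Σ₀`: among the critical trajectories of `Q_α(z) dz²` that connect the simple
zeros `z₋` and `z₊`, the one that intersects the positive real axis. -/
structure ParametrizesSigmaZero (α : ℝ) (γ : ℝ → ℂ) : Prop where
  isTrajectoryArc : IsTrajectoryArc (Q α) (zMinus α) (zPlus α) γ
  meets_pos_real : ∃ t ∈ Ioo (0 : ℝ) 1, (γ t).im = 0 ∧ 0 < (γ t).re

/-- The arc `Σ₀` (endpoints included) traced by `γ`. -/
def arc (γ : ℝ → ℂ) : Set ℂ := γ '' Icc 0 1

/-- The positive measure `dμ(s) = (1 / (π i)) Q_α(s)^{1/2} ds = (1 / π) |Q_α(s)|^{1/2} |ds|` on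
the trajectory traced by `γ`, where `|ds| = |γ'(t)| dt` is the arc length element. -/
def trajectoryMeasure (α : ℝ) (γ : ℝ → ℂ) : Measure ℂ :=
  (((volume : Measure ℝ).restrict (Ioo 0 1)).withDensity
    (fun t => ENNReal.ofReal (√‖Q α (γ t)‖ * ‖deriv γ t‖ / Real.pi))).map γ

/-- `g(z) = ∫ log (z - s) dμ(s)`. The choice of the branch of the logarithm only affects the
imaginary part of `g`; the real part is `∫ log |z - s| dμ(s)` for every choice. -/
def gFunction (μ : Measure ℂ) (z : ℂ) : ℂ := ∫ s, Complex.log (z - s) ∂μ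

/-- The set enclosed by `C`: the union of the bounded connected components of the complement. For
a Jordan curve `C` this is its (open) interior domain. -/
def enclosed (C : Set ℂ) : Set ℂ :=
  {z | z ∈ Cᶜ ∧ Bornology.IsBounded (connectedComponentIn Cᶜ z)}

/-- The domain `Ω₀` bounded by the part of `S` in the right half-plane and the part of `-S` in the
left half-plane. The half-planes are taken closed here so that the points on the imaginary axis
where the two parts meet belong to the boundary curve. -/
def OmegaZero (S : Set ℂ) : Set ℂ :=
  enclosed ({z | z ∈ S ∧ 0 ≤ z.re} ∪ {z | -z ∈ S ∧ z.re ≤ 0})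

end HexagonMVOP

end

/-! Put `s = √α`, `E = (1 + s)² / 2`, `A = z + E`, `S = (z - z₊)(z - z₋)` and `r² = S`. On the genus
zero surface `r² = S` the differential integrates in closed form: `-2 Q^{1/2} dz = d log [(A + 2r)(A
- r)² / ((A - 2r)(A + r)²)]`. The bracket has modulus 1 at the branch points, hence along `Σ₀`; that
is, the two sheet values `|A ± 2r| / |A ± r|²` agree on the arc (`CriticalArc.moduli_eq`). With `r`
the root for which `Re (A r̄) ≥ 0`, these values are `lowMod` (sign `+`) and `highMod` (sign `-`),
and away from `cross = 0` the sign of `disc` decides which is larger.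

Potential. The coordinate `ξ` with `ξ + 1/ξ = e A / r` uniformizes the surface and makes the
differential a sum of simple poles on the unit circle. It carries `Σ₀` into the open first quadrant,
running from `∞` to `0`, on a curve determined on each circle by its radius. Principal logarithms
then serve as primitives along the whole arc, each gaining `πi`. This yields total mass 1 and the
Cauchy transform of the measure, so that `exp (Re g)` is a constant times one of the two sheet
values. The selected value is `modulus`; equality holds off the endpoints
(`CriticalArc.potential_eq`) and `≥` everywhere (`CriticalArc.integrable_log_and_le_potential`).

Comparison. It remains to show `modulus z < modulus (-z)` for `Re z > 0`. Quotients of these moduli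
are dominated from below, locally, by moduli of holomorphic functions, so a maximum principle
applies (`le_one_of_hasHolSupport`). It gives `lowMod z < lowMod (-z)` (`lowMod_lt`), which settles
the region `disc z ≥ 0`, where `modulus z = lowMod z`. Where `disc z < 0`, neither `z` nor `-z` lies
on the arc. For `-z` this is where the hypothesis on `Ω₀` enters (`CriticalArc.neg_notMem_arc`). A
second maximum principle for `modulus z / modulus (-z)` then finishes: the quotient is below 1 where
`disc` vanishes, equals 1 on the imaginary axis, and is asymptotically at most 1 at infinity. -/

noncomputable section

namespace HexagonMVOP

open Filter Topology ComplexConjugate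

/-! ### The two sheet values of the potential -/

/-- The shift that moves the base point of the uniformization to the origin. -/
def ctr (s : ℝ) : ℝ := (1 + s) ^ 2 / 2

def shift (s : ℝ) (z : ℂ) : ℂ := z + (ctr s : ℂ)

/-- The quadratic polynomial `(z - z₊) (z - z₋)` in terms of the shifted variable. -/
def quad (s : ℝ) (z : ℂ) : ℂ :=
  shift s z ^ 2 - ((3 / 2 * ctr s : ℝ) : ℂ) * shift s z + ((3 / 2 * ctr s * s : ℝ) : ℂ)

/-- `|Re (A * conj r)|` for either square root `r` of the quadratic. -/
def cross (s : ℝ) (z : ℂ) : ℝ :=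
  √((‖shift s z‖ ^ 2 * ‖quad s z‖ + (shift s z ^ 2 * conj (quad s z)).re) / 2)

/-- For a root `r` with `Re (A r̄) ≥ 0` this is `|A + 2r| / |A + r|²`. Writing it through `cross`
avoids any choice of branch and makes it continuous on the whole plane. -/
def lowMod (s : ℝ) (z : ℂ) : ℝ :=
  √(‖shift s z‖ ^ 2 + 4 * ‖quad s z‖ + 4 * cross s z) /
    (‖shift s z‖ ^ 2 + ‖quad s z‖ + 2 * cross s z)

/-- The value on the other sheet, `|A - 2r| / |A - r|²`. The product over the two sheets is rational
in `z`, so this value is that product divided by `lowMod`. -/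
def highMod (s : ℝ) (z : ℂ) : ℝ :=
  3 * ‖z ^ 2 - (((1 - s ^ 2) / 2 : ℝ) : ℂ) ^ 2‖ /
    ((3 / 2 * ctr s) ^ 2 * ‖z + (((1 + s ^ 2) / 2 : ℝ) : ℂ)‖ ^ 2 * lowMod s z)

/-- The sign of this function tells which of the two moduli is larger. -/
def disc (s : ℝ) (z : ℂ) : ℝ :=
  4 * cross s z ^ 2 - 3 * ‖quad s z‖ * (‖shift s z‖ ^ 2 + ‖quad s z‖)

theorem ctr_pos {s : ℝ} (hs : 1 / 3 < s) : 0 < ctr s := by unfold ctr; positivity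

theorem two_mul_le_ctr (s : ℝ) : 2 * s ≤ ctr s := by
  unfold ctr; nlinarith [sq_nonneg (1 - s)]

/-- Twice the difference `8s - 3E` is `(3s - 1)(3 - s)`. The inequality says that the quadratic has
negative discriminant, so its zeros are not real. -/
theorem three_mul_ctr_lt {s : ℝ} (hs : 1 / 3 < s) (hs1 : s ≤ 1) : 3 * ctr s < 8 * s := by
  unfold ctr; nlinarith

/-- Together with the next identity this places the poles of `Q`: `A = ±r` at `-(1 + s²)/2`, and `A
= ±2r` at `±(1 - s²)/2`. -/
theorem shift_sq_sub_quad (s : ℝ) (z : ℂ) :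
    shift s z ^ 2 - quad s z =
      ((3 / 2 * ctr s : ℝ) : ℂ) * (z + (((1 + s ^ 2) / 2 : ℝ) : ℂ)) := by
  unfold quad shift ctr; push_cast; ring

theorem shift_sq_sub_four_quad (s : ℝ) (z : ℂ) :
    shift s z ^ 2 - 4 * quad s z = -3 * (z ^ 2 - (((1 - s ^ 2) / 2 : ℝ) : ℂ) ^ 2) := by
  unfold quad shift ctr; push_cast; ring

theorem continuous_shift (s : ℝ) : Continuous (shift s) := by unfold shift; fun_prop

theorem continuous_quad (s : ℝ) : Continuous (quad s) := by
  unfold quad; have := continuous_shift s; fun_prop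

theorem continuous_cross (s : ℝ) : Continuous (cross s) := by
  unfold cross
  have := continuous_shift s
  have := continuous_quad s
  refine Real.continuous_sqrt.comp (Continuous.div_const (Continuous.add (by fun_prop) ?_) _)
  exact Complex.continuous_re.comp ((by fun_prop : Continuous fun z => shift s z ^ 2).mul
    (Complex.continuous_conj.comp this))

theorem continuous_disc (s : ℝ) : Continuous (disc s) := by
  unfold disc
  have := continuous_shift s
  have := continuous_quad s
  have := continuous_cross s
  fun_prop

theorem cross_nonneg (s : ℝ) (z : ℂ) : 0 ≤ cross s z := Real.sqrt_nonneg _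

theorem cross_sq (s : ℝ) (z : ℂ) : cross s z ^ 2 =
    (‖shift s z‖ ^ 2 * ‖quad s z‖ + (shift s z ^ 2 * conj (quad s z)).re) / 2 := by
  unfold cross
  refine Real.sq_sqrt ?_
  have h := Complex.abs_re_le_norm (shift s z ^ 2 * conj (quad s z))
  rw [norm_mul, norm_pow, RCLike.norm_conj] at h
  linarith [neg_abs_le (shift s z ^ 2 * conj (quad s z)).re]

theorem cross_sq_eq {s : ℝ} {z r : ℂ} (hr : r ^ 2 = quad s z) :
    cross s z ^ 2 = (shift s z * conj r).re ^ 2 := by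
  rw [cross_sq, ← hr]
  have h1 : shift s z ^ 2 * conj (r ^ 2) = (shift s z * conj r) ^ 2 := by
    rw [map_pow]; ring
  have h2 : ‖shift s z‖ ^ 2 * ‖r ^ 2‖ = ‖shift s z * conj r‖ ^ 2 := by
    rw [norm_mul, RCLike.norm_conj, norm_pow]; ring
  rw [h1, h2]
  generalize shift s z * conj r = w
  rw [Complex.sq_norm, Complex.normSq_apply, pow_two w, Complex.mul_re]
  ring

theorem cross_eq {s : ℝ} {z r : ℂ} (hr : r ^ 2 = quad s z) (h : 0 ≤ (shift s z * conj r).re) :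
    cross s z = (shift s z * conj r).re :=
  (sq_eq_sq₀ (cross_nonneg s z) h).1 (cross_sq_eq hr)

theorem exists_root (s : ℝ) (z : ℂ) :
    ∃ r : ℂ, r ^ 2 = quad s z ∧ 0 ≤ (shift s z * conj r).re := by
  obtain ⟨r, hr⟩ := IsAlgClosed.exists_pow_nat_eq (quad s z) (n := 2) (by norm_num)
  by_cases h : 0 ≤ (shift s z * conj r).re
  · exact ⟨r, hr, h⟩
  · refine ⟨-r, by rw [neg_sq, hr], ?_⟩
    rw [map_neg, mul_neg, Complex.neg_re]
    linarith

theorem norm_add_real_mul_sq (A r : ℂ) (t : ℝ) :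
    ‖A + t * r‖ ^ 2 = ‖A‖ ^ 2 + t ^ 2 * ‖r‖ ^ 2 + 2 * t * (A * conj r).re := by
  simp only [Complex.sq_norm, Complex.normSq_apply, Complex.add_re, Complex.add_im, Complex.mul_re,
    Complex.mul_im, Complex.ofReal_re, Complex.ofReal_im, Complex.conj_re, Complex.conj_im]
  ring

/-- `A` and `S` have no common zero. -/
theorem shift_quad_pos {s : ℝ} (hs : 1 / 3 < s) (z : ℂ) : 0 < ‖shift s z‖ ^ 2 + ‖quad s z‖ := by
  by_cases h : shift s z = 0
  · have : quad s z = ((3 / 2 * ctr s * s : ℝ) : ℂ) := by unfold quad; rw [h]; ring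
    rw [h, this]
    have h2 : (0 : ℝ) < 3 / 2 * ctr s * s := by have := ctr_pos hs; positivity
    rw [Complex.norm_real, Real.norm_eq_abs, abs_of_pos h2]
    simpa using h2
  · have : 0 < ‖shift s z‖ := norm_pos_iff.2 h
    positivity

theorem lowMod_pos {s : ℝ} (hs : 1 / 3 < s) (z : ℂ) : 0 < lowMod s z := by
  have h := shift_quad_pos hs z
  have h2 := cross_nonneg s z
  have h3 := norm_nonneg (quad s z)
  unfold lowMod
  apply div_pos
  · apply Real.sqrt_pos.2; linarith
  · linarith

theorem continuous_lowMod {s : ℝ} (hs : 1 / 3 < s) : Continuous (lowMod s) := by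
  unfold lowMod
  have h1 := continuous_shift s
  have h2 := continuous_quad s
  have h3 := continuous_cross s
  refine Continuous.div (by fun_prop) (by fun_prop) fun z => ?_
  have h := shift_quad_pos hs z
  have := cross_nonneg s z
  linarith

theorem lowMod_eq {s : ℝ} {z r : ℂ} (hr : r ^ 2 = quad s z)
    (h : 0 ≤ (shift s z * conj r).re) :
    lowMod s z = ‖shift s z + 2 * r‖ / ‖shift s z + r‖ ^ 2 := by
  have h1 := norm_add_real_mul_sq (shift s z) r 2
  have h2 := norm_add_real_mul_sq (shift s z) r 1
  have hn : ‖quad s z‖ = ‖r‖ ^ 2 := by rw [← hr, norm_pow]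
  rw [← cross_eq hr h] at h1 h2
  unfold lowMod
  rw [hn]
  push_cast at h1 h2
  rw [one_mul] at h2
  congr 1
  · rw [← Real.sqrt_sq (norm_nonneg (shift s z + 2 * r)), h1]
    congr 1; ring
  · rw [h2]; ring

theorem add_root_ne_zero {s : ℝ} (hs : 1 / 3 < s) {z r : ℂ} (hr : r ^ 2 = quad s z)
    (h : 0 ≤ (shift s z * conj r).re) {t : ℝ} (ht : 0 < t) : shift s z + t * r ≠ 0 := by
  intro h0
  have h1 := norm_add_real_mul_sq (shift s z) r t
  rw [h0] at h1
  have hn : ‖quad s z‖ = ‖r‖ ^ 2 := by rw [← hr, norm_pow]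
  have h2 := shift_quad_pos hs z
  rw [hn] at h2
  have h3 : 0 ≤ 2 * t * (shift s z * conj r).re := by positivity
  have h4 : 0 ≤ t ^ 2 * ‖r‖ ^ 2 := by positivity
  have h5 : 0 ≤ ‖shift s z‖ ^ 2 := by positivity
  rw [norm_zero, zero_pow two_ne_zero] at h1
  have h6 : ‖shift s z‖ ^ 2 = 0 := by linarith
  have h7 : t ^ 2 * ‖r‖ ^ 2 = 0 := by linarith
  have h8 : ‖r‖ ^ 2 = 0 := by
    rcases mul_eq_zero.1 h7 with h | h
    · exact absurd h (by positivity)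
    · exact h
  linarith

theorem highMod_eq {s : ℝ} (hs : 1 / 3 < s) {z r : ℂ} (hr : r ^ 2 = quad s z)
    (h : 0 ≤ (shift s z * conj r).re) :
    highMod s z = ‖shift s z - 2 * r‖ / ‖shift s z - r‖ ^ 2 := by
  unfold highMod
  rw [lowMod_eq hr h]
  have e1 : 3 * ‖z ^ 2 - (((1 - s ^ 2) / 2 : ℝ) : ℂ) ^ 2‖ =
      ‖shift s z + 2 * r‖ * ‖shift s z - 2 * r‖ := by
    rw [← norm_mul]
    have : (shift s z + 2 * r) * (shift s z - 2 * r) =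
      -3 * (z ^ 2 - (((1 - s ^ 2) / 2 : ℝ) : ℂ) ^ 2) := by
      rw [← shift_sq_sub_four_quad, ← hr]; ring
    rw [this, norm_mul]; norm_num
  have e2 : (3 / 2 * ctr s) ^ 2 * ‖z + (((1 + s ^ 2) / 2 : ℝ) : ℂ)‖ ^ 2 =
      (‖shift s z + r‖ * ‖shift s z - r‖) ^ 2 := by
    rw [← norm_mul, ← mul_pow]
    have : (shift s z + r) * (shift s z - r) =
      ((3 / 2 * ctr s : ℝ) : ℂ) * (z + (((1 + s ^ 2) / 2 : ℝ) : ℂ)) := by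
      rw [← shift_sq_sub_quad, ← hr]; ring
    rw [this, norm_mul, Complex.norm_real, Real.norm_eq_abs,
      abs_of_pos (by have := ctr_pos hs; positivity)]
  rw [e1, e2]
  have h1 : ‖shift s z + 2 * r‖ ≠ 0 := by
    have := add_root_ne_zero hs hr h (t := 2) (by norm_num)
    simpa using this
  have h2 : ‖shift s z + r‖ ≠ 0 := by
    have := add_root_ne_zero hs hr h (t := 1) (by norm_num)
    simpa using this
  by_cases h3 : ‖shift s z - r‖ = 0
  · rw [h3]; simp
  · field_simp

/-- Comparison of the moduli through the sign of `disc`. -/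
theorem moduli_cmp {s : ℝ} (hs : 1 / 3 < s) {z : ℂ}
    (hz : z + (((1 + s ^ 2) / 2 : ℝ) : ℂ) ≠ 0) :
    lowMod s z ^ 2 - highMod s z ^ 2 =
      8 * cross s z * disc s z /
        ((‖shift s z‖ ^ 2 + ‖quad s z‖ + 2 * cross s z) ^ 2 *
          (‖shift s z‖ ^ 2 + ‖quad s z‖ - 2 * cross s z) ^ 2) := by
  obtain ⟨r, hr, h⟩ := exists_root s z
  rw [lowMod_eq hr h, highMod_eq hs hr h]
  have hn : ‖quad s z‖ = ‖r‖ ^ 2 := by rw [← hr, norm_pow]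
  have h1 := norm_add_real_mul_sq (shift s z) r 2
  have h2 := norm_add_real_mul_sq (shift s z) r 1
  have h3 := norm_add_real_mul_sq (shift s z) r (-2)
  have h4 := norm_add_real_mul_sq (shift s z) r (-1)
  rw [← cross_eq hr h] at h1 h2 h3 h4
  push_cast at h1 h2 h3 h4
  rw [one_mul] at h2
  rw [neg_mul, ← sub_eq_add_neg] at h3
  rw [neg_mul, one_mul, ← sub_eq_add_neg] at h4
  have n2 : ‖shift s z + r‖ ≠ 0 := by
    have := add_root_ne_zero hs hr h (t := 1) (by norm_num)
    simpa using this
  have n4 : ‖shift s z - r‖ ≠ 0 := by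
    intro h0
    have : (shift s z + r) * (shift s z - r) =
      ((3 / 2 * ctr s : ℝ) : ℂ) * (z + (((1 + s ^ 2) / 2 : ℝ) : ℂ)) := by
      rw [← shift_sq_sub_quad, ← hr]; ring
    rw [norm_eq_zero.1 h0, mul_zero] at this
    rcases mul_eq_zero.1 this.symm with h | h
    · have := ctr_pos hs
      rw [Complex.ofReal_eq_zero] at h
      linarith
    · exact hz h
  rw [div_pow, div_pow, h1, h3, h2, h4]
  rw [← norm_ne_zero_iff, norm_norm, ← pow_ne_zero_iff (two_ne_zero), h2] at n2
  rw [← norm_ne_zero_iff, norm_norm, ← pow_ne_zero_iff (two_ne_zero), h4] at n4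
  unfold disc
  rw [hn]
  have n2' : ‖shift s z‖ ^ 2 + ‖r‖ ^ 2 + 2 * cross s z ≠ 0 := by
    intro h; apply n2; linarith
  have n4' : ‖shift s z‖ ^ 2 + ‖r‖ ^ 2 - 2 * cross s z ≠ 0 := by
    intro h; apply n4; linarith
  rw [show ‖shift s z‖ ^ 2 + 1 ^ 2 * ‖r‖ ^ 2 + 2 * 1 * cross s z =
    ‖shift s z‖ ^ 2 + ‖r‖ ^ 2 + 2 * cross s z by ring,
    show ‖shift s z‖ ^ 2 + (-1) ^ 2 * ‖r‖ ^ 2 + 2 * -1 * cross s z =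
    ‖shift s z‖ ^ 2 + ‖r‖ ^ 2 - 2 * cross s z by ring]
  field_simp
  ring

/-- On the closed right half-plane the square roots stay transversal to `A`. -/
theorem cross_pos_of_re_nonneg {s : ℝ} (hs : 1 / 3 < s) (hs1 : s ≤ 1) {z : ℂ} (hz : 0 ≤ z.re) :
    0 < cross s z := by
  unfold cross
  apply Real.sqrt_pos.2
  apply half_pos
  set A := shift s z with hA
  set x := A.re with hx
  set y := A.im with hy
  have hE := ctr_pos hs
  have hE2 := two_mul_le_ctr s
  have hE8 := three_mul_ctr_lt hs hs1
  set E := ctr s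
  have hxE : E ≤ x := by simp [hx, hA, shift, E, hz]
  have hre : (A ^ 2 * conj (quad s z)).re =
      (x ^ 2 + y ^ 2) ^ 2 - 3 / 2 * E * x * (x ^ 2 + y ^ 2) + 3 / 2 * E * s * (x ^ 2 - y ^ 2) := by
    unfold quad
    rw [← hA]
    simp only [map_add, map_sub, map_mul, Complex.conj_ofReal, pow_two, Complex.mul_re,
      Complex.mul_im, Complex.add_re, Complex.sub_re, Complex.add_im, Complex.sub_im,
      Complex.conj_re, Complex.conj_im, Complex.ofReal_re, Complex.ofReal_im]
    ring
  have him : (A ^ 2 * conj (quad s z)).im =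
      -(3 / 2 * E * y * (x ^ 2 + y ^ 2 - 2 * s * x)) := by
    unfold quad
    rw [← hA]
    simp only [map_add, map_sub, map_mul, Complex.conj_ofReal, pow_two, Complex.mul_re,
      Complex.mul_im, Complex.add_re, Complex.sub_re, Complex.add_im, Complex.sub_im,
      Complex.conj_re, Complex.conj_im, Complex.ofReal_re, Complex.ofReal_im]
    ring
  have hnorm : ‖A‖ ^ 2 * ‖quad s z‖ = ‖A ^ 2 * conj (quad s z)‖ := by
    rw [norm_mul, norm_pow, RCLike.norm_conj]
  rw [hnorm]
  set w := A ^ 2 * conj (quad s z)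
  have hsq : ‖w‖ ^ 2 = w.re ^ 2 + w.im ^ 2 := by
    rw [Complex.sq_norm, Complex.normSq_apply]; ring
  -- `‖w‖ + Re w` vanishes only on the closed negative real axis. Off the real axis `Im w ≠ 0`,
  -- because `x ≥ E ≥ 2s`; on it `w > 0`, because the quadratic has no real zero.
  by_cases hy0 : y = 0
  · have : 0 < w.re := by
      rw [hre, hy0]
      have : 0 < x ^ 2 - 3 / 2 * E * x + 3 / 2 * E * s := by
        nlinarith [sq_nonneg (x - 3 / 4 * E)]
      have hx0 : 0 < x := by linarith
      have : 0 < x ^ 2 * (x ^ 2 - 3 / 2 * E * x + 3 / 2 * E * s) := by positivity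
      nlinarith
    linarith [norm_nonneg w]
  · have him0 : w.im ≠ 0 := by
      rw [him]
      have : 0 < x ^ 2 + y ^ 2 - 2 * s * x := by
        have : 0 < y ^ 2 := by positivity
        nlinarith
      have h3 : 0 < y ^ 2 := by positivity
      simp only [ne_eq, neg_eq_zero, mul_eq_zero, not_or]
      refine ⟨⟨⟨by norm_num, hE.ne'⟩, hy0⟩, this.ne'⟩
    by_contra hcon
    have h1 : w.re ≤ -‖w‖ := by linarith
    have h3 : 0 < w.im ^ 2 := by positivity
    nlinarith [norm_nonneg w]

/-! ### Holomorphic supports and the maximum principle -/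

/-- Holomorphic local square root. -/
theorem exists_local_sqrt {f : ℂ → ℂ} {z₀ r₀ : ℂ} (hf : AnalyticAt ℂ f z₀) (h0 : f z₀ ≠ 0)
    (hr : r₀ ^ 2 = f z₀) :
    ∃ r : ℂ → ℂ, AnalyticAt ℂ r z₀ ∧ r z₀ = r₀ ∧ ∀ᶠ z in 𝓝 z₀, r z ^ 2 = f z := by
  refine ⟨fun z => r₀ * Complex.exp (Complex.log (f z / f z₀) / 2), ?_, ?_, ?_⟩
  · refine analyticAt_const.mul (AnalyticAt.cexp ?_)
    refine AnalyticAt.div_const (AnalyticAt.clog (hf.div_const) ?_)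
    rw [div_self h0]; exact Complex.one_mem_slitPlane
  · simp [div_self h0]
  · filter_upwards [hf.continuousAt.eventually_ne h0] with z hz
    rw [mul_pow, ← Complex.exp_nat_mul, hr]
    rw [show ((2 : ℕ) : ℂ) * (Complex.log (f z / f z₀) / 2) = Complex.log (f z / f z₀) by
      push_cast; ring, Complex.exp_log (div_ne_zero hz h0)]
    field_simp

theorem analyticAt_shift (s : ℝ) (z : ℂ) : AnalyticAt ℂ (shift s) z := by
  unfold shift; fun_prop

theorem analyticAt_quad (s : ℝ) (z : ℂ) : AnalyticAt ℂ (quad s) z := by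
  unfold quad
  have := analyticAt_shift s z
  fun_prop

theorem quad_ne_zero_of_cross_pos {s : ℝ} {z : ℂ} (h : 0 < cross s z) : quad s z ≠ 0 := by
  intro h0
  unfold cross at h
  rw [h0] at h
  simp at h

/-- Holomorphic choice of the dominant square root near a transversal point. -/
theorem exists_local_root {s : ℝ} {z₀ : ℂ} (h : 0 < cross s z₀) :
    ∃ r : ℂ → ℂ, AnalyticAt ℂ r z₀ ∧
      ∀ᶠ z in 𝓝 z₀, r z ^ 2 = quad s z ∧ 0 < (shift s z * conj (r z)).re := by
  obtain ⟨r₀, hr₀, hre⟩ := exists_root s z₀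
  obtain ⟨r, hra, hrz, hr⟩ := exists_local_sqrt (analyticAt_quad s z₀)
    (quad_ne_zero_of_cross_pos h) hr₀
  refine ⟨r, hra, hr.and ?_⟩
  have hc : ContinuousAt (fun z => (shift s z * conj (r z)).re) z₀ :=
    Complex.continuous_re.continuousAt.comp ((continuous_shift s).continuousAt.mul
      (Complex.continuous_conj.continuousAt.comp hra.continuousAt))
  refine hc.eventually (lt_mem_nhds ?_)
  simp only [hrz]; rw [← cross_eq hr₀ hre]; exact h

/-- A holomorphic function whose modulus touches `u` from below at `z₀`. -/
def HasHolSupport (u : ℂ → ℝ) (z₀ : ℂ) : Prop :=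
  ∃ F : ℂ → ℂ, AnalyticAt ℂ F z₀ ∧ ‖F z₀‖ = u z₀ ∧ ∀ᶠ z in 𝓝 z₀, ‖F z‖ ≤ u z

theorem HasHolSupport.mul {u v : ℂ → ℝ} {z₀ : ℂ} (hu : HasHolSupport u z₀)
    (hv : HasHolSupport v z₀) : HasHolSupport (fun z => u z * v z) z₀ := by
  obtain ⟨F, hF, hF0, hFu⟩ := hu
  obtain ⟨G, hG, hG0, hGv⟩ := hv
  refine ⟨fun z => F z * G z, hF.mul hG, by rw [norm_mul, hF0, hG0], ?_⟩
  filter_upwards [hFu, hGv] with z h1 h2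
  rw [norm_mul]
  exact mul_le_mul h1 h2 (norm_nonneg _) ((norm_nonneg _).trans h1)

theorem HasHolSupport.comp_neg {u : ℂ → ℝ} {z₀ : ℂ} (hu : HasHolSupport u (-z₀)) :
    HasHolSupport (fun z => u (-z)) z₀ := by
  obtain ⟨F, hF, hF0, hFu⟩ := hu
  refine ⟨fun z => F (-z), ?_, hF0, ?_⟩
  · exact AnalyticAt.fun_comp (f := fun z : ℂ => -z) hF (by fun_prop)
  · exact (continuous_neg.tendsto z₀).eventually hFu

/-- The support satisfies `‖F‖ ≤ u ≤ u z₀ = ‖F z₀‖`, so `‖F‖` has a local maximum and is locally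
constant; `u` is squeezed between the two. -/
theorem HasHolSupport.eventually_eq {u : ℂ → ℝ} {z₀ : ℂ} (hu : HasHolSupport u z₀)
    (h : ∀ᶠ z in 𝓝 z₀, u z ≤ u z₀) : ∀ᶠ z in 𝓝 z₀, u z = u z₀ := by
  obtain ⟨F, hF, hF0, hFu⟩ := hu
  have hmax : IsLocalMax (norm ∘ F) z₀ := by
    filter_upwards [h, hFu] with z h1 h2
    simp only [Function.comp_apply]
    rw [hF0]; exact h2.trans h1
  have hd : ∀ᶠ z in 𝓝 z₀, DifferentiableAt ℂ F z :=
    hF.eventually_analyticAt.mono fun z hz => hz.differentiableAt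
  have := Complex.norm_eventually_eq_of_isLocalMax hd hmax
  filter_upwards [this, h, hFu] with z h1 h2 h3
  refine le_antisymm h2 ?_
  rw [← hF0, ← h1]; exact h3

/-- Maximum principle for functions with holomorphic supports. -/
theorem le_one_of_hasHolSupport {U : Set ℂ} (hU : IsOpen U) {u : ℂ → ℝ} (hu : ContinuousOn u U)
    (hs : ∀ z ∈ U, 1 < u z → HasHolSupport u z)
    (hK : ∀ c : ℝ, 1 < c → IsCompact {z | z ∈ U ∧ c ≤ u z}) {z : ℂ} (hz : z ∈ U) : u z ≤ 1 := by
  by_contra! hcon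
  obtain ⟨z₁, ⟨hz₁U, hz₁⟩, hmax⟩ := (hK (u z) hcon).exists_isMaxOn ⟨z, hz, le_rfl⟩
    (hu.mono fun w hw => hw.1)
  have hglob : ∀ w ∈ U, u w ≤ u z₁ := by
    intro w hw
    by_cases h : u z ≤ u w
    · exact hmax ⟨hw, h⟩
    · linarith
  have h1 : 1 < u z₁ := by linarith
  -- The set where `u` attains its maximum is compact by hypothesis and open by the local maximum
  -- principle. In the connected, noncompact plane such a set is empty, so no boundary regularity is
  -- needed.
  set Z := {w | w ∈ U ∧ u z₁ ≤ u w} with hZ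
  have hZc : IsCompact Z := hK _ h1
  have hZo : IsOpen Z := by
    rw [isOpen_iff_mem_nhds]
    rintro w ⟨hwU, hw⟩
    have hwe : u w = u z₁ := le_antisymm (hglob w hwU) hw
    have hev := (hs w hwU (by linarith)).eventually_eq (by
      filter_upwards [hU.mem_nhds hwU] with y hy
      rw [hwe]; exact hglob y hy)
    filter_upwards [hev, hU.mem_nhds hwU] with y h2 h3
    exact ⟨h3, by rw [h2, hwe]⟩
  have hclopen : IsClopen Z := ⟨hZc.isClosed, hZo⟩
  rcases isClopen_iff.1 hclopen with h | h
  · exact (h ▸ (⟨hz₁U, le_rfl⟩ : z₁ ∈ Z) : z₁ ∈ (∅ : Set ℂ))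
  · rw [h] at hZc
    exact noncompact_univ ℂ hZc

/-! ### Conjugation symmetry and supports for `lowMod` and its reciprocal -/

theorem shift_conj (s : ℝ) (z : ℂ) : shift s (conj z) = conj (shift s z) := by
  simp [shift]

theorem quad_conj (s : ℝ) (z : ℂ) : quad s (conj z) = conj (quad s z) := by
  unfold quad
  rw [shift_conj]
  simp only [map_add, map_sub, map_mul, map_pow, Complex.conj_ofReal]

theorem cross_conj (s : ℝ) (z : ℂ) : cross s (conj z) = cross s z := by
  unfold cross
  rw [shift_conj, quad_conj, RCLike.norm_conj, RCLike.norm_conj, ← map_pow, ← map_mul,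
    Complex.conj_re]

theorem lowMod_conj (s : ℝ) (z : ℂ) : lowMod s (conj z) = lowMod s z := by
  unfold lowMod
  rw [cross_conj, shift_conj, quad_conj, RCLike.norm_conj, RCLike.norm_conj]

theorem neg_eq_conj {z : ℂ} (hz : z.re = 0) : -z = conj z := by
  apply Complex.ext <;> simp [hz]

theorem lowMod_mul_highMod {s : ℝ} (hs : 1 / 3 < s) (z : ℂ) :
    lowMod s z * highMod s z = ‖shift s z ^ 2 - 4 * quad s z‖ / ‖shift s z ^ 2 - quad s z‖ ^ 2 := by
  rw [shift_sq_sub_four_quad, shift_sq_sub_quad, norm_mul, norm_mul, Complex.norm_real,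
    Real.norm_eq_abs, abs_of_pos (by have := ctr_pos hs; positivity)]
  unfold highMod
  have h := (lowMod_pos hs z).ne'
  have h3 : ‖(-3 : ℂ)‖ = 3 := by norm_num
  rw [h3, mul_pow]
  field_simp

theorem hasHolSupport_lowMod {s : ℝ} (hs : 1 / 3 < s) {z₀ : ℂ} (h : 0 < cross s z₀) :
    HasHolSupport (lowMod s) z₀ := by
  obtain ⟨r, hra, hr⟩ := exists_local_root h
  have h0 := hr.self_of_nhds
  have hA := analyticAt_shift s z₀
  refine ⟨fun z => (shift s z + 2 * r z) / (shift s z + r z) ^ 2, ?_, ?_, ?_⟩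
  · refine AnalyticAt.div (hA.add (analyticAt_const.mul hra)) ((hA.add hra).pow 2) ?_
    have := add_root_ne_zero hs h0.1 h0.2.le (t := 1) one_pos
    rw [Complex.ofReal_one, one_mul] at this
    exact pow_ne_zero 2 this
  · rw [norm_div, norm_pow, lowMod_eq h0.1 h0.2.le]
  · filter_upwards [hr] with z hz
    rw [norm_div, norm_pow, lowMod_eq hz.1 hz.2.le]

theorem hasHolSupport_inv_lowMod_of_pos {s : ℝ} (hs : 1 / 3 < s) {z₀ : ℂ} (h : 0 < cross s z₀) :
    HasHolSupport (fun z => (lowMod s z)⁻¹) z₀ := by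
  obtain ⟨r, hra, hr⟩ := exists_local_root h
  have h0 := hr.self_of_nhds
  have hA := analyticAt_shift s z₀
  refine ⟨fun z => ((shift s z + 2 * r z) / (shift s z + r z) ^ 2)⁻¹, ?_, ?_, ?_⟩
  · have h1 := add_root_ne_zero hs h0.1 h0.2.le (t := 1) one_pos
    rw [Complex.ofReal_one, one_mul] at h1
    have h2 := add_root_ne_zero hs h0.1 h0.2.le (t := 2) two_pos
    rw [Complex.ofReal_ofNat] at h2
    refine AnalyticAt.inv (AnalyticAt.div (hA.add (analyticAt_const.mul hra)) ((hA.add hra).pow 2)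
      (pow_ne_zero 2 h1)) (div_ne_zero h2 (pow_ne_zero 2 h1))
  · simp only [norm_inv, norm_div, norm_pow]
    rw [lowMod_eq h0.1 h0.2.le]
  · filter_upwards [hr] with z hz
    rw [norm_inv, norm_div, norm_pow, lowMod_eq hz.1 hz.2.le]

theorem shift_sq_sub_quad_ne_zero {s : ℝ} (hs : 1 / 3 < s) {z : ℂ} (h : cross s z = 0) :
    shift s z ^ 2 - quad s z ≠ 0 := by
  intro h0
  have h1 := cross_sq s z
  have h2 : quad s z = shift s z ^ 2 := (sub_eq_zero.1 h0).symm
  have h3 := shift_quad_pos hs z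
  rw [h, h2, Complex.mul_conj, Complex.ofReal_re, Complex.normSq_eq_norm_sq, norm_pow] at h1
  rw [h2, norm_pow] at h3
  nlinarith [sq_nonneg ‖shift s z‖, sq_nonneg (‖shift s z‖ ^ 2)]

theorem shift_sq_sub_four_quad_ne_zero {s : ℝ} (hs : 1 / 3 < s) {z : ℂ} (h : cross s z = 0) :
    shift s z ^ 2 - 4 * quad s z ≠ 0 := by
  intro h0
  have h1 := cross_sq s z
  have h2 : quad s z = shift s z ^ 2 * ((1 / 4 : ℝ) : ℂ) := by
    rw [sub_eq_zero.1 h0]; push_cast; ring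
  have h3 := shift_quad_pos hs z
  rw [h, h2, map_mul, Complex.conj_ofReal, ← mul_assoc, Complex.mul_conj, ← Complex.ofReal_mul,
    Complex.ofReal_re, Complex.normSq_eq_norm_sq, norm_mul, norm_pow, Complex.norm_real] at h1
  rw [h2, norm_mul, norm_pow, Complex.norm_real] at h3
  norm_num at h1 h3
  nlinarith [sq_nonneg ‖shift s z‖, sq_nonneg (‖shift s z‖ ^ 2)]

/-- Where `cross = 0` the sheets exchange roles and the two values agree. Since `disc < 0` nearby,
`lowMod` is the smaller one, so its reciprocal is a maximum and dominates the geometric mean of both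
reciprocals. That mean is `|(A² - S) / √(A² - 4S)|`, which is holomorphic inside the modulus. -/
theorem hasHolSupport_inv_lowMod_of_eq_zero {s : ℝ} (hs : 1 / 3 < s) {z₀ : ℂ}
    (h : cross s z₀ = 0) (hq : quad s z₀ ≠ 0) :
    HasHolSupport (fun z => (lowMod s z)⁻¹) z₀ := by
  have n1 := shift_sq_sub_quad_ne_zero hs h
  have n4 := shift_sq_sub_four_quad_ne_zero hs h
  have hA := analyticAt_shift s z₀
  have hS := analyticAt_quad s z₀
  have hf : AnalyticAt ℂ (fun z => shift s z ^ 2 - 4 * quad s z) z₀ := by fun_prop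
  obtain ⟨r₀, hr₀⟩ := IsAlgClosed.exists_pow_nat_eq (shift s z₀ ^ 2 - 4 * quad s z₀)
    (n := 2) (by norm_num)
  obtain ⟨r, hra, hrz, hr⟩ := exists_local_sqrt hf n4 hr₀
  have hrne : r z₀ ≠ 0 := by
    intro h0; apply n4; rw [← hr₀, ← hrz, h0]; simp
  have hev : ∀ᶠ z in 𝓝 z₀, ‖(shift s z ^ 2 - quad s z) / r z‖ ^ 2 =
      (lowMod s z * highMod s z)⁻¹ := by
    filter_upwards [hr] with z hz
    rw [lowMod_mul_highMod hs, inv_div, norm_div, div_pow, ← norm_pow (r z), hz]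
  have hdisc : disc s z₀ < 0 := by
    unfold disc
    rw [h]
    have := shift_quad_pos hs z₀
    have : 0 < ‖quad s z₀‖ := norm_pos_iff.2 hq
    have : 0 < ‖quad s z₀‖ * (‖shift s z₀‖ ^ 2 + ‖quad s z₀‖) := by positivity
    nlinarith
  have hle : ∀ᶠ z in 𝓝 z₀, (lowMod s z * highMod s z)⁻¹ ≤ (lowMod s z)⁻¹ ^ 2 := by
    have c1 : ContinuousAt (fun z => shift s z ^ 2 - quad s z) z₀ := by fun_prop
    have c4 : ContinuousAt (fun z => shift s z ^ 2 - 4 * quad s z) z₀ := by fun_prop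
    filter_upwards [(continuous_disc s).continuousAt.eventually (gt_mem_nhds hdisc),
      c1.eventually_ne n1, c4.eventually_ne n4] with z h1 h2 h3
    have hlow := lowMod_pos hs z
    have hz : z + (((1 + s ^ 2) / 2 : ℝ) : ℂ) ≠ 0 := by
      intro h0; apply h2; rw [shift_sq_sub_quad, h0, mul_zero]
    have hcmp := moduli_cmp hs hz
    have hle2 : lowMod s z ^ 2 ≤ highMod s z ^ 2 := by
      have : 8 * cross s z * disc s z ≤ 0 := by
        have := cross_nonneg s z
        nlinarith
      have := div_nonpos_of_nonpos_of_nonneg this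
        (by positivity : 0 ≤ (‖shift s z‖ ^ 2 + ‖quad s z‖ + 2 * cross s z) ^ 2 *
          (‖shift s z‖ ^ 2 + ‖quad s z‖ - 2 * cross s z) ^ 2)
      linarith
    have hhigh0 : 0 ≤ highMod s z := by unfold highMod; positivity
    have hle : lowMod s z ≤ highMod s z := (sq_le_sq₀ hlow.le hhigh0).1 hle2
    rw [inv_pow, pow_two]
    gcongr
  refine ⟨fun z => (shift s z ^ 2 - quad s z) / r z, ?_, ?_, ?_⟩
  · exact AnalyticAt.div (by fun_prop) hra hrne
  · have h1 := hev.self_of_nhds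
    have hz : z₀ + (((1 + s ^ 2) / 2 : ℝ) : ℂ) ≠ 0 := by
      intro h0; apply n1; rw [shift_sq_sub_quad, h0, mul_zero]
    have hcmp := moduli_cmp hs hz
    rw [h, mul_zero, zero_mul, zero_div] at hcmp
    have hhigh0 : 0 ≤ highMod s z₀ := by
      have := lowMod_pos hs z₀
      unfold highMod; positivity
    have heq : lowMod s z₀ = highMod s z₀ :=
      (sq_eq_sq₀ (lowMod_pos hs z₀).le hhigh0).1 (by linarith)
    rw [← heq, ← pow_two, ← inv_pow] at h1
    exact (sq_eq_sq₀ (norm_nonneg _) (inv_nonneg.2 (lowMod_pos hs z₀).le)).1 h1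
  · filter_upwards [hev, hle] with z h1 h2
    rw [← h1] at h2
    exact (sq_le_sq₀ (norm_nonneg _) (inv_nonneg.2 (lowMod_pos hs z).le)).1 h2

theorem hasHolSupport_inv_lowMod {s : ℝ} (hs : 1 / 3 < s) {z₀ : ℂ} (hq : quad s z₀ ≠ 0) :
    HasHolSupport (fun z => (lowMod s z)⁻¹) z₀ := by
  rcases (cross_nonneg s z₀).eq_or_lt with h | h
  · exact hasHolSupport_inv_lowMod_of_eq_zero hs h.symm hq
  · exact hasHolSupport_inv_lowMod_of_pos hs h

theorem lowMod_sq (s : ℝ) (z : ℂ) : lowMod s z ^ 2 =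
    (‖shift s z‖ ^ 2 + 4 * ‖quad s z‖ + 4 * cross s z) /
    (‖shift s z‖ ^ 2 + ‖quad s z‖ + 2 * cross s z) ^ 2 := by
  unfold lowMod
  rw [div_pow, Real.sq_sqrt]
  have := cross_nonneg s z
  positivity

/-- Real and imaginary parts of a zero of the quadratic. -/
theorem root_re_im {s : ℝ} (hs : 1 / 3 < s) (hs1 : s ≤ 1) {w : ℂ} (h : quad s w = 0) :
    (shift s w).re = 3 / 4 * ctr s ∧ (shift s w).im ^ 2 = 3 / 2 * ctr s * s - 9 / 16 * ctr s ^ 2 := by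
  have hE := ctr_pos hs
  have hE8 := three_mul_ctr_lt hs hs1
  have hre := congrArg Complex.re h
  have him := congrArg Complex.im h
  unfold quad at hre him
  simp only [pow_two, Complex.mul_re, Complex.mul_im, Complex.add_re, Complex.sub_re,
    Complex.add_im, Complex.sub_im, Complex.ofReal_re, Complex.ofReal_im, Complex.zero_re,
    Complex.zero_im] at hre him
  set x := (shift s w).re
  set y := (shift s w).im
  set E := ctr s
  have hy : y ≠ 0 := by
    intro h0
    rw [h0] at hre
    nlinarith [sq_nonneg (x - 3 / 4 * E)]
  have hx : x = 3 / 4 * E := by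
    have : y * (2 * x - 3 / 2 * E) = 0 := by linarith
    rcases mul_eq_zero.1 this with h | h
    · exact absurd h hy
    · linarith
  refine ⟨hx, ?_⟩
  rw [hx] at hre
  nlinarith

/-- At a zero of the quadratic the reciprocal has no support available, so the strict inequality is
checked by hand: there `|B|² = 3Es/2`, while `|A|² = E² + 3Es/2` at the reflected point. -/
theorem lowMod_lt_of_quad_neg_eq_zero {s : ℝ} (hs : 1 / 3 < s) (hs1 : s ≤ 1) {z : ℂ}
    (h : quad s (-z) = 0) : lowMod s z < lowMod s (-z) := by
  have hE := ctr_pos hs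
  have hE2 := two_mul_le_ctr s
  have hE8 := three_mul_ctr_lt hs hs1
  obtain ⟨hx, hy⟩ := root_re_im hs hs1 h
  set B := shift s (-z) with hB
  have hA : shift s z = 2 * (ctr s : ℂ) - B := by rw [hB]; unfold shift; ring
  have hBn : ‖B‖ ^ 2 = 3 / 2 * ctr s * s := by
    rw [Complex.sq_norm, Complex.normSq_apply, hx]; linarith
  have hAn : ‖shift s z‖ ^ 2 = ctr s ^ 2 + 3 / 2 * ctr s * s := by
    rw [hA, Complex.sq_norm, Complex.normSq_apply]
    simp only [Complex.sub_re, Complex.sub_im, Complex.mul_re, Complex.mul_im, Complex.ofReal_re,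
      Complex.ofReal_im, Complex.re_ofNat, Complex.im_ofNat, hx]
    linarith
  have hcr : cross s (-z) = 0 := by unfold cross; rw [h]; simp
  have h1 : lowMod s (-z) ^ 2 = 1 / (3 / 2 * ctr s * s) := by
    rw [lowMod_sq s, h, hcr, ← hB, hBn]
    have : 3 / 2 * ctr s * s ≠ 0 := by positivity
    simp only [norm_zero, mul_zero, add_zero]
    field_simp
  rw [← sq_lt_sq₀ (lowMod_pos hs z).le (lowMod_pos hs _).le, h1, lowMod_sq s, hAn]
  have ha := cross_nonneg s z
  have hm := norm_nonneg (quad s z)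
  set a := cross s z
  set m := ‖quad s z‖
  set E := ctr s
  rw [div_lt_div_iff₀ (by positivity) (by positivity), one_mul]
  have k1 : 0 ≤ m * (2 * E ^ 2 - 3 * E * s) := by
    apply mul_nonneg hm
    nlinarith
  have k2 : 0 ≤ a * E ^ 2 := by positivity
  have k3 : 0 < E ^ 2 * (E ^ 2 + 3 / 2 * E * s) := by positivity
  nlinarith [sq_nonneg (m + 2 * a)]

/-- Supplies the one point of strict inequality that the connectedness argument needs. At `-E` the
shift vanishes and everything is explicit. -/
theorem lowMod_ctr_lt {s : ℝ} (hs : 1 / 3 < s) : lowMod s (ctr s) < lowMod s (-(ctr s : ℂ)) := by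
  have hE := ctr_pos hs
  have hE2 := two_mul_le_ctr s
  have hA0 : shift s (-(ctr s : ℂ)) = 0 := by unfold shift; ring
  have hS0 : quad s (-(ctr s : ℂ)) = ((3 / 2 * ctr s * s : ℝ) : ℂ) := by
    unfold quad; rw [hA0]; ring
  have hn0 : ‖quad s (-(ctr s : ℂ))‖ = 3 / 2 * ctr s * s := by
    rw [hS0, Complex.norm_real, Real.norm_eq_abs, abs_of_pos (by positivity)]
  have hc0 : cross s (-(ctr s : ℂ)) = 0 := by unfold cross; rw [hA0]; simp
  have hA : ‖shift s (ctr s)‖ ^ 2 = 4 * ctr s ^ 2 := by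
    have : shift s (ctr s) = ((2 * ctr s : ℝ) : ℂ) := by unfold shift; push_cast; ring
    rw [this, Complex.norm_real, Real.norm_eq_abs, sq_abs]; ring
  rw [← sq_lt_sq₀ (lowMod_pos hs _).le (lowMod_pos hs _).le, lowMod_sq s, lowMod_sq s, hn0, hc0,
    hA0, hA]
  have ha := cross_nonneg s (ctr s)
  have hm := norm_nonneg (quad s (ctr s))
  set a := cross s (ctr s)
  set m := ‖quad s (ctr s)‖
  set E := ctr s
  rw [div_lt_div_iff₀ (by positivity) (by simp; positivity)]
  simp only [norm_zero, mul_zero, add_zero, ne_eq, OfNat.ofNat_ne_zero, not_false_eq_true, zero_pow,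
    zero_add]
  have k0 : 0 < 3 / 2 * E * s := by positivity
  have k1 : (4 * E ^ 2 + 4 * m + 4 * a) * (3 / 2 * E * s) < 4 * (4 * E ^ 2 + m + 2 * a) ^ 2 := by
    have : 3 / 2 * E * s ≤ E ^ 2 := by nlinarith
    have k2 : (4 * E ^ 2 + 4 * m + 4 * a) * (3 / 2 * E * s) ≤ (4 * E ^ 2 + 4 * m + 4 * a) * E ^ 2 :=
      mul_le_mul_of_nonneg_left this (by positivity)
    have : 0 < E ^ 2 * E ^ 2 := by positivity
    have : 0 ≤ E ^ 2 * m := by positivity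
    have : 0 ≤ E ^ 2 * a := by positivity
    nlinarith [sq_nonneg (m + 2 * a)]
  nlinarith

/-! ### Behaviour at infinity and the reflection inequality for `lowMod` -/

theorem tendsto_shift_div (s : ℝ) :
    Tendsto (fun z : ℂ => shift s z / z) (Bornology.cobounded ℂ) (𝓝 1) := by
  have h : Tendsto (fun z : ℂ => 1 + (ctr s : ℂ) * z⁻¹) (Bornology.cobounded ℂ)
      (𝓝 (1 + (ctr s : ℂ) * 0)) :=
    tendsto_const_nhds.add (tendsto_const_nhds.mul tendsto_inv₀_cobounded)
  rw [mul_zero, add_zero] at h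
  refine h.congr' ?_
  filter_upwards [Bornology.eventually_ne_cobounded (0 : ℂ)] with z hz
  unfold shift
  field_simp

theorem tendsto_quad_div (s : ℝ) :
    Tendsto (fun z : ℂ => quad s z / z ^ 2) (Bornology.cobounded ℂ) (𝓝 1) := by
  have hi : Tendsto (fun z : ℂ => z⁻¹) (Bornology.cobounded ℂ) (𝓝 0) := tendsto_inv₀_cobounded
  have h := ((tendsto_shift_div s).pow 2).sub ((tendsto_const_nhds
    (x := ((3 / 2 * ctr s : ℝ) : ℂ))).mul ((tendsto_shift_div s).mul hi))
  have h2 := h.add ((tendsto_const_nhds (x := ((3 / 2 * ctr s * s : ℝ) : ℂ))).mul (hi.pow 2))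
  norm_num at h2
  refine h2.congr' ?_
  filter_upwards [Bornology.eventually_ne_cobounded (0 : ℂ)] with z hz
  unfold quad
  push_cast
  field_simp

theorem cross_div (s : ℝ) {z : ℂ} (hz : z ≠ 0) :
    cross s z / ‖z‖ ^ 2 = √((‖shift s z / z‖ ^ 2 * ‖quad s z / z ^ 2‖ +
      ((shift s z / z) ^ 2 * conj (quad s z / z ^ 2)).re) / 2) := by
  have hn : ‖z‖ ≠ 0 := norm_ne_zero_iff.2 hz
  have hc : conj z ≠ 0 := by simpa using hz
  have e : (shift s z / z) ^ 2 * conj (quad s z / z ^ 2) =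
      (((‖z‖ ^ 4)⁻¹ : ℝ) : ℂ) * (shift s z ^ 2 * conj (quad s z)) := by
    have : ((‖z‖ ^ 4 : ℝ) : ℂ) = (z * conj z) ^ 2 := by
      rw [Complex.mul_conj, Complex.normSq_eq_norm_sq]; push_cast; ring
    rw [Complex.ofReal_inv, this, map_div₀, map_pow]
    field_simp
  rw [e, Complex.re_ofReal_mul, norm_div, norm_div, norm_pow]
  have : (‖shift s z‖ / ‖z‖) ^ 2 * (‖quad s z‖ / ‖z‖ ^ 2) +
      (‖z‖ ^ 4)⁻¹ * (shift s z ^ 2 * conj (quad s z)).re =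
      (‖shift s z‖ ^ 2 * ‖quad s z‖ + (shift s z ^ 2 * conj (quad s z)).re) / (‖z‖ ^ 2) ^ 2 := by
    field_simp
  rw [this, div_right_comm, Real.sqrt_div' _ (by positivity), Real.sqrt_sq (by positivity)]
  rfl

/-- At infinity the dominant root satisfies `r ~ A ~ z`, so `|A + 2r| / |A + r|² ~ 3|z| / (2|z|)²`.
-/
theorem tendsto_norm_mul_lowMod (s : ℝ) :
    Tendsto (fun z : ℂ => ‖z‖ * lowMod s z) (Bornology.cobounded ℂ) (𝓝 (3 / 4)) := by
  have hA := tendsto_shift_div s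
  have hS := tendsto_quad_div s
  have ha : Tendsto (fun z : ℂ => cross s z / ‖z‖ ^ 2) (Bornology.cobounded ℂ) (𝓝 1) := by
    have h1 := (Complex.continuous_re.tendsto _).comp
      ((hA.pow 2).mul ((Complex.continuous_conj.tendsto _).comp hS))
    have h2 := (((hA.norm.pow 2).mul hS.norm).add h1).div_const 2
    have h3 := (Real.continuous_sqrt.tendsto _).comp h2
    norm_num at h3
    refine h3.congr' ?_
    filter_upwards [Bornology.eventually_ne_cobounded (0 : ℂ)] with z hz
    rw [cross_div s hz]
    simp [div_pow]
  have hn := hA.norm.pow 2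
  have hm := hS.norm
  have hnum := (Real.continuous_sqrt.tendsto _).comp
    ((hn.add (hm.const_mul 4)).add (ha.const_mul 4))
  have hden := (hn.add hm).add (ha.const_mul 2)
  have h := hnum.div hden (by norm_num)
  have e9 : √9 = 3 := by rw [show (9 : ℝ) = 3 ^ 2 by norm_num, Real.sqrt_sq (by norm_num)]
  norm_num [e9] at h
  refine h.congr' ?_
  filter_upwards [Bornology.eventually_ne_cobounded (0 : ℂ)] with z hz
  have hzn : ‖z‖ ≠ 0 := norm_ne_zero_iff.2 hz
  simp only [Function.comp_apply, Pi.div_apply]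
  unfold lowMod
  have e1 : (‖shift s z‖ / ‖z‖) ^ 2 + 4 * (‖quad s z‖ / ‖z‖ ^ 2) + 4 * (cross s z / ‖z‖ ^ 2) =
      (‖shift s z‖ ^ 2 + 4 * ‖quad s z‖ + 4 * cross s z) / ‖z‖ ^ 2 := by field_simp
  have e2 : (‖shift s z‖ / ‖z‖) ^ 2 + (‖quad s z‖ / ‖z‖ ^ 2) + 2 * (cross s z / ‖z‖ ^ 2) =
      (‖shift s z‖ ^ 2 + ‖quad s z‖ + 2 * cross s z) / ‖z‖ ^ 2 := by field_simp
  rw [e1, e2, Real.sqrt_div' _ (by positivity), Real.sqrt_sq (norm_nonneg z)]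
  field_simp

theorem tendsto_lowMod_ratio (s : ℝ) :
    Tendsto (fun z : ℂ => lowMod s z * (lowMod s (-z))⁻¹) (Bornology.cobounded ℂ) (𝓝 1) := by
  have h1 := tendsto_norm_mul_lowMod s
  have h2 : Tendsto (fun z : ℂ => ‖-z‖ * lowMod s (-z)) (Bornology.cobounded ℂ) (𝓝 (3 / 4)) :=
    h1.comp tendsto_neg_cobounded
  have h3 := h1.div h2 (by norm_num)
  rw [div_self (by norm_num)] at h3
  refine h3.congr' ?_
  filter_upwards [Bornology.eventually_ne_cobounded (0 : ℂ)] with z hz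
  have hzn : ‖z‖ ≠ 0 := norm_ne_zero_iff.2 hz
  simp only [Pi.div_apply, norm_neg]
  rw [mul_div_mul_left _ _ hzn, div_eq_mul_inv]

/-- Compactness of superlevel sets from continuity on the closed half-plane, a bound by `1` on the
imaginary axis and the behaviour at infinity. -/
theorem isCompact_superlevel {u : ℂ → ℝ} {T : Set ℂ} (hT : IsClosed T) (hu : ContinuousOn u T)
    (hlim : ∀ c : ℝ, 1 < c → ∀ᶠ z in Bornology.cobounded ℂ, z ∈ T → u z < c) {c : ℝ} (hc : 1 < c) :
    IsCompact {z | z ∈ T ∧ c ≤ u z} := by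
  refine Metric.isCompact_of_isClosed_isBounded (hu.preimage_isClosed_of_isClosed hT isClosed_Ici) ?_
  have := hlim c hc
  rw [Filter.Eventually, ← Bornology.isCobounded_def, ← Bornology.isBounded_compl_iff] at this
  refine this.subset ?_
  rintro z ⟨hzT, hz⟩ hcon
  exact absurd (hcon hzT) (not_lt.2 hz)

theorem isOpen_rightHalf : IsOpen {z : ℂ | 0 < z.re} :=
  isOpen_lt continuous_const Complex.continuous_re

theorem isPreconnected_rightHalf : IsPreconnected {z : ℂ | 0 < z.re} :=
  (convex_halfSpace_re_gt 0).isPreconnected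

/-- Let `u` be the quotient of the two sides. It is 1 on the imaginary axis, where `-z` is the
conjugate of `z`, and tends to 1 at infinity. Wherever `u ≥ 1` in the half-plane it has a
holomorphic support: the numerator because `cross > 0`, the denominator because zeros of `quad` at
`-z` force `u < 1`. Hence `u ≤ 1`, and the set `u = 1` is open; by connectedness it is empty, since
`u < 1` at `ctr s`. -/
theorem lowMod_lt {s : ℝ} (hs : 1 / 3 < s) (hs1 : s ≤ 1) {z : ℂ} (hz : 0 < z.re) :
    lowMod s z < lowMod s (-z) := by
  set u : ℂ → ℝ := fun z => lowMod s z * (lowMod s (-z))⁻¹ with hu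
  have hcu : Continuous u := (continuous_lowMod hs).mul
    (((continuous_lowMod hs).comp continuous_neg).inv₀ fun z => (lowMod_pos hs _).ne')
  have hlt : ∀ w, u w < 1 ↔ lowMod s w < lowMod s (-w) := fun w => by
    rw [hu]; simp only; rw [← div_eq_mul_inv, div_lt_one (lowMod_pos hs _)]
  have hsup : ∀ w : ℂ, 0 < w.re → 1 ≤ u w → HasHolSupport u w := by
    intro w hw h1
    refine (hasHolSupport_lowMod hs (cross_pos_of_re_nonneg hs hs1 hw.le)).mul ?_
    refine HasHolSupport.comp_neg (u := fun z => (lowMod s z)⁻¹) (hasHolSupport_inv_lowMod hs ?_)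
    intro h0
    have := (hlt w).2 (lowMod_lt_of_quad_neg_eq_zero hs hs1 h0)
    linarith
  have haxis : ∀ w : ℂ, w.re = 0 → u w = 1 := by
    intro w hw
    simp only [hu]
    rw [neg_eq_conj hw, lowMod_conj, mul_inv_cancel₀ (lowMod_pos hs _).ne']
  have hle : ∀ w : ℂ, 0 < w.re → u w ≤ 1 := by
    intro w hw
    refine le_one_of_hasHolSupport isOpen_rightHalf hcu.continuousOn
      (fun y hy h => hsup y hy h.le) (fun c hc => ?_) hw
    have := isCompact_superlevel (u := u) (T := {z : ℂ | 0 ≤ z.re})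
      (isClosed_le continuous_const Complex.continuous_re) hcu.continuousOn
      (fun c hc => by
        filter_upwards [(tendsto_lowMod_ratio s).eventually (gt_mem_nhds hc)] with z h _ using h) hc
    convert this using 1
    ext y
    simp only [mem_ofPred_eq]
    constructor
    · rintro ⟨h1, h2⟩; exact ⟨h1.le, h2⟩
    · rintro ⟨h1, h2⟩
      refine ⟨lt_of_le_of_ne h1 fun h => ?_, h2⟩
      rw [haxis y h.symm] at h2
      linarith
  rw [← hlt]
  by_contra! hcon
  have hO1 : IsOpen {w : ℂ | u w < 1} := isOpen_lt hcu continuous_const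
  have hO2 : IsOpen {w : ℂ | 0 < w.re ∧ u w = 1} := by
    rw [isOpen_iff_mem_nhds]
    rintro w ⟨hw, hw1⟩
    have := (hsup w hw hw1.ge).eventually_eq (by
      filter_upwards [isOpen_rightHalf.mem_nhds hw] with y hy
      rw [hw1]; exact hle y hy)
    filter_upwards [this, isOpen_rightHalf.mem_nhds hw] with y h1 h2
    exact ⟨h2, by rw [h1, hw1]⟩
  obtain ⟨y, -, hy1, hy2⟩ := isPreconnected_rightHalf _ _ hO1 hO2
    (fun w hw => (hle w hw).lt_or_eq.imp id fun h => ⟨hw, h⟩)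
    ⟨ctr s, by simpa using ctr_pos hs, (hlt _).2 (lowMod_ctr_lt hs)⟩
    ⟨z, hz, hz, le_antisymm (hle z hz) hcon⟩
  exact absurd hy2.2 hy1.ne

/-! ### The dominant root and the primitive of the differential -/

/-- The square root of the quadratic with nonnegative real part of `A * conj r`. -/
def root (s : ℝ) (z : ℂ) : ℂ := (exists_root s z).choose

theorem root_sq (s : ℝ) (z : ℂ) : root s z ^ 2 = quad s z := (exists_root s z).choose_spec.1

theorem root_re_nonneg (s : ℝ) (z : ℂ) : 0 ≤ (shift s z * conj (root s z)).re :=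
  (exists_root s z).choose_spec.2

theorem cross_eq_root (s : ℝ) (z : ℂ) : cross s z = (shift s z * conj (root s z)).re :=
  cross_eq (root_sq s z) (root_re_nonneg s z)

theorem eq_root {s : ℝ} {z r : ℂ} (hr : r ^ 2 = quad s z) (h : 0 < (shift s z * conj r).re) :
    r = root s z := by
  rcases sq_eq_sq_iff_eq_or_eq_neg.1 (hr.trans (root_sq s z).symm) with h1 | h1
  · exact h1
  · have := root_re_nonneg s z
    rw [h1, map_neg, mul_neg, Complex.neg_re] at h
    linarith

theorem analyticAt_root {s : ℝ} {z : ℂ} (h : 0 < cross s z) : AnalyticAt ℂ (root s) z := by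
  obtain ⟨r, hra, hr⟩ := exists_local_root h
  exact hra.congr (hr.mono fun w hw => eq_root hw.1 hw.2)

theorem hasDerivAt_shift (s : ℝ) (z : ℂ) : HasDerivAt (shift s) 1 z := by
  unfold shift; simpa using (hasDerivAt_id z).add_const (ctr s : ℂ)

theorem hasDerivAt_quad (s : ℝ) (z : ℂ) :
    HasDerivAt (quad s) (2 * shift s z - ((3 / 2 * ctr s : ℝ) : ℂ)) z := by
  have h := hasDerivAt_shift s z
  have := ((h.fun_pow 2).fun_sub (h.const_mul ((3 / 2 * ctr s : ℝ) : ℂ))).add_const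
    ((3 / 2 * ctr s * s : ℝ) : ℂ)
  exact this.congr_deriv (by simp)

theorem hasDerivAt_of_sq_eq {f : ℂ → ℂ} {s : ℝ} {z : ℂ} (hf : AnalyticAt ℂ f z)
    (h : ∀ᶠ w in 𝓝 z, f w ^ 2 = quad s w) (h0 : f z ≠ 0) :
    HasDerivAt f ((2 * shift s z - ((3 / 2 * ctr s : ℝ) : ℂ)) / (2 * f z)) z := by
  have h1 := hf.differentiableAt.hasDerivAt
  have h2 : HasDerivAt (fun w => f w ^ 2) (2 * shift s z - ((3 / 2 * ctr s : ℝ) : ℂ)) z :=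
    (hasDerivAt_quad s z).congr_of_eventuallyEq h
  have h3 := (h1.fun_pow 2).unique h2
  simp only [Nat.cast_ofNat, Nat.add_one_sub_one, pow_one] at h3
  refine h1.congr_deriv ?_
  rw [← h3]
  field_simp

theorem root_ne_zero {s : ℝ} {z : ℂ} (h : quad s z ≠ 0) : root s z ≠ 0 := by
  intro h0
  apply h
  rw [← root_sq, h0]; simp

theorem hasDerivAt_root {s : ℝ} {z : ℂ} (h : 0 < cross s z) :
    HasDerivAt (root s) ((2 * shift s z - ((3 / 2 * ctr s : ℝ) : ℂ)) / (2 * root s z)) z :=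
  hasDerivAt_of_sq_eq (analyticAt_root h) (Eventually.of_forall (root_sq s))
    (root_ne_zero (quad_ne_zero_of_cross_pos h))

/-- The ratio whose modulus compares the two branches. -/
def ratio (A r : ℂ) : ℂ := ((A + 2 * r) * (A - r) ^ 2) / ((A - 2 * r) * (A + r) ^ 2)

/-- A square root of `Q` built from a root `r` of the quadratic. -/
def rootQ (s : ℝ) (z r : ℂ) : ℂ :=
  r * (z + (((1 - s) ^ 2 / 2 : ℝ) : ℂ)) /
    ((z + (((1 + s ^ 2) / 2 : ℝ) : ℂ)) * (z ^ 2 - (((1 - s ^ 2) / 2 : ℝ) : ℂ) ^ 2))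

theorem norm_ratio {s : ℝ} (hs : 1 / 3 < s) {z r : ℂ} (hr : r ^ 2 = quad s z)
    (h : 0 ≤ (shift s z * conj r).re) : ‖ratio (shift s z) r‖ = lowMod s z / highMod s z := by
  rw [lowMod_eq hr h, highMod_eq hs hr h]
  unfold ratio
  rw [norm_div, norm_mul, norm_mul, norm_pow, norm_pow, div_div_div_eq]
  ring

theorem ratio_neg (A r : ℂ) : ratio A (-r) = (ratio A r)⁻¹ := by
  unfold ratio
  rw [inv_div]
  ring

/-- Changing the sign of `r` inverts the ratio, so the squared logarithm does not depend on the
branch and is defined along the whole arc. -/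
theorem log_norm_ratio_sq {s : ℝ} (hs : 1 / 3 < s) {z r : ℂ} (hr : r ^ 2 = quad s z) :
    Real.log ‖ratio (shift s z) r‖ ^ 2 = Real.log (lowMod s z / highMod s z) ^ 2 := by
  by_cases h : 0 ≤ (shift s z * conj r).re
  · rw [norm_ratio hs hr h]
  · have hr2 : (-r) ^ 2 = quad s z := by rw [neg_sq, hr]
    have h2 : 0 ≤ (shift s z * conj (-r)).re := by
      rw [map_neg, mul_neg, Complex.neg_re]; linarith
    have := norm_ratio hs hr2 h2
    rw [ratio_neg, norm_inv] at this
    rw [← this, Real.log_inv]; ring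

theorem rootQ_eq {s : ℝ} (hs : 1 / 3 < s) {z r : ℂ} (hr : r ^ 2 = quad s z) :
    rootQ s z r = -3 * r * ((2 * shift s z - ((3 / 2 * ctr s : ℝ) : ℂ)) * shift s z - 2 * r ^ 2) /
      ((shift s z ^ 2 - r ^ 2) * (shift s z ^ 2 - 4 * r ^ 2)) := by
  have hEc : (ctr s : ℂ) ≠ 0 := Complex.ofReal_ne_zero.2 (ctr_pos hs).ne'
  have c3 : (2 * shift s z - ((3 / 2 * ctr s : ℝ) : ℂ)) * shift s z - 2 * r ^ 2 =
      ((3 / 2 * ctr s : ℝ) : ℂ) * (z + (((1 - s) ^ 2 / 2 : ℝ) : ℂ)) := by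
    rw [hr]; unfold quad shift ctr; push_cast; ring
  rw [c3, hr, shift_sq_sub_quad, shift_sq_sub_four_quad]
  unfold rootQ
  have h3 : ((3 / 2 * ctr s : ℝ) : ℂ) ≠ 0 := by push_cast; simp [hEc]
  generalize ((3 / 2 * ctr s : ℝ) : ℂ) = E at *
  generalize z + (((1 - s) ^ 2 / 2 : ℝ) : ℂ) = u
  generalize z + (((1 + s ^ 2) / 2 : ℝ) : ℂ) = v
  generalize z ^ 2 - (((1 - s ^ 2) / 2 : ℝ) : ℂ) ^ 2 = y
  rw [show -3 * r * (E * u) = (-3 * E) * (r * u) by ring,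
    show E * v * (-3 * y) = (-3 * E) * (v * y) by ring,
    mul_div_mul_left _ _ (mul_ne_zero (by norm_num) h3)]

/-- The logarithmic derivative of the ratio is `-2 Q^{1/2}`. Since `Q^{1/2} dz` is imaginary along a
trajectory, the modulus of the ratio is constant there. -/
theorem hasDerivAt_ratio {s : ℝ} (hs : 1 / 3 < s) {f : ℂ → ℂ} {z : ℂ} (hf : AnalyticAt ℂ f z)
    (h : ∀ᶠ w in 𝓝 z, f w ^ 2 = quad s w) (h0 : quad s z ≠ 0)
    (h1 : shift s z ^ 2 - quad s z ≠ 0) (h4 : shift s z ^ 2 - 4 * quad s z ≠ 0) :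
    HasDerivAt (fun w => ratio (shift s w) (f w))
      (-2 * rootQ s z (f z) * ratio (shift s z) (f z)) z := by
  have hz := h.self_of_nhds
  have hfz : f z ≠ 0 := by intro h'; apply h0; rw [← hz, h']; simp
  have hf' := hasDerivAt_of_sq_eq hf h hfz
  have hA := hasDerivAt_shift s z
  have e1 : shift s z ^ 2 - quad s z = (shift s z + f z) * (shift s z - f z) := by rw [← hz]; ring
  have e4 : shift s z ^ 2 - 4 * quad s z = (shift s z + 2 * f z) * (shift s z - 2 * f z) := by
    rw [← hz]; ring
  rw [e1] at h1
  rw [e4] at h4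
  obtain ⟨n1, n2⟩ := mul_ne_zero_iff.1 h1
  obtain ⟨n3, n4⟩ := mul_ne_zero_iff.1 h4
  unfold ratio
  have hder := ((hA.fun_add (hf'.const_mul 2)).fun_mul ((hA.fun_sub hf').fun_pow 2)).fun_div
    ((hA.fun_sub (hf'.const_mul 2)).fun_mul ((hA.fun_add hf').fun_pow 2))
    (mul_ne_zero n4 (pow_ne_zero 2 n1))
  refine hder.congr_deriv ?_
  rw [rootQ_eq hs hz]
  generalize 2 * shift s z - ((3 / 2 * ctr s : ℝ) : ℂ) = D
  generalize shift s z = A at *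
  generalize f z = r at *
  rw [show A ^ 2 - r ^ 2 = (A + r) * (A - r) by ring,
    show A ^ 2 - 4 * r ^ 2 = (A + 2 * r) * (A - 2 * r) by ring]
  simp only [Nat.cast_ofNat, Nat.add_one_sub_one, pow_one]
  field_simp
  ring

theorem highMod_nonneg {s : ℝ} (hs : 1 / 3 < s) (z : ℂ) : 0 ≤ highMod s z := by
  have := lowMod_pos hs z
  unfold highMod; positivity

theorem highMod_pos {s : ℝ} (hs : 1 / 3 < s) {z : ℂ} (h1 : shift s z ^ 2 - quad s z ≠ 0)
    (h4 : shift s z ^ 2 - 4 * quad s z ≠ 0) : 0 < highMod s z := by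
  have h := lowMod_mul_highMod hs z
  have hl := lowMod_pos hs z
  have h2 : 0 < ‖shift s z ^ 2 - 4 * quad s z‖ / ‖shift s z ^ 2 - quad s z‖ ^ 2 := by
    have := norm_pos_iff.2 h1
    have := norm_pos_iff.2 h4
    positivity
  rw [← h] at h2
  exact (pos_iff_pos_of_mul_pos h2).1 hl

theorem continuousAt_highMod {s : ℝ} (hs : 1 / 3 < s) {z : ℂ}
    (h1 : shift s z ^ 2 - quad s z ≠ 0) : ContinuousAt (highMod s) z := by
  have hl := continuous_lowMod hs
  have hz : z + (((1 + s ^ 2) / 2 : ℝ) : ℂ) ≠ 0 := by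
    intro h0; apply h1; rw [shift_sq_sub_quad, h0, mul_zero]
  unfold highMod
  refine ContinuousAt.div (by fun_prop) (by fun_prop) ?_
  have := ctr_pos hs
  have := lowMod_pos hs z
  have := norm_pos_iff.2 hz
  positivity

theorem norm_sub_root_sq_pos {s : ℝ} {z : ℂ} (h1 : shift s z ^ 2 - quad s z ≠ 0) :
    0 < ‖shift s z‖ ^ 2 + ‖quad s z‖ - 2 * cross s z := by
  have h4 := norm_add_real_mul_sq (shift s z) (root s z) (-1)
  rw [← cross_eq_root] at h4
  have hn : ‖quad s z‖ = ‖root s z‖ ^ 2 := by rw [← root_sq, norm_pow]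
  rw [hn]
  have : ‖shift s z + ((-1 : ℝ) : ℂ) * root s z‖ ≠ 0 := by
    rw [norm_ne_zero_iff]
    intro h0
    apply h1
    rw [← root_sq]
    push_cast at h0
    linear_combination (shift s z + root s z) * h0
  have : 0 < ‖shift s z + ((-1 : ℝ) : ℂ) * root s z‖ ^ 2 := by positivity
  linarith

theorem moduli_cmp' {s : ℝ} (hs : 1 / 3 < s) {z : ℂ} (h1 : shift s z ^ 2 - quad s z ≠ 0) :
    ∃ κ : ℝ, 0 < κ ∧ lowMod s z ^ 2 - highMod s z ^ 2 = κ * (cross s z * disc s z) := by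
  have hz : z + (((1 + s ^ 2) / 2 : ℝ) : ℂ) ≠ 0 := by
    intro h0; apply h1; rw [shift_sq_sub_quad, h0, mul_zero]
  have hp := norm_sub_root_sq_pos h1
  have hq := shift_quad_pos hs z
  have hc := cross_nonneg s z
  refine ⟨8 / ((‖shift s z‖ ^ 2 + ‖quad s z‖ + 2 * cross s z) ^ 2 *
          (‖shift s z‖ ^ 2 + ‖quad s z‖ - 2 * cross s z) ^ 2), by positivity, ?_⟩
  rw [moduli_cmp hs hz]; ring

theorem highMod_le_lowMod_iff {s : ℝ} (hs : 1 / 3 < s) {z : ℂ}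
    (h1 : shift s z ^ 2 - quad s z ≠ 0) :
    highMod s z ≤ lowMod s z ↔ 0 ≤ cross s z * disc s z := by
  obtain ⟨κ, hκ, h⟩ := moduli_cmp' hs h1
  rw [← sq_le_sq₀ (highMod_nonneg hs z) (lowMod_pos hs z).le, ← sub_nonneg, h,
    mul_nonneg_iff_of_pos_left hκ]

theorem lowMod_le_highMod_iff {s : ℝ} (hs : 1 / 3 < s) {z : ℂ}
    (h1 : shift s z ^ 2 - quad s z ≠ 0) :
    lowMod s z ≤ highMod s z ↔ cross s z * disc s z ≤ 0 := by
  obtain ⟨κ, hκ, h⟩ := moduli_cmp' hs h1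
  rw [← sq_le_sq₀ (lowMod_pos hs z).le (highMod_nonneg hs z), ← sub_nonpos, h]
  constructor
  · intro h; by_contra! h'; have := mul_pos hκ h'; linarith
  · intro h; exact mul_nonpos_of_nonneg_of_nonpos hκ.le h

theorem disc_neg_of_cross_eq_zero {s : ℝ} (hs : 1 / 3 < s) {z : ℂ} (h : cross s z = 0)
    (hq : quad s z ≠ 0) : disc s z < 0 := by
  unfold disc
  rw [h]
  have h1 := shift_quad_pos hs z
  have h2 : 0 < ‖quad s z‖ := norm_pos_iff.2 hq
  have := mul_pos h2 h1
  nlinarith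

theorem cross_eq_zero_of_quad {s : ℝ} {z : ℂ} (h : quad s z = 0) : cross s z = 0 := by
  unfold cross; rw [h]; simp

theorem hasDerivAt_log_norm {f : ℝ → ℂ} {f' : ℂ} {t : ℝ} (hf : HasDerivAt f f' t)
    (h0 : f t ≠ 0) : HasDerivAt (fun x => Real.log ‖f x‖) (f' / f t).re t := by
  have h1 := hf.norm_sq
  have h2 : ‖f t‖ ^ 2 ≠ 0 := by have := norm_pos_iff.2 h0; positivity
  have h3 := (h1.log h2).div_const 2
  have e : (fun x => Real.log (‖f x‖ ^ 2) / 2) = fun x => Real.log ‖f x‖ := by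
    funext x; rw [Real.log_pow]; push_cast; ring
  rw [e] at h3
  refine h3.congr_deriv ?_
  rw [Complex.inner, Complex.div_re, ← Complex.normSq_eq_norm_sq, Complex.mul_re, Complex.conj_re,
    Complex.conj_im]
  have h4 : Complex.normSq (f t) ≠ 0 := by rwa [Complex.normSq_eq_norm_sq]
  field_simp
  ring

theorem shift_ne_zero_of_quad {z : ℂ} {s : ℝ} (hs : 1 / 3 < s) (h : quad s z = 0) :
    shift s z ≠ 0 := by
  have := shift_quad_pos hs z
  rw [h, norm_zero, add_zero] at this
  intro h0
  rw [h0] at this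
  simp at this

/-! ### Critical trajectories lie on the zero set of the discriminant -/

/-- A critical trajectory joining the two zeros of the quadratic, in normalized form. -/
structure CriticalArc (s : ℝ) (γ : ℝ → ℂ) : Prop where
  s_gt : 1 / 3 < s
  s_le : s ≤ 1
  cont : ContinuousOn γ (Icc 0 1)
  inj : InjOn γ (Icc 0 1)
  source : quad s (γ 0) = 0
  target : quad s (γ 1) = 0
  source_im : (γ 0).im < 0
  target_im : 0 < (γ 1).im
  contDiff : ContDiffOn ℝ 1 γ (Ioo 0 1)
  re_eq_zero : ∀ t ∈ Ioo (0 : ℝ) 1, (rootQ s (γ t) (root s (γ t)) * deriv γ t).re = 0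
  ne_zero : ∀ t ∈ Ioo (0 : ℝ) 1, rootQ s (γ t) (root s (γ t)) * deriv γ t ≠ 0
  meets : ∃ t ∈ Ioo (0 : ℝ) 1, (γ t).im = 0 ∧ 0 < (γ t).re

namespace CriticalArc

variable {s : ℝ} {γ : ℝ → ℂ}

theorem hasDerivAt (h : CriticalArc s γ) {t : ℝ} (ht : t ∈ Ioo (0 : ℝ) 1) :
    HasDerivAt γ (deriv γ t) t :=
  ((h.contDiff.differentiableOn one_ne_zero).differentiableAt (isOpen_Ioo.mem_nhds ht)).hasDerivAt

theorem nondeg (h : CriticalArc s γ) {t : ℝ} (ht : t ∈ Ioo (0 : ℝ) 1) :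
    quad s (γ t) ≠ 0 ∧ shift s (γ t) ^ 2 - quad s (γ t) ≠ 0 ∧
      shift s (γ t) ^ 2 - 4 * quad s (γ t) ≠ 0 := by
  have h0 := (mul_ne_zero_iff.1 (h.ne_zero t ht)).1
  unfold rootQ at h0
  obtain ⟨h1, h2⟩ := div_ne_zero_iff.1 h0
  obtain ⟨h3, h4⟩ := mul_ne_zero_iff.1 h1
  obtain ⟨h5, h6⟩ := mul_ne_zero_iff.1 h2
  refine ⟨?_, ?_, ?_⟩
  · rw [← root_sq]; exact pow_ne_zero 2 h3
  · rw [shift_sq_sub_quad]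
    refine mul_ne_zero ?_ h5
    have := ctr_pos h.s_gt
    exact Complex.ofReal_ne_zero.2 (by positivity)
  · rw [shift_sq_sub_four_quad]
    exact mul_ne_zero (by norm_num) h6

/-- The squared logarithm of `lowMod / highMod` is continuous on the closed arc, has zero derivative
inside, and vanishes at the initial point, where `r = 0` makes both sheets coincide. -/
theorem moduli_eq (h : CriticalArc s γ) {t : ℝ} (ht : t ∈ Icc (0 : ℝ) 1) :
    lowMod s (γ t) = highMod s (γ t) := by
  have hs := h.s_gt
  have hnd : ∀ x ∈ Icc (0 : ℝ) 1, shift s (γ x) ^ 2 - quad s (γ x) ≠ 0 ∧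
      shift s (γ x) ^ 2 - 4 * quad s (γ x) ≠ 0 := by
    intro x hx
    have key : quad s (γ x) = 0 → shift s (γ x) ^ 2 - quad s (γ x) ≠ 0 ∧
      shift s (γ x) ^ 2 - 4 * quad s (γ x) ≠ 0 := by
      intro h0
      have := shift_ne_zero_of_quad hs h0
      rw [h0]; simp [this]
    rcases eq_or_ne x 0 with rfl | h0
    · exact key h.source
    rcases eq_or_ne x 1 with rfl | h1
    · exact key h.target
    exact (h.nondeg ⟨lt_of_le_of_ne hx.1 h0.symm, lt_of_le_of_ne hx.2 h1⟩).2
  set g : ℝ → ℝ := fun x => Real.log (lowMod s (γ x) / highMod s (γ x)) ^ 2 with hg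
  have hgc : ContinuousOn g (Icc 0 1) := by
    intro x hx
    have hpos := highMod_pos hs (hnd x hx).1 (hnd x hx).2
    have hlow := lowMod_pos hs (γ x)
    have c1 : ContinuousAt (fun z => Real.log (lowMod s z / highMod s z) ^ 2) (γ x) :=
      (((continuous_lowMod hs).continuousAt.div (continuousAt_highMod hs (hnd x hx).1)
        hpos.ne').log (div_pos hlow hpos).ne').pow 2
    exact ContinuousAt.comp_continuousWithinAt (f := γ) c1 (h.cont x hx)
  have hgd : ∀ x ∈ Ioo (0 : ℝ) 1, HasDerivAt g 0 x := by
    intro x hx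
    obtain ⟨n0, n1, n4⟩ := h.nondeg hx
    -- `root` may jump where `cross = 0`, a possibility not yet excluded on the arc. A local
    -- holomorphic root with the same value at `γ x` replaces it.
    obtain ⟨r, hra, hrz, hr⟩ := exists_local_sqrt (analyticAt_quad s (γ x)) n0 (root_sq s (γ x))
    have hd := hasDerivAt_ratio hs hra hr n0 n1 n4
    have hd2 := HasDerivAt.scomp x hd (h.hasDerivAt hx)
    have hval := norm_ratio hs (root_sq s (γ x)) (root_re_nonneg s (γ x))
    have hne : ratio (shift s (γ x)) (r (γ x)) ≠ 0 := by
      rw [hrz, ← norm_ne_zero_iff, hval]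
      exact (div_pos (lowMod_pos hs _) (highMod_pos hs n1 n4)).ne'
    have hd3 := (hasDerivAt_log_norm hd2 hne).fun_pow 2
    have hz0 : (deriv γ x • (-2 * rootQ s (γ x) (r (γ x)) * ratio (shift s (γ x)) (r (γ x))) /
        ((fun w => ratio (shift s w) (r w)) ∘ γ) x).re = 0 := by
      simp only [Function.comp_apply, smul_eq_mul, hrz] at hne ⊢
      have e : deriv γ x * (-2 * rootQ s (γ x) (root s (γ x)) *
          ratio (shift s (γ x)) (root s (γ x))) / ratio (shift s (γ x)) (root s (γ x)) =
          ((-2 : ℝ) : ℂ) * (rootQ s (γ x) (root s (γ x)) * deriv γ x) := by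
        push_cast
        field_simp
      rw [e, Complex.re_ofReal_mul, h.re_eq_zero x hx, mul_zero]
    rw [hz0, mul_zero] at hd3
    refine hd3.congr_of_eventuallyEq ?_
    filter_upwards [(h.hasDerivAt hx).continuousAt.eventually hr] with y hy
    simp only [hg, Function.comp_apply]
    rw [log_norm_ratio_sq hs hy]
  have h00 : g 0 = 0 := by
    simp only [hg]
    have h1 := hnd 0 (by simp)
    have hc := cross_eq_zero_of_quad h.source
    have : lowMod s (γ 0) = highMod s (γ 0) := le_antisymm
      ((lowMod_le_highMod_iff hs h1.1).2 (by rw [hc, zero_mul]))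
      ((highMod_le_lowMod_iff hs h1.1).2 (by rw [hc, zero_mul]))
    rw [this, div_self (highMod_pos hs h1.1 h1.2).ne', Real.log_one]; norm_num
  have hgt : g t = 0 := by
    rcases ht.1.eq_or_lt with h0 | h0
    · rw [← h0, h00]
    · obtain ⟨c, hc, hce⟩ := exists_hasDerivAt_eq_slope g (fun _ => 0) h0
        (hgc.mono (Icc_subset_Icc_right ht.2)) (fun x hx => hgd x ⟨hx.1, hx.2.trans_le ht.2⟩)
      rw [eq_div_iff (by linarith), h00] at hce
      linarith
  have hlow := lowMod_pos hs (γ t)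
  have hpos := highMod_pos hs (hnd t ht).1 (hnd t ht).2
  have := pow_eq_zero_iff (two_ne_zero) |>.1 hgt
  have := Real.eq_one_of_pos_of_log_eq_zero (div_pos hlow hpos) this
  rwa [div_eq_one_iff_eq hpos.ne'] at this

theorem cross_mul_disc (h : CriticalArc s γ) {t : ℝ} (ht : t ∈ Ioo (0 : ℝ) 1) :
    cross s (γ t) * disc s (γ t) = 0 := by
  have h1 := (h.nondeg ht).2.1
  have h2 := h.moduli_eq ⟨ht.1.le, ht.2.le⟩
  exact le_antisymm ((lowMod_le_highMod_iff h.s_gt h1).1 h2.le)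
    ((highMod_le_lowMod_iff h.s_gt h1).1 h2.ge)

/-- Along the arc `cross * disc = 0`, and `cross = 0` forces `disc < 0`. The open arc is thus split
into the disjoint relatively open sets `cross > 0` and `disc < 0`; the crossing of the positive real
axis selects the first. -/
theorem disc_eq_zero (h : CriticalArc s γ) {t : ℝ} (ht : t ∈ Ioo (0 : ℝ) 1) :
    disc s (γ t) = 0 := by
  have hc : ContinuousOn γ (Ioo 0 1) := h.cont.mono Ioo_subset_Icc_self
  have c1 : ContinuousOn (fun x => cross s (γ x)) (Ioo 0 1) := (continuous_cross s).comp_continuousOn hc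
  have c2 : ContinuousOn (fun x => disc s (γ x)) (Ioo 0 1) := (continuous_disc s).comp_continuousOn hc
  obtain ⟨t₁, ht₁, him, hre⟩ := h.meets
  have h1 : 0 < cross s (γ t₁) := cross_pos_of_re_nonneg h.s_gt h.s_le hre.le
  by_contra hcon
  have hO1 := c1.isOpen_inter_preimage isOpen_Ioo isOpen_Ioi (t := Ioi (0 : ℝ))
  have hO2 := c2.isOpen_inter_preimage isOpen_Ioo isOpen_Iio (t := Iio (0 : ℝ))
  have hcov : ∀ x ∈ Ioo (0 : ℝ) 1, 0 < cross s (γ x) ∨ disc s (γ x) < 0 := by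
    intro x hx
    rcases (cross_nonneg s (γ x)).eq_or_lt with h0 | h0
    · exact Or.inr (disc_neg_of_cross_eq_zero h.s_gt h0.symm (h.nondeg hx).1)
    · exact Or.inl h0
  have hdt : disc s (γ t) < 0 := by
    rcases mul_eq_zero.1 (h.cross_mul_disc ht) with h0 | h0
    · exact disc_neg_of_cross_eq_zero h.s_gt h0 (h.nondeg ht).1
    · exact absurd h0 hcon
  obtain ⟨x, hx, ⟨-, hx1⟩, ⟨-, hx2⟩⟩ := isPreconnected_Ioo (a := (0 : ℝ)) (b := 1) _ _ hO1 hO2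
    (fun x hx => (hcov x hx).imp (fun h => ⟨hx, h⟩) (fun h => ⟨hx, h⟩))
    ⟨t₁, ht₁, ht₁, h1⟩ ⟨t, ht, ht, hdt⟩
  rcases mul_eq_zero.1 (h.cross_mul_disc hx) with h0 | h0
  · exact (ne_of_gt hx1) h0
  · exact (ne_of_lt hx2) h0

theorem cross_pos (h : CriticalArc s γ) {t : ℝ} (ht : t ∈ Ioo (0 : ℝ) 1) :
    0 < cross s (γ t) := by
  rcases (cross_nonneg s (γ t)).eq_or_lt with h0 | h0
  · have := disc_neg_of_cross_eq_zero h.s_gt h0.symm (h.nondeg ht).1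
    rw [h.disc_eq_zero ht] at this
    exact absurd this (lt_irrefl _)
  · exact h0

end CriticalArc

/-! ### Passage from `α` to `s = √α` -/

theorem quad_eq_of_sqrt {α : ℝ} (hα : 1 / 9 < α) (hα' : α ≤ 1) (z : ℂ) :
    quad (√α) z = (z - zPlus α) * (z - zMinus α) := by
  have h1 : 1 / 3 < √α := by
    rw [Real.lt_sqrt (by norm_num)]; norm_num; linarith
  have h2 : √α ≤ 1 := Real.sqrt_le_one.2 hα'
  set s := √α with hs
  have hk : (0 : ℝ) ≤ (1 - s / 3) * (3 * s - 1) := mul_nonneg (by linarith) (by linarith)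
  have hk2 := Real.sq_sqrt hk
  unfold zPlus zMinus
  rw [← hs]
  set k := √((1 - s / 3) * (3 * s - 1)) with hkd
  have hk3 : (k : ℂ) ^ 2 = (1 - (s : ℂ) / 3) * (3 * s - 1) := by
    rw [← Complex.ofReal_pow, hk2]; push_cast; ring
  unfold quad shift ctr
  push_cast
  linear_combination (-(9 : ℂ) / 64) * (1 + s) ^ 2 * hk3 +
    (9 / 64 : ℂ) * (1 + s) ^ 2 * (k : ℂ) ^ 2 * Complex.I_sq

theorem Q_eq {α : ℝ} (hα : 1 / 9 < α) (hα' : α ≤ 1) {z r : ℂ} (hr : r ^ 2 = quad (√α) z) :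
    Q α z = rootQ (√α) z r ^ 2 := by
  have hsq : (√α) ^ 2 = α := Real.sq_sqrt (by linarith)
  unfold Q rootQ
  rw [← quad_eq_of_sqrt hα hα', ← hr, div_pow, mul_pow]
  have hb : beta α = (1 - (√α) ^ 2) / 2 := by rw [hsq]; rfl
  have hc : (α : ℂ) + (beta α : ℂ) = (((1 + (√α) ^ 2) / 2 : ℝ) : ℂ) := by
    rw [hsq]; unfold beta; push_cast; ring
  rw [add_assoc z, hc, hb]
  congr 1
  ring

theorem ParametrizesSigmaZero.criticalArc {α : ℝ} (hα : 1 / 9 < α) (hα' : α ≤ 1) {γ : ℝ → ℂ}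
    (h : ParametrizesSigmaZero α γ) : CriticalArc (√α) γ := by
  have h1 : 1 / 3 < √α := by
    rw [Real.lt_sqrt (by norm_num)]; norm_num; linarith
  have h2 : √α ≤ 1 := Real.sqrt_le_one.2 hα'
  have hT := h.isTrajectoryArc
  have hk : (0 : ℝ) < (1 - √α / 3) * (3 * √α - 1) := mul_pos (by linarith) (by linarith)
  have hk2 := Real.sqrt_pos.2 hk
  have key : ∀ t ∈ Ioo (0 : ℝ) 1,
      (rootQ (√α) (γ t) (root (√α) (γ t)) * deriv γ t).re = 0 ∧
      rootQ (√α) (γ t) (root (√α) (γ t)) * deriv γ t ≠ 0 := by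
    intro t ht
    have i0 := hT.im_eq_zero t ht
    have i1 := hT.re_neg t ht
    rw [Q_eq hα hα' (root_sq _ _), ← mul_pow] at i0 i1
    generalize rootQ (√α) (γ t) (root (√α) (γ t)) * deriv γ t = w at *
    rw [pow_two] at i0 i1
    rw [Complex.mul_im] at i0
    rw [Complex.mul_re] at i1
    have hw : w.re * w.im = 0 := by linarith
    rcases mul_eq_zero.1 hw with h | h
    · refine ⟨h, fun h0 => ?_⟩
      rw [h0] at i1; simp at i1
    · rw [h] at i1
      nlinarith [mul_self_nonneg w.re]
  refine ⟨h1, h2, hT.continuousOn, hT.injOn, ?_, ?_, ?_, ?_, hT.contDiffOn,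
    fun t ht => (key t ht).1, fun t ht => (key t ht).2, h.meets_pos_real⟩
  · rw [quad_eq_of_sqrt hα hα', hT.source]; ring
  · rw [quad_eq_of_sqrt hα hα', hT.target]; ring
  · rw [hT.source]
    unfold zMinus
    rw [Complex.im_ofReal_mul]
    refine mul_neg_of_pos_of_neg (by linarith) ?_
    rw [Complex.sub_im, Complex.im_mul_ofReal, Complex.ofReal_im]
    have : (3 * Complex.I / 8 : ℂ).im = 3 / 8 := by norm_num
    rw [this]; linarith
  · rw [hT.target]
    unfold zPlus
    rw [Complex.im_ofReal_mul]
    refine mul_pos (by linarith) ?_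
    rw [Complex.add_im, Complex.im_mul_ofReal, Complex.ofReal_im]
    have : (3 * Complex.I / 8 : ℂ).im = 3 / 8 := by norm_num
    rw [this]; linarith

/-! ### Rational uniformization of the square root -/

/-- Notation: `k² = 3E/(2s)`, which lies in `[3, 4)`, and `e² = 4 - k²`. The unimodular numbers `τ =
(e + ik)/2` and `σ = e + i√(1 - e²)` satisfy `τ + τ̄ = e` and `σ + σ̄ = 2e`. The coordinate will
satisfy `ξ + 1/ξ = e A / r`, so `A = -r` corresponds to `ξ = -τ, -τ̄`, and `A = -2r` to `ξ = -σ,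
-σ̄`. -/
def uniE (s : ℝ) : ℝ := √(4 - 3 * ctr s / (2 * s))

def uniK (s : ℝ) : ℝ := √(3 * ctr s / (2 * s))

def uniTau (s : ℝ) : ℂ := ((uniE s / 2 : ℝ) : ℂ) + ((uniK s / 2 : ℝ) : ℂ) * Complex.I

def uniSigma (s : ℝ) : ℂ := (uniE s : ℂ) + (√(1 - uniE s ^ 2) : ℂ) * Complex.I

theorem uniK_sq {s : ℝ} (hs : 1 / 3 < s) : uniK s ^ 2 = 3 * ctr s / (2 * s) := by
  have := ctr_pos hs
  exact Real.sq_sqrt (by positivity)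

theorem uniK_sq_mul {s : ℝ} (hs : 1 / 3 < s) : uniK s ^ 2 * s = 3 / 2 * ctr s := by
  have : s ≠ 0 := by linarith
  rw [uniK_sq hs]; field_simp

theorem uniK_pos {s : ℝ} (hs : 1 / 3 < s) : 0 < uniK s := by
  have := ctr_pos hs
  exact Real.sqrt_pos.2 (by positivity)

theorem uniE_arg_pos {s : ℝ} (hs : 1 / 3 < s) (hs1 : s ≤ 1) : 0 < 4 - 3 * ctr s / (2 * s) := by
  have := three_mul_ctr_lt hs hs1
  have h : 0 < 2 * s := by linarith
  rw [sub_pos, div_lt_iff₀ h]; linarith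

theorem uniE_pos {s : ℝ} (hs : 1 / 3 < s) (hs1 : s ≤ 1) : 0 < uniE s :=
  Real.sqrt_pos.2 (uniE_arg_pos hs hs1)

theorem uniE_sq {s : ℝ} (hs : 1 / 3 < s) (hs1 : s ≤ 1) : uniE s ^ 2 = 4 - uniK s ^ 2 := by
  rw [uniK_sq hs]
  exact Real.sq_sqrt (uniE_arg_pos hs hs1).le

theorem uniE_le_one {s : ℝ} (hs : 1 / 3 < s) (hs1 : s ≤ 1) : uniE s ^ 2 ≤ 1 := by
  have h : 0 < 2 * s := by linarith
  rw [uniE_sq hs hs1, uniK_sq hs]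
  have : 3 ≤ 3 * ctr s / (2 * s) := by
    rw [le_div_iff₀ h]; have := two_mul_le_ctr s; linarith
  linarith

theorem uniTau_re (s : ℝ) : (uniTau s).re = uniE s / 2 := by simp [uniTau]
theorem uniTau_im (s : ℝ) : (uniTau s).im = uniK s / 2 := by simp [uniTau]
theorem uniSigma_re (s : ℝ) : (uniSigma s).re = uniE s := by simp [uniSigma]
theorem uniSigma_im (s : ℝ) : (uniSigma s).im = √(1 - uniE s ^ 2) := by simp [uniSigma]

theorem uniTau_add_conj (s : ℝ) : uniTau s + conj (uniTau s) = uniE s := by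
  rw [Complex.add_conj, uniTau_re]; push_cast; ring

theorem uniTau_sub_conj (s : ℝ) : uniTau s - conj (uniTau s) = uniK s * Complex.I := by
  rw [Complex.sub_conj, uniTau_im]; push_cast; ring

theorem uniTau_mul_conj {s : ℝ} (hs : 1 / 3 < s) (hs1 : s ≤ 1) :
    uniTau s * conj (uniTau s) = 1 := by
  rw [Complex.mul_conj, Complex.normSq_apply, uniTau_re, uniTau_im]
  have := uniE_sq hs hs1
  rw [← Complex.ofReal_one, Complex.ofReal_inj]; linear_combination this / 4

theorem uniSigma_add_conj (s : ℝ) : uniSigma s + conj (uniSigma s) = 2 * uniE s := by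
  rw [Complex.add_conj, uniSigma_re]; push_cast; ring

theorem uniSigma_mul_conj {s : ℝ} (hs : 1 / 3 < s) (hs1 : s ≤ 1) :
    uniSigma s * conj (uniSigma s) = 1 := by
  rw [Complex.mul_conj, Complex.normSq_apply, uniSigma_re, uniSigma_im]
  have := uniE_le_one hs hs1
  have h := Real.sq_sqrt (show 0 ≤ 1 - uniE s ^ 2 by linarith)
  rw [← Complex.ofReal_one, Complex.ofReal_inj]; linear_combination h

theorem norm_eq_one_of_mul_conj {p : ℂ} (h : p * conj p = 1) : ‖p‖ = 1 := by
  rw [Complex.mul_conj, Complex.normSq_eq_norm_sq, ← Complex.ofReal_one, Complex.ofReal_inj] at h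
  exact (pow_eq_one_iff_of_nonneg (norm_nonneg p) two_ne_zero).1 h

/-- The numerator of the square of the uniformizing coordinate. -/
def numer (s : ℝ) (z : ℂ) : ℂ := uniTau s * shift s z - Complex.I * uniK s * s

/-- The denominator of the square of the uniformizing coordinate. -/
def denom (s : ℝ) (z : ℂ) : ℂ := conj (uniTau s) * shift s z + Complex.I * uniK s * s

theorem numer_mul_denom {s : ℝ} (hs : 1 / 3 < s) (hs1 : s ≤ 1) (z : ℂ) :
    numer s z * denom s z = quad s z := by
  have h1 := uniTau_mul_conj hs hs1
  have h2 := uniTau_sub_conj s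
  have h3 : (uniK s : ℂ) ^ 2 * s = 3 / 2 * ctr s := by
    have := congrArg (fun x : ℝ => (x : ℂ)) (uniK_sq_mul hs)
    push_cast at this; exact this
  unfold numer denom quad
  push_cast
  linear_combination (shift s z) ^ 2 * h1 + Complex.I * uniK s * s * shift s z * h2 +
    (s - shift s z) * h3 +
    (shift s z * uniK s ^ 2 * s - (uniK s * s) ^ 2 : ℂ) * Complex.I_sq

theorem numer_add_denom (s : ℝ) (z : ℂ) : numer s z + denom s z = uniE s * shift s z := by
  unfold numer denom; linear_combination shift s z * uniTau_add_conj s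

theorem numer_sub_denom (s : ℝ) (z : ℂ) :
    numer s z - denom s z = Complex.I * uniK s * (shift s z - 2 * s) := by
  unfold numer denom; linear_combination shift s z * uniTau_sub_conj s

theorem hasDerivAt_numer (s : ℝ) (z : ℂ) : HasDerivAt (numer s) (uniTau s) z := by
  have := ((hasDerivAt_shift s z).const_mul (uniTau s)).sub_const (Complex.I * uniK s * s)
  exact this.congr_deriv (by ring)

theorem continuous_numer (s : ℝ) : Continuous (numer s) := by
  have := continuous_shift s; unfold numer; fun_prop

theorem continuous_denom (s : ℝ) : Continuous (denom s) := by
  have := continuous_shift s; unfold denom; fun_prop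

/-- Since `ξ² = numer / denom`, this says that the real axis corresponds to the unit circle and the
lower half-plane to its exterior. -/
theorem normSq_numer_sub_denom (s : ℝ) (z : ℂ) :
    Complex.normSq (numer s z) - Complex.normSq (denom s z) = -2 * uniK s * s * uniE s * z.im := by
  have hA : (shift s z).im = z.im := by simp [shift]
  rw [← hA]
  unfold numer denom
  simp only [Complex.normSq_apply, Complex.sub_re, Complex.add_re, Complex.mul_re, Complex.sub_im,
    Complex.add_im, Complex.mul_im, Complex.conj_re, Complex.conj_im, uniTau_re, uniTau_im,
    Complex.I_re, Complex.I_im, Complex.ofReal_re, Complex.ofReal_im]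
  ring

/-- The imaginary part of the square of the uniformizing coordinate, up to a positive factor. -/
def circ (s : ℝ) (z : ℂ) : ℝ := ‖shift s z‖ ^ 2 - 2 * s * (shift s z).re

theorem numer_mul_conj_denom_im (s : ℝ) (z : ℂ) :
    (numer s z * conj (denom s z)).im = uniE s * uniK s / 2 * circ s z := by
  unfold numer denom circ
  rw [← Complex.normSq_eq_norm_sq]
  simp only [Complex.normSq_apply, Complex.sub_re, Complex.add_re, Complex.mul_re, Complex.sub_im,
    Complex.add_im, Complex.mul_im, Complex.conj_re, Complex.conj_im, uniTau_re, uniTau_im,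
    Complex.I_re, Complex.I_im, Complex.ofReal_re, Complex.ofReal_im]
  ring

/-- The uniformizing coordinate attached to a point and a root of the quadratic there. -/
def coord (s : ℝ) (z r : ℂ) : ℂ := numer s z / r

section coord

variable {s : ℝ} {z r : ℂ}

theorem coord_sq (hs : 1 / 3 < s) (hs1 : s ≤ 1) (hr : r ^ 2 = quad s z) (hr0 : r ≠ 0) :
    coord s z r ^ 2 * denom s z = numer s z := by
  have h := numer_mul_denom hs hs1 z
  unfold coord
  rw [← hr] at h
  field_simp
  linear_combination numer s z * h

theorem coord_inv (hs : 1 / 3 < s) (hs1 : s ≤ 1) (hr : r ^ 2 = quad s z) (hr0 : r ≠ 0) :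
    (coord s z r)⁻¹ = denom s z / r := by
  have h := numer_mul_denom hs hs1 z
  rw [← hr] at h
  have : numer s z ≠ 0 := by
    intro h0; rw [h0, zero_mul] at h; exact hr0 (pow_eq_zero_iff two_ne_zero |>.1 h.symm)
  unfold coord
  rw [inv_div]
  field_simp
  linear_combination -h

theorem coord_ne_zero (hs : 1 / 3 < s) (hs1 : s ≤ 1) (hr : r ^ 2 = quad s z) (hr0 : r ≠ 0) :
    coord s z r ≠ 0 := by
  have h := numer_mul_denom hs hs1 z
  rw [← hr] at h
  have : numer s z ≠ 0 := by
    intro h0; rw [h0, zero_mul] at h; exact hr0 (pow_eq_zero_iff two_ne_zero |>.1 h.symm)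
  exact div_ne_zero this hr0

theorem coord_add_inv (hs : 1 / 3 < s) (hs1 : s ≤ 1) (hr : r ^ 2 = quad s z) (hr0 : r ≠ 0) :
    coord s z r + (coord s z r)⁻¹ = uniE s * (shift s z / r) := by
  rw [coord_inv hs hs1 hr hr0, coord, ← add_div, numer_add_denom, mul_div_assoc]

theorem coord_sub_inv (hs : 1 / 3 < s) (hs1 : s ≤ 1) (hr : r ^ 2 = quad s z) (hr0 : r ≠ 0) :
    coord s z r - (coord s z r)⁻¹ = Complex.I * uniK s * ((shift s z - 2 * s) / r) := by
  rw [coord_inv hs hs1 hr hr0, coord, ← sub_div, numer_sub_denom, mul_div_assoc]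

theorem add_inv_re (w : ℂ) : (w + w⁻¹).re = w.re * (1 + (‖w‖ ^ 2)⁻¹) := by
  rw [Complex.add_re, Complex.inv_re, ← Complex.normSq_eq_norm_sq, div_eq_mul_inv]; ring

theorem add_inv_im (w : ℂ) : (w + w⁻¹).im = w.im * (1 - (‖w‖ ^ 2)⁻¹) := by
  rw [Complex.add_im, Complex.inv_im, ← Complex.normSq_eq_norm_sq, div_eq_mul_inv]; ring

theorem sub_inv_im (w : ℂ) : (w - w⁻¹).im = w.im * (1 + (‖w‖ ^ 2)⁻¹) := by
  rw [Complex.sub_im, Complex.inv_im, ← Complex.normSq_eq_norm_sq, div_eq_mul_inv]; ring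

theorem div_re_mul_norm_sq {A : ℂ} (hr0 : r ≠ 0) : (A / r).re * ‖r‖ ^ 2 = (A * conj r).re := by
  have : Complex.normSq r ≠ 0 := by simpa using hr0
  rw [Complex.div_re, ← Complex.normSq_eq_norm_sq, Complex.mul_re, Complex.conj_re,
    Complex.conj_im]
  field_simp
  ring

theorem coord_re_mul (hs : 1 / 3 < s) (hs1 : s ≤ 1) (hr : r ^ 2 = quad s z) (hr0 : r ≠ 0) :
    (coord s z r).re * ((1 + (‖coord s z r‖ ^ 2)⁻¹) * ‖r‖ ^ 2) =
      uniE s * (shift s z * conj r).re := by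
  have h := congrArg Complex.re (coord_add_inv hs hs1 hr hr0)
  rw [add_inv_re, Complex.re_ofReal_mul] at h
  rw [← div_re_mul_norm_sq hr0, ← mul_assoc, h, mul_assoc]

theorem coord_factor_pos (hr0 : r ≠ 0) :
    0 < (1 + (‖coord s z r‖ ^ 2)⁻¹) * ‖r‖ ^ 2 := by
  have := norm_pos_iff.2 hr0
  have : 0 ≤ (‖coord s z r‖ ^ 2)⁻¹ := by positivity
  positivity

/-- The discriminant in the uniformizing coordinate. -/
def discU (s : ℝ) (w : ℂ) : ℝ :=
  w.re ^ 2 * (1 + (‖w‖ ^ 2)⁻¹) ^ 2 - 3 * w.im ^ 2 * (1 - (‖w‖ ^ 2)⁻¹) ^ 2 - 3 * uniE s ^ 2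

/-- The real and imaginary parts of `ξ + 1/ξ = e A / r` express both `cross` and `|A|` through `ξ`,
after division by powers of `|r|`. -/
theorem discU_coord (hs : 1 / 3 < s) (hs1 : s ≤ 1) (hr : r ^ 2 = quad s z) (hr0 : r ≠ 0) :
    discU s (coord s z r) * ‖r‖ ^ 4 = uniE s ^ 2 * disc s z := by
  have h1 := congrArg Complex.re (coord_add_inv hs hs1 hr hr0)
  have h2 := congrArg Complex.im (coord_add_inv hs hs1 hr hr0)
  rw [add_inv_re, Complex.re_ofReal_mul] at h1
  rw [add_inv_im, Complex.im_ofReal_mul] at h2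
  have hq : ‖quad s z‖ = ‖r‖ ^ 2 := by rw [← hr, norm_pow]
  have hc : cross s z ^ 2 = (shift s z * conj r).re ^ 2 := cross_sq_eq hr
  have hA : ‖shift s z‖ ^ 2 = ((shift s z / r).re ^ 2 + (shift s z / r).im ^ 2) * ‖r‖ ^ 2 := by
    have : (shift s z / r).re ^ 2 + (shift s z / r).im ^ 2 = ‖shift s z / r‖ ^ 2 := by
      rw [← Complex.normSq_eq_norm_sq, Complex.normSq_apply]; ring
    have h0 := norm_pos_iff.2 hr0
    rw [this, norm_div]; field_simp
  unfold discU disc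
  rw [hq, hc, hA, ← div_re_mul_norm_sq hr0]
  have e : (coord s z r).re ^ 2 * (1 + (‖coord s z r‖ ^ 2)⁻¹) ^ 2 -
      3 * (coord s z r).im ^ 2 * (1 - (‖coord s z r‖ ^ 2)⁻¹) ^ 2 =
      ((coord s z r).re * (1 + (‖coord s z r‖ ^ 2)⁻¹)) ^ 2 -
      3 * ((coord s z r).im * (1 - (‖coord s z r‖ ^ 2)⁻¹)) ^ 2 := by ring
  rw [e, h1, h2]
  ring

theorem coord_sq_im_mul (hs : 1 / 3 < s) (hs1 : s ≤ 1) (hr : r ^ 2 = quad s z) (hr0 : r ≠ 0) :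
    2 * ((coord s z r).re * (coord s z r).im) * Complex.normSq (denom s z) =
      uniE s * uniK s / 2 * circ s z := by
  rw [← numer_mul_conj_denom_im, ← coord_sq hs hs1 hr hr0,
    mul_assoc (coord s z r ^ 2), Complex.mul_conj,
    Complex.im_mul_ofReal]
  congr 1
  rw [pow_two, Complex.mul_im]; ring

theorem normSq_denom_pos (hs : 1 / 3 < s) (hs1 : s ≤ 1) (hr : r ^ 2 = quad s z) (hr0 : r ≠ 0) :
    0 < Complex.normSq (denom s z) := by
  rw [Complex.normSq_pos]
  intro h0
  have h := numer_mul_denom hs hs1 z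
  rw [h0, mul_zero, ← hr] at h
  exact hr0 (pow_eq_zero_iff two_ne_zero |>.1 h.symm)

theorem norm_coord_eq_one (hs : 1 / 3 < s) (hs1 : s ≤ 1) (hr : r ^ 2 = quad s z) (hr0 : r ≠ 0)
    (h : ‖coord s z r‖ = 1) : z.im = 0 := by
  have h1 := congrArg Complex.normSq (coord_sq hs hs1 hr hr0)
  have h2 := normSq_numer_sub_denom s z
  rw [map_mul, map_pow, Complex.normSq_eq_norm_sq (coord s z r), h, one_pow, one_pow, one_mul] at h1
  rw [h1, sub_self] at h2
  have := uniK_pos hs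
  have := uniE_pos hs hs1
  have : -2 * uniK s * s * uniE s ≠ 0 := by
    have h3 : 0 < uniK s * s * uniE s := by positivity
    intro h4; nlinarith
  exact (mul_eq_zero.1 h2.symm).resolve_left this

end coord

/-- Points of the first quadrant with equal modulus are ordered by their real parts. -/
theorem mul_conj_im_pos {a b : ℂ} (h : ‖b‖ = ‖a‖) (ha : 0 ≤ a.im) (hb : 0 < b.im)
    (hb' : 0 < b.re) (hab : b.re < a.re) : 0 < (b * conj a).im := by
  have h2 : Complex.normSq b = Complex.normSq a := by
    rw [Complex.normSq_eq_norm_sq, Complex.normSq_eq_norm_sq, h]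
  rw [Complex.normSq_apply, Complex.normSq_apply] at h2
  rw [Complex.mul_im, Complex.conj_re, Complex.conj_im]
  have : a.im < b.im := by nlinarith
  nlinarith

/-- At equal modulus the discriminant increases with the square of the real part. -/
theorem discU_lt_iff {s : ℝ} {a b : ℂ} (h : ‖b‖ = ‖a‖) :
    discU s b < discU s a ↔ b.re ^ 2 < a.re ^ 2 := by
  have h2 : Complex.normSq b = Complex.normSq a := by
    rw [Complex.normSq_eq_norm_sq, Complex.normSq_eq_norm_sq, h]
  rw [Complex.normSq_apply, Complex.normSq_apply] at h2
  unfold discU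
  rw [h]
  set ρ := (‖a‖ ^ 2)⁻¹
  have hρ : 0 ≤ ρ := by positivity
  have hpos : 0 < (1 + ρ) ^ 2 + 3 * (1 - ρ) ^ 2 := by positivity
  have e : a.re ^ 2 * (1 + ρ) ^ 2 - 3 * a.im ^ 2 * (1 - ρ) ^ 2 -
      (b.re ^ 2 * (1 + ρ) ^ 2 - 3 * b.im ^ 2 * (1 - ρ) ^ 2) =
      (a.re ^ 2 - b.re ^ 2) * ((1 + ρ) ^ 2 + 3 * (1 - ρ) ^ 2) := by
    linear_combination (3 * (1 - ρ) ^ 2) * h2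
  constructor
  · intro h3
    by_contra! h4
    nlinarith
  · intro h3
    nlinarith [mul_pos (sub_pos.2 h3) hpos]

theorem pos_of_ne_zero_of_exists_pos {f : ℝ → ℝ} {S : Set ℝ} (hS : IsPreconnected S)
    (hf : ContinuousOn f S) (h0 : ∀ x ∈ S, f x ≠ 0) (h1 : ∃ x ∈ S, 0 < f x) :
    ∀ x ∈ S, 0 < f x := by
  intro x hx
  obtain ⟨y, hy, hy0⟩ := h1
  by_contra! hneg
  obtain ⟨z, hz, hz0⟩ := hS.intermediate_value hx hy hf ⟨hneg, hy0.le⟩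
  exact h0 z hz hz0

/-! ### The arc in the uniformizing coordinate -/

namespace CriticalArc

variable {s : ℝ} {γ : ℝ → ℂ}

/-- The uniformizing coordinate along the arc. -/
def _root_.HexagonMVOP.xi (s : ℝ) (γ : ℝ → ℂ) (t : ℝ) : ℂ := coord s (γ t) (root s (γ t))

theorem root_ne (h : CriticalArc s γ) {t : ℝ} (ht : t ∈ Ioo (0 : ℝ) 1) : root s (γ t) ≠ 0 :=
  root_ne_zero (h.nondeg ht).1

theorem xi_ne (h : CriticalArc s γ) {t : ℝ} (ht : t ∈ Ioo (0 : ℝ) 1) : xi s γ t ≠ 0 :=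
  coord_ne_zero h.s_gt h.s_le (root_sq _ _) (h.root_ne ht)

theorem xi_re_pos (h : CriticalArc s γ) {t : ℝ} (ht : t ∈ Ioo (0 : ℝ) 1) :
    0 < (xi s γ t).re := by
  have h1 := coord_re_mul h.s_gt h.s_le (root_sq s (γ t)) (h.root_ne ht)
  have h2 := mul_pos (uniE_pos h.s_gt h.s_le) (h.cross_pos ht)
  rw [cross_eq_root, ← h1] at h2
  exact (pos_iff_pos_of_mul_pos h2).2 (coord_factor_pos (h.root_ne ht))

theorem discU_xi (h : CriticalArc s γ) {t : ℝ} (ht : t ∈ Ioo (0 : ℝ) 1) :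
    discU s (xi s γ t) = 0 := by
  have h1 := discU_coord h.s_gt h.s_le (root_sq s (γ t)) (h.root_ne ht)
  rw [h.disc_eq_zero ht, mul_zero] at h1
  exact (mul_eq_zero.1 h1).resolve_right (pow_ne_zero 4 (norm_ne_zero_iff.2 (h.root_ne ht)))

/-- On the real `ξ`-axis the discriminant equals `4 + (x - 1/x)² - 3e²`, which is positive because
`e² ≤ 1`. -/
theorem xi_im_ne (h : CriticalArc s γ) {t : ℝ} (ht : t ∈ Ioo (0 : ℝ) 1) :
    (xi s γ t).im ≠ 0 := by
  intro h0
  have h1 := h.discU_xi ht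
  have h2 := h.xi_re_pos ht
  unfold discU at h1
  rw [← Complex.normSq_eq_norm_sq, Complex.normSq_apply, h0] at h1
  generalize (xi s γ t).re = x at *
  have e : x ^ 2 * (1 + (x * x + 0 * 0)⁻¹) ^ 2 = 4 + (x - x⁻¹) ^ 2 := by field_simp; ring
  rw [e] at h1
  have := uniE_le_one h.s_gt h.s_le
  nlinarith [sq_nonneg (x - x⁻¹)]

theorem continuousAt_root (h : CriticalArc s γ) {t : ℝ} (ht : t ∈ Ioo (0 : ℝ) 1) :
    ContinuousAt (root s) (γ t) := (analyticAt_root (h.cross_pos ht)).continuousAt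

/-- The logarithmic derivative of `numer / r` is half the difference of those of `numer` and
`denom`. Both are affine in `z`, so their Wronskian is constant, equal to `i e k s`. -/
theorem hasDerivAt_xi (h : CriticalArc s γ) {t : ℝ} (ht : t ∈ Ioo (0 : ℝ) 1) :
    HasDerivAt (xi s γ) (xi s γ t * (Complex.I * uniE s * uniK s * s) * deriv γ t /
      (2 * root s (γ t) ^ 2)) t := by
  have hr := hasDerivAt_root (h.cross_pos ht)
  have hn := hasDerivAt_numer s (γ t)
  have hr0 := h.root_ne ht
  have hx : HasDerivAt (fun z => coord s z (root s z)) _ (γ t) := hn.fun_div hr hr0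
  have h1 := HasDerivAt.scomp t hx (h.hasDerivAt ht)
  refine h1.congr_deriv ?_
  have hN := numer_mul_denom h.s_gt h.s_le (γ t)
  rw [← root_sq] at hN
  have hq := root_sq s (γ t)
  have hT := uniTau_mul_conj h.s_gt h.s_le
  have hT2 := uniTau_add_conj s
  unfold xi coord
  rw [smul_eq_mul]
  have e : 2 * shift s (γ t) - ((3 / 2 * ctr s : ℝ) : ℂ) =
      uniTau s * denom s (γ t) + conj (uniTau s) * numer s (γ t) := by
    have h3 : (uniK s : ℂ) ^ 2 * s = 3 / 2 * ctr s := by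
      have := congrArg (fun x : ℝ => (x : ℂ)) (uniK_sq_mul h.s_gt)
      push_cast at this; exact this
    unfold numer denom
    push_cast
    linear_combination (-2 * shift s (γ t)) * hT - Complex.I * uniK s * s * uniTau_sub_conj s +
      h3 - (uniK s ^ 2 * s : ℂ) * Complex.I_sq
  have e2 : uniTau s * denom s (γ t) - conj (uniTau s) * numer s (γ t) =
      Complex.I * uniE s * uniK s * s := by
    unfold numer denom
    linear_combination Complex.I * uniK s * s * hT2
  rw [e, ← e2]
  generalize root s (γ t) = r at *
  field_simp
  rw [← hN]
  ring

theorem continuousOn_xi (h : CriticalArc s γ) : ContinuousOn (xi s γ) (Ioo 0 1) :=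
  fun _ ht => (h.hasDerivAt_xi ht).continuousAt.continuousWithinAt

theorem root_real_re_pos {x : ℝ} {r : ℂ} (hs : 1 / 3 < s) (hs1 : s ≤ 1) (hx : 0 < x)
    (hr : r ^ 2 = quad s x) (h : 0 ≤ (shift s x * conj r).re) : 0 < r.re ∧ r.im = 0 := by
  have hE := ctr_pos hs
  have hA : shift s x = ((x + ctr s : ℝ) : ℂ) := by simp [shift]
  rw [hA, Complex.re_ofReal_mul, Complex.conj_re] at h
  have hre : 0 ≤ r.re := nonneg_of_mul_nonneg_right h (by linarith)
  have hq : quad s x = (((x + ctr s) ^ 2 - 3 / 2 * ctr s * (x + ctr s) + 3 / 2 * ctr s * s : ℝ) : ℂ)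
      := by
    unfold quad; rw [hA]; push_cast; ring
  have hpos : 0 < (x + ctr s) ^ 2 - 3 / 2 * ctr s * (x + ctr s) + 3 / 2 * ctr s * s := by
    have := three_mul_ctr_lt hs hs1
    nlinarith [sq_nonneg (x + ctr s - 3 / 4 * ctr s)]
  rw [hq] at hr
  have h1 := congrArg Complex.re hr
  have h2 := congrArg Complex.im hr
  rw [pow_two, Complex.mul_re, Complex.ofReal_re] at h1
  rw [pow_two, Complex.mul_im, Complex.ofReal_im] at h2
  have h3 : r.re * r.im = 0 := by linarith
  rcases mul_eq_zero.1 h3 with h4 | h4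
  · rw [h4] at h1; nlinarith [mul_self_nonneg r.im]
  · refine ⟨lt_of_le_of_ne hre (fun h5 => ?_), h4⟩
    rw [← h5, h4] at h1; linarith

/-- The sign is constant along the arc, so it can be read off at the crossing of the positive axis.
There `r > 0` and `A > 2s`, and `ξ - 1/ξ = i k (A - 2s)/r` has positive imaginary part. -/
theorem xi_im_pos (h : CriticalArc s γ) {t : ℝ} (ht : t ∈ Ioo (0 : ℝ) 1) :
    0 < (xi s γ t).im := by
  refine pos_of_ne_zero_of_exists_pos isPreconnected_Ioo
    (Complex.continuous_im.comp_continuousOn h.continuousOn_xi) (fun x hx => h.xi_im_ne hx) ?_ t ht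
  obtain ⟨t₁, ht₁, him, hre⟩ := h.meets
  refine ⟨t₁, ht₁, ?_⟩
  have hz : γ t₁ = (((γ t₁).re : ℝ) : ℂ) := Complex.ext rfl (by rw [him]; simp)
  have hr := root_sq s (γ t₁)
  have hr' := root_re_nonneg s (γ t₁)
  rw [hz] at hr hr'
  rw [← hz] at hr hr'
  obtain ⟨r1, r2⟩ := root_real_re_pos (r := root s (γ t₁)) h.s_gt h.s_le hre
    (by rw [hr, ← hz]) (by rw [← hz]; exact hr')
  have h1 := congrArg Complex.im (coord_sub_inv h.s_gt h.s_le hr (h.root_ne ht₁))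
  rw [sub_inv_im] at h1
  have hR : root s (γ t₁) = (((root s (γ t₁)).re : ℝ) : ℂ) := Complex.ext rfl (by rw [r2]; simp)
  have hA : shift s (γ t₁) - 2 * s = (((γ t₁).re + ctr s - 2 * s : ℝ) : ℂ) := by
    unfold shift; rw [hz]; simp
  have hv : (Complex.I * uniK s * ((shift s (γ t₁) - 2 * s) / root s (γ t₁))).im =
      uniK s * (((γ t₁).re + ctr s - 2 * s) / (root s (γ t₁)).re) := by
    rw [hA, hR, ← Complex.ofReal_div, mul_assoc, ← Complex.ofReal_mul, Complex.I_mul_im,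
      Complex.ofReal_re]
    simp
  rw [hv] at h1
  have hp : 0 < uniK s * (((γ t₁).re + ctr s - 2 * s) / (root s (γ t₁)).re) := by
    have := two_mul_le_ctr s
    exact mul_pos (uniK_pos h.s_gt) (div_pos (by linarith) r1)
  rw [← h1] at hp
  refine (pos_iff_pos_of_mul_pos hp).2 ?_
  positivity

end CriticalArc

/-- A value of the uniformizing coordinate from which the arc is seen on the left whenever it
crosses the circle through that value. -/
def Separated (s : ℝ) (γ : ℝ → ℂ) (w : ℂ) : Prop :=
  w ≠ 0 ∧ ∀ t ∈ Ioo (0 : ℝ) 1, ‖xi s γ t‖ = ‖w‖ → 0 < (xi s γ t * conj w).im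

namespace CriticalArc

variable {s : ℝ} {γ : ℝ → ℂ}

theorem separated_of_quadrant (h : CriticalArc s γ) {w : ℂ} (hw : w ≠ 0) (h1 : 0 ≤ w.re)
    (h2 : w.im ≤ 0) : Separated s γ w := by
  refine ⟨hw, fun t ht _ => ?_⟩
  have a := h.xi_re_pos ht
  have b := h.xi_im_pos ht
  rw [Complex.mul_im, Complex.conj_re, Complex.conj_im]
  rcases h1.eq_or_lt with h3 | h3
  · have : w.im ≠ 0 := fun h4 => hw (Complex.ext h3.symm h4)
    have : w.im < 0 := lt_of_le_of_ne h2 this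
    rw [← h3]; nlinarith
  · nlinarith [mul_pos b h3]

/-- On a fixed circle `discU` increases with the square of the real part and vanishes on the arc. So
`discU w ≥ 0` places the arc at smaller real part than `w`, hence counterclockwise from it; the next
lemma is the opposite case, where the arc lies clockwise from `w` and so counterclockwise from `-w`.
-/
theorem separated_of_discU_nonneg (h : CriticalArc s γ) {w : ℂ} (h1 : 0 < w.re)
    (h2 : 0 ≤ w.im) (h3 : 0 ≤ discU s w) (h4 : ∀ t ∈ Ioo (0 : ℝ) 1, xi s γ t ≠ w) :
    Separated s γ w := by
  refine ⟨fun h0 => by rw [h0] at h1; simp at h1, fun t ht hn => ?_⟩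
  have a := h.xi_re_pos ht
  have b := h.xi_im_pos ht
  have hle : (xi s γ t).re ≤ w.re := by
    by_contra! hlt
    have := (discU_lt_iff (s := s) hn.symm).2 (pow_lt_pow_left₀ hlt h1.le two_ne_zero)
    rw [h.discU_xi ht] at this; linarith
  rcases hle.eq_or_lt with h5 | h5
  · exfalso
    apply h4 t ht
    have h6 : Complex.normSq (xi s γ t) = Complex.normSq w := by
      rw [Complex.normSq_eq_norm_sq, Complex.normSq_eq_norm_sq, hn]
    rw [Complex.normSq_apply, Complex.normSq_apply, h5] at h6
    refine Complex.ext h5 ?_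
    nlinarith
  · exact mul_conj_im_pos hn h2 b a h5

theorem separated_neg_of_discU_neg (h : CriticalArc s γ) {w : ℂ} (h1 : 0 < w.re)
    (h2 : 0 < w.im) (h3 : discU s w < 0) : Separated s γ (-w) := by
  refine ⟨fun h0 => by rw [neg_eq_zero.1 h0] at h1; simp at h1, fun t ht hn => ?_⟩
  rw [norm_neg] at hn
  have a := h.xi_re_pos ht
  have b := h.xi_im_pos ht
  rw [← h.discU_xi ht] at h3
  have h5 := (discU_lt_iff hn.symm).1 h3
  have h6 : w.re < (xi s γ t).re := lt_of_pow_lt_pow_left₀ 2 a.le h5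
  have := mul_conj_im_pos hn.symm b.le h2 h1 h6
  rw [Complex.mul_im, Complex.conj_re, Complex.conj_im] at this
  rw [map_neg, mul_neg, Complex.neg_im, Complex.mul_im, Complex.conj_re, Complex.conj_im]
  linarith

theorem discU_of_norm_eq_one {w : ℂ} (h : ‖w‖ = 1) : discU s w = 4 * w.re ^ 2 - 3 * uniE s ^ 2 := by
  unfold discU; rw [h]; ring

theorem separated_sigma (h : CriticalArc s γ) : Separated s γ (uniSigma s) := by
  have hn := norm_eq_one_of_mul_conj (uniSigma_mul_conj h.s_gt h.s_le)
  have he := uniE_pos h.s_gt h.s_le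
  have hd : 0 < discU s (uniSigma s) := by
    rw [discU_of_norm_eq_one hn, uniSigma_re]; nlinarith
  refine h.separated_of_discU_nonneg (by rw [uniSigma_re]; exact he)
    (by rw [uniSigma_im]; positivity) hd.le (fun t ht h0 => ?_)
  rw [← h0, h.discU_xi ht] at hd
  exact lt_irrefl _ hd

theorem separated_conj_sigma (h : CriticalArc s γ) : Separated s γ (conj (uniSigma s)) := by
  have he := uniE_pos h.s_gt h.s_le
  refine h.separated_of_quadrant (fun h0 => ?_) ?_ ?_
  · have := congrArg Complex.re h0
    rw [Complex.conj_re, uniSigma_re, Complex.zero_re] at this; linarith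
  · rw [Complex.conj_re, uniSigma_re]; exact he.le
  · rw [Complex.conj_im, uniSigma_im]; have := Real.sqrt_nonneg (1 - uniE s ^ 2); linarith

theorem separated_conj_tau (h : CriticalArc s γ) : Separated s γ (conj (uniTau s)) := by
  have he := uniE_pos h.s_gt h.s_le
  have hk := uniK_pos h.s_gt
  refine h.separated_of_quadrant (fun h0 => ?_) ?_ ?_
  · have := congrArg Complex.re h0
    rw [Complex.conj_re, uniTau_re, Complex.zero_re] at this; linarith
  · rw [Complex.conj_re, uniTau_re]; linarith
  · rw [Complex.conj_im, uniTau_im]; linarith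

theorem separated_neg_tau (h : CriticalArc s γ) : Separated s γ (-uniTau s) := by
  have hn := norm_eq_one_of_mul_conj (uniTau_mul_conj h.s_gt h.s_le)
  have he := uniE_pos h.s_gt h.s_le
  have hk := uniK_pos h.s_gt
  refine h.separated_neg_of_discU_neg (by rw [uniTau_re]; linarith) (by rw [uniTau_im]; linarith) ?_
  rw [discU_of_norm_eq_one hn, uniTau_re]; nlinarith

/-! ### Logarithmic primitives along the arc -/

theorem xi_ne_of_separated {w : ℂ} (hw : Separated s γ w) {t : ℝ}
    (ht : t ∈ Ioo (0 : ℝ) 1) : xi s γ t - w ≠ 0 ∧ xi s γ t + w ≠ 0 := by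
  constructor
  · intro h0
    have e := sub_eq_zero.1 h0
    have := hw.2 t ht (by rw [e])
    rw [e, Complex.mul_conj, Complex.ofReal_im] at this
    exact lt_irrefl _ this
  · intro h0
    have e := eq_neg_of_add_eq_zero_left h0
    have := hw.2 t ht (by rw [e, norm_neg])
    rw [e, neg_mul, Complex.mul_conj, Complex.neg_im, Complex.ofReal_im, neg_zero] at this
    exact lt_irrefl _ this

/-- The real part of the value has the sign of `Im (x w̄)`, and the imaginary part that of `|w| -
|x|`. The cut can therefore be hit only when `|x| = |w|`, which is why `Separated` has its form. -/
theorem mobius_mem_slitPlane {x w : ℂ} (h : x + w ≠ 0)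
    (hw : ‖x‖ = ‖w‖ → 0 < (x * conj w).im) :
    -Complex.I * ((x - w) / (x + w)) ∈ Complex.slitPlane := by
  have hN : 0 < Complex.normSq (x + w) := Complex.normSq_pos.2 h
  have h1 : (-Complex.I * ((x - w) / (x + w))).re = 2 * (x * conj w).im / Complex.normSq (x + w) := by
    rw [Complex.mul_re, Complex.div_re, Complex.div_im]
    simp only [Complex.neg_re, Complex.I_re, Complex.neg_im, Complex.I_im, Complex.sub_re,
      Complex.sub_im, Complex.add_re, Complex.add_im, Complex.mul_im, Complex.conj_re,
      Complex.conj_im]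
    field_simp
    ring
  have h2 : (-Complex.I * ((x - w) / (x + w))).im =
      (‖w‖ ^ 2 - ‖x‖ ^ 2) / Complex.normSq (x + w) := by
    rw [← Complex.normSq_eq_norm_sq, ← Complex.normSq_eq_norm_sq, Complex.mul_im, Complex.div_re,
      Complex.div_im]
    simp only [Complex.neg_re, Complex.I_re, Complex.neg_im, Complex.I_im, Complex.sub_re,
      Complex.sub_im, Complex.add_re, Complex.add_im, Complex.normSq_apply]
    field_simp
    ring
  rw [Complex.mem_slitPlane_iff, h1, h2]
  by_cases hn : ‖x‖ = ‖w‖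
  · left; have := hw hn; positivity
  · right
    refine div_ne_zero ?_ hN.ne'
    intro h0
    apply hn
    have h3 : ‖x‖ ^ 2 = ‖w‖ ^ 2 := by linarith
    exact (pow_left_inj₀ (norm_nonneg _) (norm_nonneg _) two_ne_zero).1 h3

/-- Primitive of `2 w dξ / (ξ² - w²)` along the arc. -/
def _root_.HexagonMVOP.prim (s : ℝ) (γ : ℝ → ℂ) (w : ℂ) (t : ℝ) : ℂ :=
  Complex.log (-Complex.I * ((xi s γ t - w) / (xi s γ t + w)))

theorem hasDerivAt_prim (h : CriticalArc s γ) {w : ℂ} (hw : Separated s γ w) {t : ℝ}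
    (ht : t ∈ Ioo (0 : ℝ) 1) :
    HasDerivAt (prim s γ w) (2 * w / (xi s γ t ^ 2 - w ^ 2) * deriv (xi s γ) t) t := by
  obtain ⟨n1, n2⟩ := xi_ne_of_separated hw ht
  have hd := (h.hasDerivAt_xi ht).differentiableAt.hasDerivAt
  have h1 := ((hd.sub_const w).fun_div (hd.add_const w) n2).const_mul (-Complex.I)
  have h2 := h1.clog_real (mobius_mem_slitPlane n2 (hw.2 t ht))
  refine h2.congr_deriv ?_
  have : xi s γ t ^ 2 - w ^ 2 ≠ 0 := by
    rw [show xi s γ t ^ 2 - w ^ 2 = (xi s γ t - w) * (xi s γ t + w) by ring]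
    exact mul_ne_zero n1 n2
  have hI := Complex.I_ne_zero
  rw [show xi s γ t ^ 2 - w ^ 2 = (xi s γ t - w) * (xi s γ t + w) by ring]
  field_simp
  ring

theorem tendsto_root_zero {z₀ : ℂ} (hq : quad s z₀ = 0) {l : Filter ℝ}
    (hl : Tendsto γ l (𝓝 z₀)) : Tendsto (fun t => root s (γ t)) l (𝓝 0) := by
  rw [tendsto_zero_iff_norm_tendsto_zero]
  have h1 : Tendsto (fun t => √‖quad s (γ t)‖) l (𝓝 (√‖quad s z₀‖)) :=
    ((Real.continuous_sqrt.comp (continuous_quad s).norm).tendsto z₀).comp hl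
  rw [hq, norm_zero, Real.sqrt_zero] at h1
  refine h1.congr fun t => ?_
  rw [← root_sq, norm_pow, Real.sqrt_sq (norm_nonneg _)]

theorem numer_eq_zero_im (h : CriticalArc s γ) {z : ℂ} (hz : numer s z = 0) : 0 < z.im := by
  have h1 := normSq_numer_sub_denom s z
  rw [hz, map_zero, zero_sub] at h1
  have hd : denom s z ≠ 0 := by
    intro h0
    have h2 := numer_add_denom s z
    have h3 := numer_sub_denom s z
    rw [hz, h0, add_zero] at h2
    have he : (uniE s : ℂ) ≠ 0 := Complex.ofReal_ne_zero.2 (uniE_pos h.s_gt h.s_le).ne'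
    have hA := (mul_eq_zero.1 h2.symm).resolve_left he
    have hk : (uniK s : ℂ) ≠ 0 := Complex.ofReal_ne_zero.2 (uniK_pos h.s_gt).ne'
    rw [hA, hz, h0, sub_zero] at h3
    have hs : (s : ℂ) ≠ 0 := Complex.ofReal_ne_zero.2 (by have := h.s_gt; linarith)
    have := Complex.I_ne_zero
    simp [hk, hs] at h3
  have := Complex.normSq_pos.2 hd
  have hp : 0 < uniK s * s * uniE s := by
    have := uniK_pos h.s_gt; have := uniE_pos h.s_gt h.s_le; have := h.s_gt; positivity
  by_contra! h5
  nlinarith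

theorem denom_eq_zero_im (h : CriticalArc s γ) {z : ℂ} (hz : denom s z = 0) : z.im < 0 := by
  have h1 := normSq_numer_sub_denom s z
  rw [hz, map_zero, sub_zero] at h1
  have hp : 0 < uniK s * s * uniE s := by
    have := uniK_pos h.s_gt; have := uniE_pos h.s_gt h.s_le; have := h.s_gt; positivity
  have h2 := Complex.normSq_nonneg (numer s z)
  have h3 : z.im ≠ 0 := by
    intro h0
    rw [h0, mul_zero, Complex.normSq_eq_zero] at h1
    have := h.numer_eq_zero_im h1
    linarith
  by_contra! h5
  have : 0 < z.im := lt_of_le_of_ne h5 h3.symm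
  nlinarith [mul_pos hp this]

theorem denom_source (h : CriticalArc s γ) : denom s (γ 0) = 0 ∧ numer s (γ 0) ≠ 0 := by
  have hn : numer s (γ 0) ≠ 0 := by
    intro h0; have := h.numer_eq_zero_im h0; have := h.source_im; linarith
  have := numer_mul_denom h.s_gt h.s_le (γ 0)
  rw [h.source] at this
  exact ⟨(mul_eq_zero.1 this).resolve_left hn, hn⟩

theorem numer_target (h : CriticalArc s γ) : numer s (γ 1) = 0 ∧ denom s (γ 1) ≠ 0 := by
  have hn : denom s (γ 1) ≠ 0 := by
    intro h0; have := h.denom_eq_zero_im h0; have := h.target_im; linarith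
  have := numer_mul_denom h.s_gt h.s_le (γ 1)
  rw [h.target] at this
  exact ⟨(mul_eq_zero.1 this).resolve_right hn, hn⟩

theorem tendsto_source (h : CriticalArc s γ) : Tendsto γ (𝓝[>] 0) (𝓝 (γ 0)) := by
  have := h.cont 0 (by simp)
  exact this.mono_left (nhdsWithin_le_of_mem (Icc_mem_nhdsGT (by norm_num)))

theorem tendsto_target (h : CriticalArc s γ) : Tendsto γ (𝓝[<] 1) (𝓝 (γ 1)) := by
  have := h.cont 1 (by simp)
  exact this.mono_left (nhdsWithin_le_of_mem (Icc_mem_nhdsLT (by norm_num)))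

/-- At the source `ξ → ∞` and the argument of the logarithm tends to `-i`; at the target `ξ → 0` and
it tends to `i`. Every separated `w` therefore gives a primitive with the same total increment `πi`.
-/
theorem tendsto_prim_source (h : CriticalArc s γ) (w : ℂ) :
    Tendsto (prim s γ w) (𝓝[>] 0) (𝓝 (-(Real.pi / 2) * Complex.I)) := by
  have hr := tendsto_root_zero h.source h.tendsto_source
  have hN := ((continuous_numer s).tendsto (γ 0)).comp h.tendsto_source
  have hn := h.denom_source.2
  have h1 : Tendsto (fun t => -Complex.I * ((numer s (γ t) - root s (γ t) * w) /
      (numer s (γ t) + root s (γ t) * w))) (𝓝[>] 0)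
      (𝓝 (-Complex.I * ((numer s (γ 0) - 0 * w) / (numer s (γ 0) + 0 * w)))) := by
    refine ((hN.sub (hr.mul_const w)).div (hN.add (hr.mul_const w)) ?_).const_mul _
    simpa using hn
  have e : -Complex.I * ((numer s (γ 0) - 0 * w) / (numer s (γ 0) + 0 * w)) = -Complex.I := by
    rw [zero_mul, sub_zero, add_zero, div_self hn, mul_one]
  rw [e] at h1
  have h2 := h1.clog (Complex.mem_slitPlane_iff.2 (Or.inr (by simp)))
  rw [Complex.log_neg_I] at h2
  refine h2.congr' ?_
  filter_upwards [Ioo_mem_nhdsGT (show (0 : ℝ) < 1 by norm_num)] with t ht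
  have hr0 := h.root_ne ht
  simp only [prim, xi, coord]
  congr 2
  rw [div_sub' hr0, div_add' _ _ _ hr0, mul_comm w, div_div_div_cancel_right₀ hr0]

theorem tendsto_prim_target (h : CriticalArc s γ) {w : ℂ} (hw : w ≠ 0) :
    Tendsto (prim s γ w) (𝓝[<] 1) (𝓝 (Real.pi / 2 * Complex.I)) := by
  have hr := tendsto_root_zero h.target h.tendsto_target
  have hN := ((continuous_denom s).tendsto (γ 1)).comp h.tendsto_target
  have hn := h.numer_target.2
  have h1 : Tendsto (fun t => -Complex.I * ((root s (γ t) - denom s (γ t) * w) /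
      (root s (γ t) + denom s (γ t) * w))) (𝓝[<] 1)
      (𝓝 (-Complex.I * ((0 - denom s (γ 1) * w) / (0 + denom s (γ 1) * w)))) := by
    refine ((hr.sub (hN.mul_const w)).div (hr.add (hN.mul_const w)) ?_).const_mul _
    simpa using ⟨hn, hw⟩
  have e : -Complex.I * ((0 - denom s (γ 1) * w) / (0 + denom s (γ 1) * w)) = Complex.I := by
    rw [zero_sub, zero_add, neg_div, div_self (mul_ne_zero hn hw)]; ring
  rw [e] at h1
  have h2 := h1.clog (Complex.mem_slitPlane_iff.2 (Or.inr (by simp)))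
  rw [Complex.log_I] at h2
  refine h2.congr' ?_
  filter_upwards [Ioo_mem_nhdsLT (show (0 : ℝ) < 1 by norm_num)] with t ht
  have hr0 := h.root_ne ht
  have hx : xi s γ t = (denom s (γ t) / root s (γ t))⁻¹ := by
    rw [← coord_inv h.s_gt h.s_le (root_sq _ _) hr0, inv_inv]; rfl
  have hd : denom s (γ t) ≠ 0 := by
    intro h0
    have := h.xi_ne ht
    rw [hx, h0] at this; simp at this
  simp only [prim]
  congr 2
  rw [hx, inv_div, div_sub' hd, div_add' _ _ _ hd, mul_comm w, div_div_div_cancel_right₀ hd]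

end CriticalArc

/-! ### Partial fractions of the differential and integration along the arc -/

/-- Poles of the differential in the uniformizing coordinate, one from each antipodal pair. -/
def pole (s : ℝ) : Fin 4 → ℂ :=
  ![uniSigma s, conj (uniSigma s), conj (uniTau s), -uniTau s]

/-- The fourth weight is `-1` because the separated representative of the pair `±τ` is `-τ`;
attached to `τ` it would be `+1`. The weights sum to `-1`, which fixes the total mass. -/
def poleWeight : Fin 4 → ℂ := ![-1 / 2, -1 / 2, 1, -1]

/-- The polynomials `(X² + 1)² - e²X²` and `(X² + 1)² - 4e²X²` have roots `±τ, ±τ̄` and `±σ, ±σ̄`.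
Reciprocal poles combine in pairs to one fraction over each polynomial. -/
theorem sum_kernel {X σ σ' τ τ' e : ℂ} (h1 : σ * σ' = 1) (h2 : σ + σ' = 2 * e)
    (h3 : τ * τ' = 1) (h4 : τ + τ' = e)
    (n1 : X ^ 2 - σ ^ 2 ≠ 0) (n2 : X ^ 2 - σ' ^ 2 ≠ 0) (n3 : X ^ 2 - τ ^ 2 ≠ 0)
    (n4 : X ^ 2 - τ' ^ 2 ≠ 0) :
    -1 / 2 * (2 * σ / (X ^ 2 - σ ^ 2)) + -1 / 2 * (2 * σ' / (X ^ 2 - σ' ^ 2)) +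
      1 * (2 * τ' / (X ^ 2 - τ' ^ 2)) + -1 * (2 * -τ / (X ^ 2 - (-τ) ^ 2)) =
    2 * e * (X ^ 2 - 1) * (1 / ((X ^ 2 + 1) ^ 2 - e ^ 2 * X ^ 2) -
      1 / ((X ^ 2 + 1) ^ 2 - 4 * e ^ 2 * X ^ 2)) := by
  have d1 : (X ^ 2 + 1) ^ 2 - e ^ 2 * X ^ 2 = (X ^ 2 - τ ^ 2) * (X ^ 2 - τ' ^ 2) := by
    rw [← h4]; linear_combination (-2 * X ^ 2 - 1 - τ * τ') * h3
  have d2 : (X ^ 2 + 1) ^ 2 - 4 * e ^ 2 * X ^ 2 = (X ^ 2 - σ ^ 2) * (X ^ 2 - σ' ^ 2) := by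
    rw [show 4 * e ^ 2 = (σ + σ') ^ 2 by rw [h2]; ring]
    linear_combination (-2 * X ^ 2 - 1 - σ * σ') * h1
  have a1 : 2 * τ' / (X ^ 2 - τ' ^ 2) + 2 * τ / (X ^ 2 - τ ^ 2) =
      2 * e * (X ^ 2 - 1) / ((X ^ 2 - τ ^ 2) * (X ^ 2 - τ' ^ 2)) := by
    rw [div_add_div _ _ n4 n3, div_eq_div_iff (mul_ne_zero n4 n3) (mul_ne_zero n3 n4), ← h4]
    linear_combination (-2 * (τ + τ')) * ((X ^ 2 - τ ^ 2) * (X ^ 2 - τ' ^ 2)) * h3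
  have a2 : 2 * σ / (X ^ 2 - σ ^ 2) + 2 * σ' / (X ^ 2 - σ' ^ 2) =
      2 * (2 * e) * (X ^ 2 - 1) / ((X ^ 2 - σ ^ 2) * (X ^ 2 - σ' ^ 2)) := by
    rw [div_add_div _ _ n1 n2, div_eq_div_iff (mul_ne_zero n1 n2) (mul_ne_zero n1 n2), ← h2]
    linear_combination (-2 * (σ + σ')) * ((X ^ 2 - σ ^ 2) * (X ^ 2 - σ' ^ 2)) * h1
  rw [d1, d2, neg_sq]
  linear_combination a1 - a2 / 2

namespace CriticalArc

variable {s : ℝ} {γ : ℝ → ℂ}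

theorem separated_pole (h : CriticalArc s γ) (i : Fin 4) : Separated s γ (pole s i) := by
  fin_cases i
  · exact h.separated_sigma
  · exact h.separated_conj_sigma
  · exact h.separated_conj_tau
  · exact h.separated_neg_tau

theorem xi_sq_sub_ne {w : ℂ} (hw : Separated s γ w) {t : ℝ}
    (ht : t ∈ Ioo (0 : ℝ) 1) : xi s γ t ^ 2 - w ^ 2 ≠ 0 := by
  obtain ⟨n1, n2⟩ := xi_ne_of_separated hw ht
  rw [show xi s γ t ^ 2 - w ^ 2 = (xi s γ t - w) * (xi s γ t + w) by ring]
  exact mul_ne_zero n1 n2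

/-- The differential in the uniformizing coordinate. -/
theorem sum_kernel_xi (h : CriticalArc s γ) {t : ℝ} (ht : t ∈ Ioo (0 : ℝ) 1) :
    ∑ i, poleWeight i * (2 * pole s i / (xi s γ t ^ 2 - pole s i ^ 2) * deriv (xi s γ) t) =
      -(rootQ s (γ t) (root s (γ t)) * deriv γ t) := by
  have hs := h.s_gt
  have hs1 := h.s_le
  have n := fun i => xi_sq_sub_ne (h.separated_pole i) ht
  have n1 := n 0
  have n2 := n 1
  have n3 := n 3
  have n4 := n 2
  simp only [pole, Matrix.cons_val] at n1 n2 n3 n4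
  rw [neg_sq] at n3
  have hK := sum_kernel (uniSigma_mul_conj hs hs1) (uniSigma_add_conj s) (uniTau_mul_conj hs hs1)
    (uniTau_add_conj s) n1 n2 n3 n4
  have e1 : ∑ i, poleWeight i * (2 * pole s i / (xi s γ t ^ 2 - pole s i ^ 2) *
      deriv (xi s γ) t) = (2 * uniE s * (xi s γ t ^ 2 - 1) *
      (1 / ((xi s γ t ^ 2 + 1) ^ 2 - uniE s ^ 2 * xi s γ t ^ 2) -
      1 / ((xi s γ t ^ 2 + 1) ^ 2 - 4 * uniE s ^ 2 * xi s γ t ^ 2))) * deriv (xi s γ) t := by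
    rw [← hK, Fin.sum_univ_four]
    simp only [poleWeight, pole, Matrix.cons_val]
    ring
  rw [e1, (h.hasDerivAt_xi ht).deriv, rootQ_eq hs (root_sq s (γ t))]
  have hr0 := h.root_ne ht
  have hx0 := h.xi_ne ht
  have c1 := coord_add_inv hs hs1 (root_sq s (γ t)) hr0
  have c2 := coord_sub_inv hs hs1 (root_sq s (γ t)) hr0
  change xi s γ t + (xi s γ t)⁻¹ = _ at c1
  change xi s γ t - (xi s γ t)⁻¹ = _ at c2
  have f1 : xi s γ t ^ 2 + 1 = xi s γ t * (uniE s * (shift s (γ t) / root s (γ t))) := by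
    rw [← c1]; field_simp
  have f2 : xi s γ t ^ 2 - 1 =
      xi s γ t * (Complex.I * uniK s * ((shift s (γ t) - 2 * s) / root s (γ t))) := by
    rw [← c2]; field_simp
  have c3 : (2 * shift s (γ t) - ((3 / 2 * ctr s : ℝ) : ℂ)) * shift s (γ t) - 2 * root s (γ t) ^ 2 =
      (uniK s : ℂ) ^ 2 * s * (shift s (γ t) - 2 * s) := by
    have h3 : (uniK s : ℂ) ^ 2 * s = 3 / 2 * ctr s := by
      have := congrArg (fun x : ℝ => (x : ℂ)) (uniK_sq_mul hs)
      push_cast at this; exact this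
    rw [root_sq, h3]; unfold quad; push_cast; ring
  rw [c3, f2, f1]
  obtain ⟨-, m1, m4⟩ := h.nondeg ht
  rw [← root_sq] at m1 m4
  have he : (uniE s : ℂ) ≠ 0 := Complex.ofReal_ne_zero.2 (uniE_pos hs hs1).ne'
  generalize xi s γ t = X at *
  generalize root s (γ t) = r at *
  generalize shift s (γ t) = A at *
  generalize (uniE s : ℂ) = e at *
  have d1 : (X * (e * (A / r))) ^ 2 - e ^ 2 * X ^ 2 = X ^ 2 * e ^ 2 * (A ^ 2 - r ^ 2) / r ^ 2 := by
    field_simp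
  have d2 : (X * (e * (A / r))) ^ 2 - 4 * e ^ 2 * X ^ 2 =
      X ^ 2 * e ^ 2 * (A ^ 2 - 4 * r ^ 2) / r ^ 2 := by
    field_simp
  rw [d1, d2]
  have hBC : (A ^ 2 - r ^ 2) - (A ^ 2 - 4 * r ^ 2) = 3 * r ^ 2 := by ring
  generalize A ^ 2 - r ^ 2 = B at *
  generalize A ^ 2 - 4 * r ^ 2 = C at *
  field_simp
  linear_combination (-Complex.I ^ 2 * (A - 2 * s) * (uniK s ^ 2 * s * deriv γ t)) * hBC -
    3 * r ^ 2 * (A - 2 * s) * (uniK s ^ 2 * s * deriv γ t) * Complex.I_sq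

/-- The density of the measure with respect to the parameter. -/
def _root_.HexagonMVOP.weight (s : ℝ) (γ : ℝ → ℂ) (t : ℝ) : ℝ :=
  ‖rootQ s (γ t) (root s (γ t)) * deriv γ t‖ / Real.pi

theorem continuousOn_differential (h : CriticalArc s γ) :
    ContinuousOn (fun t => rootQ s (γ t) (root s (γ t)) * deriv γ t) (Ioo 0 1) := by
  have hd := h.contDiff.continuousOn_deriv_of_isOpen isOpen_Ioo le_rfl
  have hc : ContinuousOn γ (Ioo 0 1) := h.cont.mono Ioo_subset_Icc_self
  refine ContinuousOn.mul ?_ hd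
  have hr : ContinuousOn (fun t => root s (γ t)) (Ioo 0 1) := fun t ht =>
    ContinuousAt.comp_continuousWithinAt (f := γ) (h.continuousAt_root ht) (hc t ht)
  unfold rootQ
  refine ContinuousOn.div (by fun_prop) (by fun_prop) fun t ht h0 => ?_
  have := (mul_ne_zero_iff.1 (h.ne_zero t ht)).1
  unfold rootQ at this
  exact (div_ne_zero_iff.1 this).2 h0

theorem continuousOn_weight (h : CriticalArc s γ) : ContinuousOn (weight s γ) (Ioo 0 1) :=
  h.continuousOn_differential.norm.div_const _

theorem weight_nonneg (s : ℝ) (γ : ℝ → ℂ) (t : ℝ) : 0 ≤ weight s γ t := by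
  unfold weight; have := Real.pi_pos; positivity

/-- The branch chosen in `root` is not tied to the orientation of the arc, which leaves a sign `ε`.
It is later found to be 1 because the total mass is nonnegative. -/
theorem exists_sign (h : CriticalArc s γ) : ∃ ε : ℝ, ε ^ 2 = 1 ∧ ∀ t ∈ Ioo (0 : ℝ) 1,
    rootQ s (γ t) (root s (γ t)) * deriv γ t = ((ε * Real.pi * weight s γ t : ℝ) : ℂ) * Complex.I := by
  set f : ℝ → ℝ := fun t => (rootQ s (γ t) (root s (γ t)) * deriv γ t).im with hf
  have hfc : ContinuousOn f (Ioo 0 1) :=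
    Complex.continuous_im.comp_continuousOn h.continuousOn_differential
  have h0 : ∀ t ∈ Ioo (0 : ℝ) 1, f t ≠ 0 := fun t ht h1 =>
    h.ne_zero t ht (Complex.ext (h.re_eq_zero t ht) h1)
  have habs : ∀ t ∈ Ioo (0 : ℝ) 1, |f t| = Real.pi * weight s γ t := by
    intro t ht
    have e : rootQ s (γ t) (root s (γ t)) * deriv γ t = (f t : ℂ) * Complex.I :=
      Complex.ext (by rw [h.re_eq_zero t ht]; simp) (by simp [hf])
    unfold weight
    rw [e, norm_mul, Complex.norm_I, mul_one, Complex.norm_real, Real.norm_eq_abs]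
    have := Real.pi_pos
    field_simp
  have hform : ∀ ε : ℝ, (∀ t ∈ Ioo (0 : ℝ) 1, f t = ε * |f t|) → ∀ t ∈ Ioo (0 : ℝ) 1,
    rootQ s (γ t) (root s (γ t)) * deriv γ t =
      ((ε * Real.pi * weight s γ t : ℝ) : ℂ) * Complex.I := by
    intro ε hε t ht
    rw [mul_assoc, ← habs t ht, ← hε t ht]
    exact Complex.ext (by rw [h.re_eq_zero t ht]; simp) (by simp [hf])
  by_cases hp : ∃ x ∈ Ioo (0 : ℝ) 1, 0 < f x
  · have := pos_of_ne_zero_of_exists_pos isPreconnected_Ioo hfc h0 hp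
    exact ⟨1, by norm_num, hform 1 fun t ht => by rw [abs_of_pos (this t ht), one_mul]⟩
  · push Not at hp
    refine ⟨-1, by norm_num, hform (-1) fun t ht => ?_⟩
    rw [abs_of_nonpos (hp t ht)]; ring

theorem tendsto_sum_prim_source (h : CriticalArc s γ) {ι : Type*} [Fintype ι] (c p : ι → ℂ) :
    Tendsto (fun t => ∑ i, c i * prim s γ (p i) t) (𝓝[>] 0)
      (𝓝 (∑ i, c i * (-(Real.pi / 2) * Complex.I))) :=
  tendsto_finsetSum _ fun i _ => (h.tendsto_prim_source (p i)).const_mul _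

theorem tendsto_sum_prim_target (h : CriticalArc s γ) {ι : Type*} [Fintype ι] (c : ι → ℂ)
    {p : ι → ℂ} (hp : ∀ i, p i ≠ 0) :
    Tendsto (fun t => ∑ i, c i * prim s γ (p i) t) (𝓝[<] 1)
      (𝓝 (∑ i, c i * (Real.pi / 2 * Complex.I))) :=
  tendsto_finsetSum _ fun i _ => (h.tendsto_prim_target (hp i)).const_mul _

theorem hasDerivAt_sum_prim (h : CriticalArc s γ) {ι : Type*} [Fintype ι] (c : ι → ℂ)
    {p : ι → ℂ} (hp : ∀ i, Separated s γ (p i)) {t : ℝ} (ht : t ∈ Ioo (0 : ℝ) 1) :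
    HasDerivAt (fun t => ∑ i, c i * prim s γ (p i) t)
      (∑ i, c i * (2 * p i / (xi s γ t ^ 2 - p i ^ 2) * deriv (xi s γ) t)) t :=
  HasDerivAt.fun_sum fun i _ => (h.hasDerivAt_prim (hp i) ht).const_mul _

theorem weight_eq (h : CriticalArc s γ) : ∃ ε : ℝ, ε ^ 2 = 1 ∧ ∀ t ∈ Ioo (0 : ℝ) 1,
    (weight s γ t : ℂ) = ∑ i, (ε * Complex.I / Real.pi * poleWeight i) *
      (2 * pole s i / (xi s γ t ^ 2 - pole s i ^ 2) * deriv (xi s γ) t) := by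
  obtain ⟨ε, hε, h1⟩ := h.exists_sign
  refine ⟨ε, hε, fun t ht => ?_⟩
  have h2 := h.sum_kernel_xi ht
  rw [h1 t ht] at h2
  simp only [mul_assoc _ (poleWeight _)]
  rw [← Finset.mul_sum, h2]
  have : (Real.pi : ℂ) ≠ 0 := Complex.ofReal_ne_zero.2 Real.pi_ne_zero
  have hε' : (ε : ℂ) ^ 2 = 1 := by rw [← Complex.ofReal_pow, hε]; simp
  push_cast
  field_simp
  linear_combination (-weight s γ t : ℂ) * hε' + (ε ^ 2 * weight s γ t : ℂ) * Complex.I_sq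

/-- No bound for `γ'` is available near the endpoints. Integrability comes instead from the
primitive: it has finite limits at both ends and a nonnegative derivative. -/
theorem integrableOn_weight (h : CriticalArc s γ) : IntegrableOn (weight s γ) (Ioo 0 1) := by
  obtain ⟨ε, -, h1⟩ := h.weight_eq
  set g : ℝ → ℝ := fun t =>
    (∑ i, (ε * Complex.I / Real.pi * poleWeight i) * prim s γ (pole s i) t).re with hg
  have hd : ∀ t ∈ Ioo (0 : ℝ) 1, HasDerivAt g (weight s γ t) t := by
    intro t ht
    have h2 := h.hasDerivAt_sum_prim (fun i => ε * Complex.I / Real.pi * poleWeight i)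
      h.separated_pole ht
    rw [← h1 t ht] at h2
    exact Complex.reCLM.hasFDerivAt.comp_hasDerivAt t h2
  have hgc : ContinuousOn g (Ioo 0 1) := fun t ht => (hd t ht).continuousAt.continuousWithinAt
  have hE := continuousOn_Icc_extendFrom_Ioo hgc
    ((Complex.continuous_re.tendsto _).comp (h.tendsto_sum_prim_source _ _))
    ((Complex.continuous_re.tendsto _).comp (h.tendsto_sum_prim_target _
      (fun i => (h.separated_pole i).1)))
  have := intervalIntegral.integrableOn_deriv_of_nonneg hE (g' := weight s γ) (fun t ht => by
    refine (hd t ht).congr_of_eventuallyEq ?_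
    filter_upwards [isOpen_Ioo.mem_nhds ht] with x hx
    exact extendFrom_extends hgc x hx) (fun t _ => weight_nonneg s γ t)
  exact this.mono_set Ioo_subset_Ioc_self

theorem integral_eq_of_prim (h : CriticalArc s γ) {ι : Type*} [Fintype ι] (c : ι → ℂ)
    {p : ι → ℂ} (hp : ∀ i, Separated s γ (p i)) {f : ℝ → ℂ} (hf : IntegrableOn f (Ioo 0 1))
    (hfe : ∀ t ∈ Ioo (0 : ℝ) 1,
      f t = ∑ i, c i * (2 * p i / (xi s γ t ^ 2 - p i ^ 2) * deriv (xi s γ) t)) :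
    ∫ t in Ioo (0 : ℝ) 1, f t = Real.pi * Complex.I * ∑ i, c i := by
  have h1 := intervalIntegral.integral_eq_sub_of_hasDerivAt_of_tendsto (f' := f)
    (show (0 : ℝ) < 1 by norm_num)
    (fun t ht => by rw [hfe t ht]; exact h.hasDerivAt_sum_prim c hp ht)
    ((intervalIntegrable_iff_integrableOn_Ioo_of_le (by norm_num)).2 hf)
    (h.tendsto_sum_prim_source c p) (h.tendsto_sum_prim_target c fun i => (hp i).1)
  rw [intervalIntegral.integral_of_le (by norm_num), integral_Ioc_eq_integral_Ioo] at h1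
  rw [h1, ← Finset.sum_sub_distrib, Finset.mul_sum]
  exact Finset.sum_congr rfl fun i _ => by ring

end CriticalArc

/-! ### Logarithmic potentials off the support -/

def potential (ν : Measure ℂ) (z : ℂ) : ℝ := ∫ x, Real.log ‖z - x‖ ∂ν

section potential

variable {ν : Measure ℂ} [IsFiniteMeasure ν] {K : Set ℂ}

theorem exists_dist_pos (hK : IsClosed K) {z₀ : ℂ} (hz : z₀ ∉ K) :
    ∃ δ > 0, ∀ x ∈ K, δ ≤ ‖z₀ - x‖ := by
  obtain ⟨δ, hδ, h⟩ := Metric.mem_nhds_iff.1 (hK.isOpen_compl.mem_nhds hz)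
  refine ⟨δ, hδ, fun x hx => ?_⟩
  by_contra! h1
  exact h (by rwa [Metric.mem_ball, dist_comm, dist_eq_norm]) hx

theorem integrable_log_norm_sub (hK : IsCompact K) (hν : ∀ᵐ x ∂ν, x ∈ K) {z : ℂ} (hz : z ∉ K) :
    Integrable (fun x => Real.log ‖z - x‖) ν := by
  obtain ⟨δ, hδ, h1⟩ := exists_dist_pos hK.isClosed hz
  have hc : ContinuousOn (fun x => Real.log ‖z - x‖) K := by
    refine ContinuousOn.log (by fun_prop) fun x hx h0 => ?_
    have := h1 x hx
    linarith
  obtain ⟨C, hC⟩ := hK.exists_bound_of_continuousOn hc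
  refine Integrable.of_bound ?_ C (hν.mono hC)
  exact (Real.measurable_log.comp (by fun_prop)).aestronglyMeasurable

theorem integrable_inv_sub (hK : IsClosed K) (hν : ∀ᵐ x ∂ν, x ∈ K) {z : ℂ} (hz : z ∉ K) :
    Integrable (fun x => (z - x)⁻¹) ν := by
  obtain ⟨δ, hδ, h1⟩ := exists_dist_pos hK hz
  refine Integrable.of_bound (by fun_prop) δ⁻¹ (hν.mono fun x hx => ?_)
  rw [norm_inv]
  exact inv_anti₀ hδ (h1 x hx)

/-- For `v` near `z₀` the quotients `(v - x)/(z₀ - x)` stay near 1 uniformly over the support, so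
their principal logarithms can be integrated without cuts and differentiated under the integral. -/
theorem exists_analytic_potential (hK : IsCompact K) (hν : ∀ᵐ x ∂ν, x ∈ K) {z₀ : ℂ}
    (hz : z₀ ∉ K) : ∃ Φ : ℂ → ℂ, (∀ᶠ v in 𝓝 z₀, HasDerivAt Φ (∫ x, (v - x)⁻¹ ∂ν) v) ∧
      Φ z₀ = 0 ∧ ∀ᶠ v in 𝓝 z₀, potential ν v = potential ν z₀ + (Φ v).re := by
  obtain ⟨δ, hδ, h1⟩ := exists_dist_pos hK.isClosed hz
  have hne : ∀ x ∈ K, z₀ - x ≠ 0 := fun x hx h0 => by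
    have := h1 x hx; rw [h0, norm_zero] at this; linarith
  have key : ∀ v ∈ Metric.ball z₀ (δ / 2), ∀ x ∈ K,
      (v - x) / (z₀ - x) = 1 + (v - z₀) / (z₀ - x) ∧ ‖(v - z₀) / (z₀ - x)‖ < 1 / 2 := by
    intro v hv x hx
    refine ⟨by have := hne x hx; field_simp; ring, ?_⟩
    rw [norm_div, div_lt_iff₀ (norm_pos_iff.2 (hne x hx))]
    rw [Metric.mem_ball, dist_eq_norm] at hv
    have := h1 x hx
    linarith
  have hslit : ∀ v ∈ Metric.ball z₀ (δ / 2), ∀ x ∈ K, (v - x) / (z₀ - x) ∈ Complex.slitPlane := by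
    intro v hv x hx
    obtain ⟨e1, e2⟩ := key v hv x hx
    rw [e1]
    exact Complex.mem_slitPlane_of_norm_lt_one (by linarith)
  have hvne : ∀ v ∈ Metric.ball z₀ (δ / 2), ∀ x ∈ K, v - x ≠ 0 := by
    intro v hv x hx h0
    have := hslit v hv x hx
    rw [h0, zero_div] at this
    simp at this
  have hint : ∀ v ∈ Metric.ball z₀ (δ / 2),
      Integrable (fun x => Complex.log ((v - x) / (z₀ - x))) ν := by
    intro v hv
    refine Integrable.of_bound ?_ (3 / 4) (hν.mono fun x hx => ?_)
    · exact (Complex.measurable_log.comp (by fun_prop)).aestronglyMeasurable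
    · obtain ⟨e1, e2⟩ := key v hv x hx
      rw [e1]
      have := Complex.norm_log_one_add_half_le_self e2.le
      linarith
  have hball : Metric.ball z₀ (δ / 2) ∈ 𝓝 z₀ := Metric.ball_mem_nhds _ (by positivity)
  refine ⟨fun v => ∫ x, Complex.log ((v - x) / (z₀ - x)) ∂ν, ?_, ?_, ?_⟩
  · filter_upwards [hball] with v hv
    refine (hasDerivAt_integral_of_dominated_loc_of_deriv_le
      (F' := fun v x => (v - x)⁻¹) (bound := fun _ => (δ / 2)⁻¹)
      (Metric.isOpen_ball.mem_nhds hv) ?_ (hint v hv) ?_ ?_ (integrable_const _) ?_).2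
    · exact Eventually.of_forall fun w =>
        (Complex.measurable_log.comp (by fun_prop)).aestronglyMeasurable
    · fun_prop
    · filter_upwards [hν] with x hx w hw
      rw [norm_inv]
      refine inv_anti₀ (by positivity) ?_
      have := h1 x hx
      rw [Metric.mem_ball, dist_eq_norm] at hw
      have h2 : ‖z₀ - x‖ ≤ ‖w - x‖ + ‖w - z₀‖ := by
        rw [show z₀ - x = (w - x) - (w - z₀) by ring]; exact norm_sub_le _ _
      linarith
    · filter_upwards [hν] with x hx w hw
      have hd : HasDerivAt (fun w : ℂ => (w - x) / (z₀ - x)) (1 / (z₀ - x)) w :=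
        ((hasDerivAt_id w).sub_const x).div_const _
      refine (hd.clog (hslit w hw x hx)).congr_deriv ?_
      have := hne x hx
      have := hvne w hw x hx
      field_simp
  · have : ∀ᵐ x ∂ν, Complex.log ((z₀ - x) / (z₀ - x)) = 0 := by
      filter_upwards [hν] with x hx
      rw [div_self (hne x hx), Complex.log_one]
    simp only [integral_congr_ae this, integral_zero]
  · filter_upwards [hball] with v hv
    have hvK : v ∉ K := fun hx => hvne v hv v hx (sub_self v)
    have h3 : (∫ x, Complex.log ((v - x) / (z₀ - x)) ∂ν).re =
        ∫ x, (Complex.log ((v - x) / (z₀ - x))).re ∂ν := by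
      have := integral_re (𝕜 := ℂ) (hint v hv)
      simpa using this.symm
    rw [h3, potential, potential, ← integral_add (integrable_log_norm_sub hK hν hz)]
    · refine integral_congr_ae ?_
      filter_upwards [hν] with x hx
      rw [Complex.log_re, norm_div, Real.log_div (norm_ne_zero_iff.2 (hvne v hv x hx))
        (norm_ne_zero_iff.2 (hne x hx))]
      ring
    · exact (hint v hv).re

end potential

/-! ### The measure on the arc -/

def arcMeasure (s : ℝ) (γ : ℝ → ℂ) : Measure ℂ :=
  ((volume.restrict (Ioo (0 : ℝ) 1)).withDensity fun t => ENNReal.ofReal (weight s γ t)).map γ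

namespace CriticalArc

variable {s : ℝ} {γ : ℝ → ℂ}

/-- Each primitive gains `πi` and the pole weights sum to `-1`, so the integral of the density is
`ε`. Nonnegativity of the density excludes `ε = -1`. -/
theorem weight_eq_and_integral (h : CriticalArc s γ) : (∀ t ∈ Ioo (0 : ℝ) 1,
    (weight s γ t : ℂ) = ∑ i, (Complex.I / Real.pi * poleWeight i) *
      (2 * pole s i / (xi s γ t ^ 2 - pole s i ^ 2) * deriv (xi s γ) t)) ∧
    ∫ t in Ioo (0 : ℝ) 1, weight s γ t = 1 := by
  obtain ⟨ε, hε, h1⟩ := h.weight_eq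
  have h2 := h.integral_eq_of_prim _ h.separated_pole
    (f := fun t => (weight s γ t : ℂ)) h.integrableOn_weight.ofReal h1
  rw [integral_complex_ofReal, ← Finset.mul_sum] at h2
  have h3 : ∑ i, poleWeight i = -1 := by
    rw [Fin.sum_univ_four]; simp only [poleWeight, Matrix.cons_val]; norm_num
  have hpi : (Real.pi : ℂ) ≠ 0 := Complex.ofReal_ne_zero.2 Real.pi_ne_zero
  have h4 : ((∫ t in Ioo (0 : ℝ) 1, weight s γ t : ℝ) : ℂ) = ε := by
    rw [h2, h3]; field_simp; linear_combination (-ε : ℂ) * Complex.I_sq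
  have h5 : ∫ t in Ioo (0 : ℝ) 1, weight s γ t = ε := by exact_mod_cast h4
  have h6 : 0 ≤ ∫ t in Ioo (0 : ℝ) 1, weight s γ t := integral_nonneg (weight_nonneg s γ)
  have h7 : ε = 1 := by
    rw [h5] at h6; nlinarith
  subst h7
  refine ⟨fun t ht => ?_, h5⟩
  rw [h1 t ht]
  simp only [Complex.ofReal_one, one_mul]

theorem aemeasurable (h : CriticalArc s γ) (f : ℝ → ENNReal) :
    AEMeasurable γ ((volume.restrict (Ioo (0 : ℝ) 1)).withDensity f) :=
  ((h.cont.mono Ioo_subset_Icc_self).aemeasurable measurableSet_Ioo).mono_ac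
    (withDensity_absolutelyContinuous _ _)

theorem aemeasurable_weight (h : CriticalArc s γ) :
    AEMeasurable (fun t => (weight s γ t).toNNReal) (volume.restrict (Ioo (0 : ℝ) 1)) :=
  (h.continuousOn_weight.aemeasurable measurableSet_Ioo).real_toNNReal

theorem integral_arcMeasure (h : CriticalArc s γ) {E : Type*} [NormedAddCommGroup E]
    [NormedSpace ℝ E] {f : ℂ → E} (hf : AEStronglyMeasurable f (arcMeasure s γ)) :
    ∫ x, f x ∂arcMeasure s γ = ∫ t in Ioo (0 : ℝ) 1, weight s γ t • f (γ t) := by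
  unfold arcMeasure at hf ⊢
  rw [integral_map (h.aemeasurable _) hf]
  have := integral_withDensity_eq_integral_smul₀ h.aemeasurable_weight (fun t => f (γ t))
  refine Eq.trans this ?_
  refine integral_congr_ae (Eventually.of_forall fun t => ?_)
  simp only [NNReal.smul_def, Real.coe_toNNReal _ (weight_nonneg s γ t)]

theorem integrable_arcMeasure (h : CriticalArc s γ) {E : Type*} [NormedAddCommGroup E]
    [NormedSpace ℝ E] {f : ℂ → E} (hf : AEStronglyMeasurable f (arcMeasure s γ)) :
    Integrable f (arcMeasure s γ) ↔ IntegrableOn (fun t => weight s γ t • f (γ t)) (Ioo 0 1) := by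
  unfold arcMeasure at hf ⊢
  rw [integrable_map_measure hf (h.aemeasurable _)]
  have := integrable_withDensity_iff_integrable_smul₀ h.aemeasurable_weight
    (g := fun t => f (γ t))
  refine Iff.trans this ?_
  refine integrable_congr (Eventually.of_forall fun t => ?_)
  simp only [NNReal.smul_def, Real.coe_toNNReal _ (weight_nonneg s γ t)]

theorem isProbabilityMeasure (h : CriticalArc s γ) : IsProbabilityMeasure (arcMeasure s γ) := by
  constructor
  unfold arcMeasure
  rw [Measure.map_apply_of_aemeasurable (h.aemeasurable _) MeasurableSet.univ, preimage_univ,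
    withDensity_apply _ MeasurableSet.univ, Measure.restrict_univ,
    ← ofReal_integral_eq_lintegral_ofReal h.integrableOn_weight
      (Eventually.of_forall (weight_nonneg s γ)), h.weight_eq_and_integral.2, ENNReal.ofReal_one]

theorem isCompact_arc (h : CriticalArc s γ) : IsCompact (arc γ) :=
  isCompact_Icc.image_of_continuousOn h.cont

theorem ae_mem_arc (h : CriticalArc s γ) : ∀ᵐ x ∂arcMeasure s γ, x ∈ arc γ := by
  unfold arcMeasure
  rw [ae_map_iff (p := fun x => x ∈ arc γ) (h.aemeasurable _) h.isCompact_arc.measurableSet]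
  refine (withDensity_absolutelyContinuous _ _).ae_le ?_
  filter_upwards [ae_restrict_mem measurableSet_Ioo] with t ht
  exact mem_image_of_mem γ (Ioo_subset_Icc_self ht)

/-- Evaluation of the Cauchy integral in the uniformizing coordinate. -/
theorem integral_kernel (h : CriticalArc s γ) {v : ℂ} (hv : Separated s γ v)
    (hp : ∀ i, v ^ 2 - pole s i ^ 2 ≠ 0)
    (hint : IntegrableOn (fun t => (weight s γ t : ℂ) * (2 * v / (v ^ 2 - xi s γ t ^ 2)))
      (Ioo 0 1)) :
    ∫ t in Ioo (0 : ℝ) 1, (weight s γ t : ℂ) * (2 * v / (v ^ 2 - xi s γ t ^ 2)) =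
      -∑ i, poleWeight i * (2 / (v + pole s i)) := by
  set m : Fin 4 → ℂ := fun i => Complex.I / Real.pi * poleWeight i with hm
  -- Partial fractions of the product of the density and the kernel: `none` carries the new pole at
  -- `v`, and `some i` the fixed poles of the density.
  set c : Option (Fin 4) → ℂ := fun o => o.elim
    (∑ i, m i * (-(2 * pole s i) / (v ^ 2 - pole s i ^ 2)))
    (fun i => m i * (2 * v / (v ^ 2 - pole s i ^ 2))) with hc
  set p : Option (Fin 4) → ℂ := fun o => o.elim v (pole s) with hpd
  have hsep : ∀ o, Separated s γ (p o) := by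
    rintro (_ | i)
    · exact hv
    · exact h.separated_pole i
  have key := h.integral_eq_of_prim c hsep hint ?_
  · rw [key, Fintype.sum_option]
    simp only [hc, Option.elim]
    rw [← Finset.sum_add_distrib, Finset.mul_sum, ← Finset.sum_neg_distrib]
    refine Finset.sum_congr rfl fun i _ => ?_
    have h1 := hp i
    have hpi : (Real.pi : ℂ) ≠ 0 := Complex.ofReal_ne_zero.2 Real.pi_ne_zero
    rw [show v ^ 2 - pole s i ^ 2 = (v - pole s i) * (v + pole s i) by ring] at h1
    obtain ⟨n1, n2⟩ := mul_ne_zero_iff.1 h1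
    simp only [hm]
    rw [show v ^ 2 - pole s i ^ 2 = (v - pole s i) * (v + pole s i) by ring]
    field_simp
    linear_combination ((v - pole s i) * poleWeight i) * Complex.I_sq
  · intro t ht
    rw [h.weight_eq_and_integral.1 t ht, Fintype.sum_option]
    simp only [hc, hpd, Option.elim]
    rw [Finset.sum_mul, Finset.sum_mul, ← Finset.sum_add_distrib]
    refine Finset.sum_congr rfl fun i _ => ?_
    have h1 := hp i
    have h2 := xi_sq_sub_ne (h.separated_pole i) ht
    have h3 := xi_sq_sub_ne hv ht
    have h4 : v ^ 2 - xi s γ t ^ 2 ≠ 0 := fun h0 => h3 (by linear_combination -h0)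
    simp only [hm]
    generalize xi s γ t = X at *
    generalize deriv (xi s γ) t = X'
    generalize pole s i = q at *
    have e : 2 * q / (X ^ 2 - q ^ 2) * (2 * v / (v ^ 2 - X ^ 2)) =
        -(2 * q) / (v ^ 2 - q ^ 2) * (2 * v / (X ^ 2 - v ^ 2)) +
          2 * v / (v ^ 2 - q ^ 2) * (2 * q / (X ^ 2 - q ^ 2)) := by
      rw [show X ^ 2 - v ^ 2 = -(v ^ 2 - X ^ 2) by ring, div_neg]
      field_simp
      ring
    linear_combination (Complex.I / Real.pi * poleWeight i * X') * e

end CriticalArc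

/-! ### The exponential of the potential in the uniformizing coordinate -/

/-- The rational map inverse to the squared uniformizing coordinate. -/
def unif (s : ℝ) (v : ℂ) : ℂ :=
  Complex.I * uniK s * s * (1 + v ^ 2) / (uniTau s - v ^ 2 * conj (uniTau s)) - ctr s

/-- The complex exponential of the potential in the uniformizing coordinate, up to a constant. -/
def expPot (s : ℝ) (v : ℂ) : ℂ :=
  (v + uniSigma s) * (v + conj (uniSigma s)) * (v - uniTau s) /
    ((v + uniTau s) * (v + conj (uniTau s)) ^ 2)

section unif

variable {s : ℝ}

theorem unif_denom_eq (hs : 1 / 3 < s) (hs1 : s ≤ 1) (v : ℂ) : uniTau s - v ^ 2 * conj (uniTau s) =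
    -conj (uniTau s) * (v ^ 2 - uniTau s ^ 2) := by
  linear_combination (-uniTau s) * uniTau_mul_conj hs hs1

theorem conj_tau_ne_zero (hs : 1 / 3 < s) (hs1 : s ≤ 1) : conj (uniTau s) ≠ 0 := by
  intro h0
  have := uniTau_mul_conj hs hs1
  rw [h0, mul_zero] at this
  exact zero_ne_one this

theorem unif_denom_ne (hs : 1 / 3 < s) (hs1 : s ≤ 1) {v : ℂ} (hv : v ^ 2 - uniTau s ^ 2 ≠ 0) :
    uniTau s - v ^ 2 * conj (uniTau s) ≠ 0 := by
  rw [unif_denom_eq hs hs1]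
  exact mul_ne_zero (neg_ne_zero.2 (conj_tau_ne_zero hs hs1)) hv

theorem shift_unif (s : ℝ) (v : ℂ) : shift s (unif s v) =
    Complex.I * uniK s * s * (1 + v ^ 2) / (uniTau s - v ^ 2 * conj (uniTau s)) := by
  unfold shift unif; ring

theorem eq_unif (hs : 1 / 3 < s) (hs1 : s ≤ 1) {v z : ℂ} (hv : v ^ 2 - uniTau s ^ 2 ≠ 0) (h : v ^ 2 * denom s z = numer s z) :
    z = unif s v := by
  have h1 : shift s z = shift s (unif s v) := by
    rw [shift_unif, eq_div_iff (unif_denom_ne hs hs1 hv)]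
    unfold numer denom at h
    linear_combination -h
  unfold shift at h1
  exact add_right_cancel h1

theorem unif_spec (hs : 1 / 3 < s) (hs1 : s ≤ 1) {v : ℂ} (hv : v ^ 2 - uniTau s ^ 2 ≠ 0) :
    v ^ 2 * denom s (unif s v) = numer s (unif s v) := by
  have h := shift_unif s v
  rw [eq_div_iff (unif_denom_ne hs hs1 hv)] at h
  unfold numer denom
  linear_combination -h

theorem hasDerivAt_unif (hs : 1 / 3 < s) (hs1 : s ≤ 1) {v : ℂ} (hv : v ^ 2 - uniTau s ^ 2 ≠ 0) :
    HasDerivAt (unif s) (Complex.I * uniK s * s * (2 * v * uniE s) /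
      (uniTau s - v ^ 2 * conj (uniTau s)) ^ 2) v := by
  have hn := unif_denom_ne hs hs1 hv
  have h2 := (hasDerivAt_id v).fun_pow 2
  have := (((h2.const_add 1).const_mul (Complex.I * uniK s * s)).fun_div
    ((h2.mul_const (conj (uniTau s))).const_sub (uniTau s)) hn).sub_const (ctr s : ℂ)
  refine this.congr_deriv ?_
  congr 1
  rw [← uniTau_add_conj]
  simp
  ring

/-- As a function of `v`, the difference `unif s v - z` has simple zeros at `±x` and simple poles at
`±τ`, the preimages of infinity. The identity is its logarithmic derivative. -/
theorem unif_kernel (hs : 1 / 3 < s) (hs1 : s ≤ 1) {v x z : ℂ} (hv : v ^ 2 - uniTau s ^ 2 ≠ 0) (hx : x ^ 2 - uniTau s ^ 2 ≠ 0)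
    (hz : x ^ 2 * denom s z = numer s z) (hvx : v ^ 2 - x ^ 2 ≠ 0) :
    unif s v - z ≠ 0 ∧ Complex.I * uniK s * s * (2 * v * uniE s) /
      (uniTau s - v ^ 2 * conj (uniTau s)) ^ 2 * (unif s v - z)⁻¹ =
      2 * v / (v ^ 2 - x ^ 2) - 2 * v / (v ^ 2 - uniTau s ^ 2) := by
  have nv := unif_denom_ne hs hs1 hv
  have nx := unif_denom_ne hs hs1 hx
  have he : (uniE s : ℂ) ≠ 0 := Complex.ofReal_ne_zero.2 (uniE_pos hs hs1).ne'
  have hk : (uniK s : ℂ) ≠ 0 := Complex.ofReal_ne_zero.2 (uniK_pos hs).ne'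
  have hs0 : (s : ℂ) ≠ 0 := Complex.ofReal_ne_zero.2 (by linarith)
  have hI := Complex.I_ne_zero
  have e1 : unif s v - z = Complex.I * uniK s * s * uniE s * (v ^ 2 - x ^ 2) /
      ((uniTau s - v ^ 2 * conj (uniTau s)) * (uniTau s - x ^ 2 * conj (uniTau s))) := by
    rw [eq_unif hs hs1 hx hz, ← uniTau_add_conj]
    unfold unif
    rw [sub_sub_sub_cancel_right, div_sub_div _ _ nv nx]
    congr 1
    ring
  constructor
  · rw [e1]
    exact div_ne_zero (by simp [*]) (mul_ne_zero nv nx)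
  · rw [e1]
    have ev := unif_denom_eq hs hs1 v
    have ex := unif_denom_eq hs hs1 x
    have ht := conj_tau_ne_zero hs hs1
    rw [ev, ex]
    field_simp
    ring

/-- `expPot` is built so that its logarithmic derivative is the value in `integral_kernel`,
corrected by the contribution of the poles `±τ` of `unif`. -/
theorem hasDerivAt_expPot {v : ℂ} (hp : ∀ i, v ^ 2 - pole s i ^ 2 ≠ 0) :
    expPot s v ≠ 0 ∧ ∃ F', HasDerivAt (expPot s) F' v ∧ F' / expPot s v =
      -∑ i, poleWeight i * (2 / (v + pole s i)) - 2 * v / (v ^ 2 - uniTau s ^ 2) := by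
  have n1 := hp 0
  have n2 := hp 1
  have n3 := hp 2
  have n4 := hp 3
  simp only [pole, Matrix.cons_val] at n1 n2 n3 n4
  rw [show v ^ 2 - (uniSigma s) ^ 2 = (v - uniSigma s) * (v + uniSigma s) by ring] at n1
  rw [show v ^ 2 - conj (uniSigma s) ^ 2 = (v - conj (uniSigma s)) * (v + conj (uniSigma s)) by
    ring] at n2
  rw [show v ^ 2 - conj (uniTau s) ^ 2 = (v - conj (uniTau s)) * (v + conj (uniTau s)) by
    ring] at n3
  rw [show v ^ 2 - (-uniTau s) ^ 2 = (v - uniTau s) * (v + uniTau s) by ring] at n4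
  obtain ⟨-, a1⟩ := mul_ne_zero_iff.1 n1
  obtain ⟨-, a2⟩ := mul_ne_zero_iff.1 n2
  obtain ⟨-, a3⟩ := mul_ne_zero_iff.1 n3
  obtain ⟨a4, a5⟩ := mul_ne_zero_iff.1 n4
  have h0 := hasDerivAt_id v
  have hd := (((h0.add_const (uniSigma s)).fun_mul (h0.add_const (conj (uniSigma s)))).fun_mul
    (h0.sub_const (uniTau s))).fun_div ((h0.add_const (uniTau s)).fun_mul
    ((h0.add_const (conj (uniTau s))).fun_pow 2)) (mul_ne_zero a5 (pow_ne_zero 2 a3))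
  refine ⟨div_ne_zero (mul_ne_zero (mul_ne_zero a1 a2) a4) (mul_ne_zero a5 (pow_ne_zero 2 a3)),
    _, hd, ?_⟩
  rw [Fin.sum_univ_four]
  simp only [poleWeight, pole, Matrix.cons_val, expPot, id, Nat.cast_ofNat, Nat.add_one_sub_one,
    pow_one]
  rw [show v ^ 2 - (uniTau s) ^ 2 = (v - uniTau s) * (v + uniTau s) by ring,
    show v + -uniTau s = v - uniTau s by ring]
  generalize conj (uniTau s) = a at *
  generalize conj (uniSigma s) = b at *
  generalize uniTau s = c at *
  generalize uniSigma s = d at *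
  field_simp
  ring

/-- The exponential of the potential in the original variables. -/
theorem norm_expPot_coord (hs : 1 / 3 < s) (hs1 : s ≤ 1) {z r : ℂ} (hr : r ^ 2 = quad s z) (hr0 : r ≠ 0)
    (hp : ∀ i, coord s z r ^ 2 - pole s i ^ 2 ≠ 0) :
    ‖expPot s (coord s z r)‖ = uniK s * s * (‖shift s z + 2 * r‖ / ‖shift s z + r‖ ^ 2) := by
  have n3 := hp 2
  have n4 := hp 3
  simp only [pole, Matrix.cons_val] at n3 n4
  have c1 := coord_add_inv hs hs1 hr hr0
  have c2 := coord_sub_inv hs hs1 hr hr0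
  have v0 := coord_ne_zero hs hs1 hr hr0
  have he : (uniE s : ℂ) ≠ 0 := Complex.ofReal_ne_zero.2 (uniE_pos hs hs1).ne'
  have hk : (uniK s : ℂ) ≠ 0 := Complex.ofReal_ne_zero.2 (uniK_pos hs).ne'
  have hs0 : (s : ℂ) ≠ 0 := Complex.ofReal_ne_zero.2 (by linarith)
  have hI := Complex.I_ne_zero
  have hT1 := uniTau_mul_conj hs hs1
  have hT2 := uniTau_add_conj s
  have hT3 := uniTau_sub_conj s
  have hS1 := uniSigma_mul_conj hs hs1
  have hS2 := uniSigma_add_conj s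
  set v := coord s z r
  set A := shift s z
  rw [show v ^ 2 - conj (uniTau s) ^ 2 = (v - conj (uniTau s)) * (v + conj (uniTau s)) by
    ring] at n3
  rw [show v ^ 2 - (-uniTau s) ^ 2 = (v - uniTau s) * (v + uniTau s) by ring] at n4
  obtain ⟨-, a3⟩ := mul_ne_zero_iff.1 n3
  obtain ⟨a4, a5⟩ := mul_ne_zero_iff.1 n4
  have f1 : (v ^ 2 + 1) * r = v * (uniE s * A) := by
    have : v ^ 2 + 1 = v * (v + v⁻¹) := by field_simp
    rw [this, c1]; field_simp
  have f2 : (v ^ 2 - 1) * r = v * (Complex.I * uniK s * (A - 2 * s)) := by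
    have : v ^ 2 - 1 = v * (v - v⁻¹) := by field_simp
    rw [this, c2]; field_simp
  -- The relation for `ξ + 1/ξ` merges conjugate pairs of factors into `A + 2r` and `A + r`; the
  -- leftover factors in `τ` are treated with the relation for `ξ - 1/ξ`.
  have g1 : (v + uniSigma s) * (v + conj (uniSigma s)) * r = v * uniE s * (A + 2 * r) := by
    linear_combination f1 + r * hS1 + r * v * hS2
  have g2 : (v + uniTau s) * (v + conj (uniTau s)) * r = v * uniE s * (A + r) := by
    linear_combination f1 + r * hT1 + r * v * hT2
  have g3 : (v ^ 2 - uniTau s ^ 2) * conj (uniTau s) * r = -v * Complex.I * uniE s * uniK s * s := by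
    have : 2 * (conj (uniTau s) * v ^ 2 - uniTau s) * r =
        -2 * (v * Complex.I * uniE s * uniK s * s) := by
      linear_combination (uniE s : ℂ) * f2 - Complex.I * uniK s * f1 +
        r * (v ^ 2 - 1) * hT2 - r * (v ^ 2 + 1) * hT3
    linear_combination this / 2 - uniTau s * r * hT1
  have hAr : A + r ≠ 0 := by
    intro h0
    rw [h0, mul_zero] at g2
    exact mul_ne_zero (mul_ne_zero a5 a3) hr0 g2
  have key : expPot s v * conj (uniTau s) = -Complex.I * uniK s * s * ((A + 2 * r) / (A + r) ^ 2) := by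
    unfold expPot
    have ht := conj_tau_ne_zero hs hs1
    have hl : v * uniE s ≠ 0 := mul_ne_zero v0 he
    have e1 : A + 2 * r = (v + uniSigma s) * (v + conj (uniSigma s)) * r / (v * uniE s) := by
      rw [g1]; field_simp
    have e2 : A + r = (v + uniTau s) * (v + conj (uniTau s)) * r / (v * uniE s) := by
      rw [g2]; field_simp
    rw [e1, e2]
    field_simp
    linear_combination (v + uniSigma s) * (v + conj (uniSigma s)) * g3
  have h1 := congrArg norm key
  rw [norm_mul, RCLike.norm_conj, norm_eq_one_of_mul_conj hT1, mul_one] at h1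
  rw [h1]
  simp only [norm_mul, norm_neg, Complex.norm_I, one_mul, norm_div, norm_pow, Complex.norm_real,
    Real.norm_eq_abs]
  rw [abs_of_pos (uniK_pos hs), abs_of_pos (by linarith : 0 < s)]

end unif

/-- For `f(φ) = a cos φ + b sin φ` one has `sin θ · f(xθ) = sin (θ - xθ) · f(0) + sin (xθ) · f(θ)`,
with nonnegative coefficients. This keeps `Separated` valid while a point is rotated through less
than a half-turn. -/
theorem add_mul_cos_sin_pos_aux {a b θ x : ℝ} (ha : 0 < a) (h : 0 < a * Real.cos θ + b * Real.sin θ)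
    (h0 : 0 < θ) (hθ : θ < Real.pi) (hx : x ∈ Icc (0 : ℝ) 1) :
    0 < a * Real.cos (x * θ) + b * Real.sin (x * θ) := by
  rcases hx.1.eq_or_lt with h1 | h1
  · rw [← h1]; simpa using ha
  have hs := Real.sin_pos_of_pos_of_lt_pi h0 hθ
  have h2 : 0 < Real.sin (x * θ) := Real.sin_pos_of_pos_of_lt_pi (by positivity) (by nlinarith [hx.2])
  have h3 : 0 ≤ Real.sin (θ - x * θ) :=
    Real.sin_nonneg_of_nonneg_of_le_pi (by nlinarith [hx.2]) (by nlinarith)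
  have e : Real.sin θ * (a * Real.cos (x * θ) + b * Real.sin (x * θ)) =
      Real.sin (θ - x * θ) * a + Real.sin (x * θ) * (a * Real.cos θ + b * Real.sin θ) := by
    rw [Real.sin_sub]; ring
  have h4 : 0 < Real.sin θ * (a * Real.cos (x * θ) + b * Real.sin (x * θ)) := by
    rw [e]; nlinarith [mul_pos h2 h, mul_nonneg h3 ha.le]
  exact (pos_iff_pos_of_mul_pos h4).1 hs

theorem add_mul_cos_sin_pos {a b θ x : ℝ} (ha : 0 < a) (h : 0 < a * Real.cos θ + b * Real.sin θ)
    (hθ : |θ| < Real.pi) (hx : x ∈ Icc (0 : ℝ) 1) :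
    0 < a * Real.cos (x * θ) + b * Real.sin (x * θ) := by
  rcases lt_trichotomy θ 0 with h0 | h0 | h0
  · have := add_mul_cos_sin_pos_aux (b := -b) (θ := -θ) ha
      (by rw [Real.cos_neg, Real.sin_neg]; linarith) (by linarith) (by rwa [abs_of_neg h0] at hθ) hx
    rw [mul_neg, Real.cos_neg, Real.sin_neg] at this
    linarith
  · rw [h0]; simpa using ha
  · exact add_mul_cos_sin_pos_aux ha h h0 (by rwa [abs_of_pos h0] at hθ) hx

theorem eq_of_hasDerivAt_zero {f : ℝ → ℝ} (h : ∀ x ∈ Icc (0 : ℝ) 1, HasDerivAt f 0 x) :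
    f 1 = f 0 := by
  obtain ⟨c, -, hc⟩ := exists_hasDerivAt_eq_slope f (fun _ => 0) (zero_lt_one' ℝ)
    (fun x hx => (h x hx).continuousAt.continuousWithinAt)
    (fun x hx => h x (Ioo_subset_Icc_self hx))
  rw [eq_comm, div_eq_zero_iff] at hc
  rcases hc with hc | hc
  · linarith
  · norm_num at hc

namespace CriticalArc

variable {s : ℝ} {γ : ℝ → ℂ}

theorem xi_sq_mul_denom (h : CriticalArc s γ) {t : ℝ} (ht : t ∈ Ioo (0 : ℝ) 1) :
    xi s γ t ^ 2 * denom s (γ t) = numer s (γ t) :=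
  coord_sq h.s_gt h.s_le (root_sq _ _) (h.root_ne ht)

theorem unif_notMem_arc (h : CriticalArc s γ) {v : ℂ} (hv : Separated s γ v)
    (hp : ∀ i, v ^ 2 - pole s i ^ 2 ≠ 0) : unif s v ∉ arc γ := by
  have ht0 : v ^ 2 - uniTau s ^ 2 ≠ 0 := by
    have := hp 3; simp only [pole, Matrix.cons_val, neg_sq] at this; exact this
  have hspec := unif_spec h.s_gt h.s_le ht0
  rintro ⟨t, ht, he⟩
  rw [← he] at hspec
  rcases eq_or_ne t 0 with rfl | h0
  · rw [h.denom_source.1, mul_zero] at hspec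
    exact h.denom_source.2 hspec.symm
  rcases eq_or_ne t 1 with rfl | h1
  · rw [h.numer_target.1] at hspec
    exact mul_ne_zero (pow_ne_zero 2 hv.1) h.numer_target.2 hspec
  have ht' : t ∈ Ioo (0 : ℝ) 1 := ⟨lt_of_le_of_ne ht.1 h0.symm, lt_of_le_of_ne ht.2 h1⟩
  have hd : denom s (γ t) ≠ 0 := by
    intro h2
    have := numer_mul_denom h.s_gt h.s_le (γ t)
    rw [h2, mul_zero] at this
    exact (h.nondeg ht').1 this.symm
  rw [← h.xi_sq_mul_denom ht'] at hspec
  have := mul_right_cancel₀ hd hspec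
  exact xi_sq_sub_ne hv ht' (by rw [this, sub_self])

/-- The derivative of the potential is a Cauchy integral, which `unif_kernel` and `integral_kernel`
evaluate. Total mass 1 accounts for the term at infinity, and the result matches the logarithmic
derivative of `expPot`. -/
theorem hasDerivAt_potential_sub (h : CriticalArc s γ) {p : ℝ → ℂ} {p' : ℂ} {x : ℝ}
    (hpd : HasDerivAt p p' x) (hv : Separated s γ (p x))
    (hp : ∀ i, p x ^ 2 - pole s i ^ 2 ≠ 0) :
    HasDerivAt (fun y => potential (arcMeasure s γ) (unif s (p y)) - Real.log ‖expPot s (p y)‖)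
      0 x := by
  have := h.isProbabilityMeasure
  have hs := h.s_gt
  have hs1 := h.s_le
  have ht0 : p x ^ 2 - uniTau s ^ 2 ≠ 0 := by
    have := hp 3; simp only [pole, Matrix.cons_val, neg_sq] at this; exact this
  have hz := h.unif_notMem_arc hv hp
  obtain ⟨Φ, hΦ, -, hΦe⟩ := exists_analytic_potential h.isCompact_arc h.ae_mem_arc hz
  have hU := hasDerivAt_unif hs hs1 ht0
  have hU2 : HasDerivAt (fun y => unif s (p y)) _ x := HasDerivAt.comp_of_eq x hU hpd rfl
  have hΦ2 : HasDerivAt (fun y => Φ (unif s (p y))) _ x :=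
    HasDerivAt.comp_of_eq x hΦ.self_of_nhds hU2 rfl
  obtain ⟨hF0, F', hF, hFe⟩ := hasDerivAt_expPot hp
  have hF2 : HasDerivAt (fun y => expPot s (p y)) _ x := HasDerivAt.comp_of_eq x hF hpd rfl
  have hL := hasDerivAt_log_norm hF2 hF0
  have hre := Complex.reCLM.hasFDerivAt.comp_hasDerivAt x hΦ2
  have hmain := (hre.const_add (potential (arcMeasure s γ) (unif s (p x)))).sub hL
  have hev : ∀ᶠ y in 𝓝 x, potential (arcMeasure s γ) (unif s (p y)) =
      potential (arcMeasure s γ) (unif s (p x)) + (Φ (unif s (p y))).re :=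
    hU2.continuousAt.eventually hΦe
  refine (hmain.congr_of_eventuallyEq (hev.mono fun y hy => ?_)).congr_deriv ?_
  · simp only [Pi.sub_apply, Function.comp_apply, Complex.reCLM_apply] at hy ⊢
    rw [hy]
  simp only [Complex.reCLM_apply]
  rw [← Complex.sub_re]
  have hmeas : AEStronglyMeasurable (fun y => (unif s (p x) - y)⁻¹) (arcMeasure s γ) := by fun_prop
  have hi := (h.integrable_arcMeasure hmeas).1
    (integrable_inv_sub h.isCompact_arc.isClosed h.ae_mem_arc hz)
  set D := Complex.I * uniK s * s * (2 * p x * uniE s) /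
      (uniTau s - p x ^ 2 * conj (uniTau s)) ^ 2 with hD
  have hker : ∀ t ∈ Ioo (0 : ℝ) 1, D * (unif s (p x) - γ t)⁻¹ =
      2 * p x / (p x ^ 2 - xi s γ t ^ 2) - 2 * p x / (p x ^ 2 - uniTau s ^ 2) := by
    intro t ht
    have h1 : xi s γ t ^ 2 - uniTau s ^ 2 ≠ 0 := by
      have := xi_sq_sub_ne h.separated_neg_tau ht; rwa [neg_sq] at this
    have h2 := xi_sq_sub_ne hv ht
    exact (unif_kernel hs hs1 ht0 h1 (h.xi_sq_mul_denom ht)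
      (fun h0 => h2 (by linear_combination -h0))).2
  have hw : IntegrableOn (fun t => (weight s γ t : ℂ)) (Ioo 0 1) := h.integrableOn_weight.ofReal
  have hfe : ∀ t ∈ Ioo (0 : ℝ) 1, (weight s γ t : ℂ) * (2 * p x / (p x ^ 2 - xi s γ t ^ 2)) =
      D * (weight s γ t • (unif s (p x) - γ t)⁻¹) +
        2 * p x / (p x ^ 2 - uniTau s ^ 2) * weight s γ t := by
    intro t ht
    rw [Complex.real_smul]
    linear_combination (-weight s γ t : ℂ) * hker t ht
  have hsum : IntegrableOn (fun t => D * (weight s γ t • (unif s (p x) - γ t)⁻¹) +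
        2 * p x / (p x ^ 2 - uniTau s ^ 2) * weight s γ t) (Ioo 0 1) :=
    (hi.const_mul D).add (hw.const_mul _)
  have hint : IntegrableOn (fun t => (weight s γ t : ℂ) *
      (2 * p x / (p x ^ 2 - xi s γ t ^ 2))) (Ioo 0 1) :=
    hsum.congr_fun (fun t ht => (hfe t ht).symm) measurableSet_Ioo
  have hk := h.integral_kernel hv hp hint
  rw [setIntegral_congr_fun measurableSet_Ioo hfe, integral_add (hi.const_mul D) (hw.const_mul _),
    integral_const_mul, integral_const_mul, integral_complex_ofReal, h.weight_eq_and_integral.2,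
    ← h.integral_arcMeasure hmeas] at hk
  rw [show F' * p' / expPot s (p x) = F' / expPot s (p x) * p' by ring, hFe, ← hk]
  have : (∫ y, (unif s (p x) - y)⁻¹ ∂arcMeasure s γ) * (D * p') -
      (D * ∫ y, (unif s (p x) - y)⁻¹ ∂arcMeasure s γ) * p' = 0 := by ring
  rw [← Complex.zero_re, ← this]
  congr 1
  push_cast
  ring

theorem separated_neg_I_mul (h : CriticalArc s γ) {ρ : ℝ} (hρ : 0 < ρ) :
    Separated s γ (-Complex.I * ρ) := by
  refine ⟨by simp [hρ.ne'], fun t ht _ => ?_⟩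
  have := mul_pos hρ (h.xi_re_pos ht)
  simp only [Complex.mul_im, Complex.conj_re, Complex.conj_im, Complex.neg_re, Complex.neg_im,
    Complex.I_re, Complex.I_im, Complex.mul_re, Complex.ofReal_re, Complex.ofReal_im]
  linarith

theorem norm_pole (h : CriticalArc s γ) (i : Fin 4) : ‖pole s i‖ = 1 := by
  have h1 := norm_eq_one_of_mul_conj (uniSigma_mul_conj h.s_gt h.s_le)
  have h2 := norm_eq_one_of_mul_conj (uniTau_mul_conj h.s_gt h.s_le)
  fin_cases i <;> simp [pole, h1, h2]

theorem pole_re_ne (h : CriticalArc s γ) (i : Fin 4) : (pole s i).re ≠ 0 := by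
  have := (uniE_pos h.s_gt h.s_le).ne'
  fin_cases i <;> simp [pole, uniSigma_re, uniTau_re, this]

theorem regular_of_norm_ne_one (h : CriticalArc s γ) {v : ℂ} (hv : ‖v‖ ≠ 1) (i : Fin 4) :
    v ^ 2 - pole s i ^ 2 ≠ 0 := by
  intro h0
  have := congrArg norm (sub_eq_zero.1 h0)
  rw [norm_pow, norm_pow, h.norm_pole, one_pow] at this
  exact hv ((pow_eq_one_iff_of_nonneg (norm_nonneg _) two_ne_zero).1 this)

theorem regular_neg_I_mul (h : CriticalArc s γ) (ρ : ℝ) (i : Fin 4) :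
    (-Complex.I * ρ) ^ 2 - pole s i ^ 2 ≠ 0 := by
  intro h0
  have := h.pole_re_ne i
  rcases sq_eq_sq_iff_eq_or_eq_neg.1 (sub_eq_zero.1 h0) with h1 | h1
  · have h2 := congrArg Complex.re h1
    simp at h2
    exact this h2.symm
  · have h2 := congrArg Complex.re h1
    simp at h2
    exact this h2

/-- The potential in the uniformizing coordinate. -/
theorem potential_unif (h : CriticalArc s γ) {v : ℂ} (hv : Separated s γ v) (hn : ‖v‖ ≠ 1)
    (hsl : Complex.I * v ∈ Complex.slitPlane) :
    potential (arcMeasure s γ) (unif s v) - Real.log ‖expPot s v‖ =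
      potential (arcMeasure s γ) (unif s (-Complex.I)) - Real.log ‖expPot s (-Complex.I)‖ := by
  set G : ℂ → ℝ := fun v => potential (arcMeasure s γ) (unif s v) - Real.log ‖expPot s v‖ with hG
  change G v = G (-Complex.I)
  set ρ := ‖v‖
  have hρ : 0 < ρ := norm_pos_iff.2 hv.1
  set θ := (Complex.I * v).arg with hθ
  have hvθ : v = -Complex.I * ρ * Complex.exp (θ * Complex.I) := by
    have h1 := Complex.norm_mul_exp_arg_mul_I (Complex.I * v)
    rw [norm_mul, Complex.norm_I, one_mul] at h1
    linear_combination Complex.I * h1 + v * Complex.I_sq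
  have hθpi : |θ| < Real.pi := by
    refine lt_of_le_of_ne (Complex.abs_arg_le_pi _) fun h0 => ?_
    rcases (abs_eq Real.pi_pos.le).1 h0 with h1 | h1
    · exact (Complex.mem_slitPlane_iff_arg.1 hsl).1 h1
    · have := Complex.neg_pi_lt_arg (Complex.I * v)
      rw [← hθ] at this; linarith
  have hre : ∀ (w : ℂ) (φ : ℝ), (w * conj (-Complex.I * ρ * Complex.exp (φ * Complex.I))).im =
      ρ * (w.re * Real.cos φ + w.im * Real.sin φ) := by
    intro w φ
    rw [Complex.exp_mul_I, ← Complex.ofReal_cos, ← Complex.ofReal_sin]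
    simp only [Complex.mul_im, Complex.conj_re, Complex.conj_im, Complex.neg_re, Complex.neg_im,
      Complex.I_re, Complex.I_im, Complex.mul_re, Complex.ofReal_re, Complex.ofReal_im,
      Complex.add_re, Complex.add_im]
    ring
  have hnorm : ∀ φ : ℝ, ‖-Complex.I * ρ * Complex.exp (φ * Complex.I)‖ = ρ := by
    intro φ
    rw [norm_mul, norm_mul, norm_neg, Complex.norm_I, Complex.norm_exp_ofReal_mul_I, one_mul,
      mul_one, Complex.norm_real, Real.norm_eq_abs, abs_of_pos hρ]
  -- Rotation along the circle of radius `ρ` from `-iρ` to `v`. Separation holds at both ends, hence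
  -- in between, and `ρ ≠ 1` avoids the poles.
  have step1 : G (-Complex.I * ρ * Complex.exp (((1 * θ : ℝ) : ℂ) * Complex.I)) =
      G (-Complex.I * ρ * Complex.exp (((0 * θ : ℝ) : ℂ) * Complex.I)) := by
    refine eq_of_hasDerivAt_zero
      (f := fun x : ℝ => G (-Complex.I * ρ * Complex.exp (((x * θ : ℝ) : ℂ) * Complex.I)))
      fun x hx => ?_
    have hd : HasDerivAt (fun x : ℝ => -Complex.I * ρ * Complex.exp (((x * θ : ℝ) : ℂ) * Complex.I))
        _ x :=
      (((((hasDerivAt_id x).mul_const θ).ofReal_comp).mul_const Complex.I).cexp).const_mul _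
    refine h.hasDerivAt_potential_sub hd ⟨?_, fun t ht htn => ?_⟩
      (h.regular_of_norm_ne_one (by rw [hnorm]; exact hn))
    · rw [← norm_ne_zero_iff, hnorm]; exact hρ.ne'
    · rw [hnorm] at htn
      rw [hre]
      refine mul_pos hρ (add_mul_cos_sin_pos (h.xi_re_pos ht) ?_ hθpi hx)
      have h1 := hv.2 t ht htn
      rw [hvθ, hre] at h1
      exact (pos_iff_pos_of_mul_pos h1).1 hρ
  -- Motion along the ray from `-iρ` to `-i`. Every point of it is separated because `Re ξ > 0` on
  -- the arc, and the poles have nonzero real part.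
  have step2 : G (-Complex.I * ((ρ + 1 * (1 - ρ) : ℝ) : ℂ)) =
      G (-Complex.I * ((ρ + 0 * (1 - ρ) : ℝ) : ℂ)) := by
    refine eq_of_hasDerivAt_zero (f := fun x : ℝ => G (-Complex.I * ((ρ + x * (1 - ρ) : ℝ) : ℂ)))
      fun x hx => ?_
    have hd : HasDerivAt (fun x : ℝ => -Complex.I * ((ρ + x * (1 - ρ) : ℝ) : ℂ)) _ x :=
      ((((hasDerivAt_id x).mul_const (1 - ρ)).const_add ρ).ofReal_comp).const_mul _
    have hpos : 0 < ρ + x * (1 - ρ) := by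
      rcases hx.2.eq_or_lt with h1 | h1
      · rw [h1]; linarith
      · have := mul_pos hρ (sub_pos.2 h1); nlinarith [hx.1]
    exact h.hasDerivAt_potential_sub hd (h.separated_neg_I_mul hpos) (h.regular_neg_I_mul _)
  rw [one_mul, zero_mul, Complex.ofReal_zero, zero_mul, Complex.exp_zero, mul_one, ← hvθ] at step1
  rw [one_mul, zero_mul, add_zero, add_sub_cancel, Complex.ofReal_one, mul_one] at step2
  rw [step1, step2]

end CriticalArc

/-! ### Choice of the sheet that computes the potential -/

/-- The exponential of the potential, up to a constant factor. -/
def modulus (s : ℝ) (z : ℂ) : ℝ :=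
  if circ s z ≤ 0 then lowMod s z else max (lowMod s z) (highMod s z)

theorem coord_neg (s : ℝ) (z r : ℂ) : coord s z (-r) = -coord s z r := by
  unfold coord; rw [div_neg]

theorem numer_injective {s : ℝ} (hs : 1 / 3 < s) (hs1 : s ≤ 1) : Function.Injective (numer s) := by
  intro z w hzw
  have ht : uniTau s ≠ 0 := fun h0 => conj_tau_ne_zero hs hs1 (by rw [h0, map_zero])
  unfold numer shift at hzw
  have : uniTau s * (z - w) = 0 := by linear_combination hzw
  exact sub_eq_zero.1 ((mul_eq_zero.1 this).resolve_left ht)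

theorem denom_injective {s : ℝ} (hs : 1 / 3 < s) (hs1 : s ≤ 1) : Function.Injective (denom s) := by
  intro z w hzw
  unfold denom shift at hzw
  have : conj (uniTau s) * (z - w) = 0 := by linear_combination hzw
  exact sub_eq_zero.1 ((mul_eq_zero.1 this).resolve_left (conj_tau_ne_zero hs hs1))

namespace CriticalArc

variable {s : ℝ} {γ : ℝ → ℂ}

theorem quad_ne_zero_of_notMem (h : CriticalArc s γ) {z : ℂ} (hz : z ∉ arc γ) :
    quad s z ≠ 0 := by
  intro h0
  rw [← numer_mul_denom h.s_gt h.s_le] at h0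
  rcases mul_eq_zero.1 h0 with h1 | h1
  · rw [← h.numer_target.1] at h1
    exact hz ⟨1, by simp, (numer_injective h.s_gt h.s_le h1).symm⟩
  · rw [← h.denom_source.1] at h1
    exact hz ⟨0, by simp, (denom_injective h.s_gt h.s_le h1).symm⟩

theorem shift_sq_sub_quad_ne_of_im (h : CriticalArc s γ) {z : ℂ} (hz : z.im ≠ 0) :
    shift s z ^ 2 - quad s z ≠ 0 := by
  rw [shift_sq_sub_quad]
  have := ctr_pos h.s_gt
  refine mul_ne_zero (Complex.ofReal_ne_zero.2 (by positivity)) fun h0 => hz ?_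
  have := congrArg Complex.im h0
  rwa [Complex.add_im, Complex.ofReal_im, add_zero] at this

/-- A root whose coordinate is separated and computes the modulus. -/
theorem exists_lift (h : CriticalArc s γ) {z : ℂ} (hz : z ∉ arc γ) (him : z.im ≠ 0) :
    ∃ r, r ^ 2 = quad s z ∧ Separated s γ (coord s z r) ∧
      Complex.I * coord s z r ∈ Complex.slitPlane ∧
      modulus s z = ‖shift s z + 2 * r‖ / ‖shift s z + r‖ ^ 2 := by
  have hs := h.s_gt
  have hs1 := h.s_le
  have hq := h.quad_ne_zero_of_notMem hz
  have hr := root_sq s z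
  have hr0 : root s z ≠ 0 := root_ne_zero hq
  have hre := root_re_nonneg s z
  set r := root s z
  have h1 := coord_re_mul hs hs1 hr hr0
  have h2 := coord_sq_im_mul hs hs1 hr hr0
  have h3 := normSq_denom_pos hs hs1 hr hr0
  have hv0 := coord_ne_zero hs hs1 hr hr0
  have hvre : 0 ≤ (coord s z r).re := by
    have h4 : 0 ≤ uniE s * (shift s z * conj r).re := mul_nonneg (uniE_pos hs hs1).le hre
    rw [← h1] at h4
    exact nonneg_of_mul_nonneg_left h4 (coord_factor_pos hr0)
  have hek : 0 < uniE s * uniK s / 2 := by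
    have := uniE_pos hs hs1; have := uniK_pos hs; positivity
  have hsl : ∀ v : ℂ, (0 < -v.im ∨ v.re ≠ 0) → Complex.I * v ∈ Complex.slitPlane := by
    intro v hv
    rw [Complex.mem_slitPlane_iff, Complex.I_mul_re, Complex.I_mul_im]
    exact hv
  -- The sign of `circ` is that of `Im ξ²`. If it is nonpositive, a root with `Re (A r̄) ≥ 0` has
  -- `ξ` in the closed fourth quadrant. Otherwise the dominant `ξ` lies in the open first quadrant,
  -- and the sign of `disc` decides between `ξ` and `-ξ`.
  by_cases hc : circ s z ≤ 0
  · have hm : modulus s z = lowMod s z := if_pos hc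
    have h5 : (coord s z r).re * (coord s z r).im ≤ 0 := by
      by_contra! h6
      have := mul_pos (mul_pos two_pos h6) h3
      rw [h2] at this
      nlinarith
    have main : ∀ r', r' ^ 2 = quad s z → 0 ≤ (shift s z * conj r').re → coord s z r' ≠ 0 →
        0 ≤ (coord s z r').re → (coord s z r').im ≤ 0 →
        ∃ r, r ^ 2 = quad s z ∧ Separated s γ (coord s z r) ∧
          Complex.I * coord s z r ∈ Complex.slitPlane ∧
          modulus s z = ‖shift s z + 2 * r‖ / ‖shift s z + r‖ ^ 2 := by
      intro r' g1 g2 g0 g3 g4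
      refine ⟨r', g1, h.separated_of_quadrant g0 g3 g4, hsl _ ?_, by rw [hm, lowMod_eq g1 g2]⟩
      by_contra! h6
      exact g0 (Complex.ext h6.2 (by rw [Complex.zero_im]; linarith [h6.1]))
    rcases hvre.eq_or_lt with h6 | h6
    · rcases le_total (coord s z r).im 0 with h7 | h7
      · exact main r hr hre hv0 hvre h7
      · have h8 : (shift s z * conj r).re = 0 := by
          rw [← h6, zero_mul] at h1
          exact (mul_eq_zero.1 h1.symm).resolve_left (uniE_pos hs hs1).ne'
        refine main (-r) (by rw [neg_sq, hr]) ?_ ?_ ?_ ?_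
        · rw [map_neg, mul_neg, Complex.neg_re, h8, neg_zero]
        · rw [coord_neg]; exact neg_ne_zero.2 hv0
        · rw [coord_neg, Complex.neg_re, ← h6, neg_zero]
        · rw [coord_neg, Complex.neg_im]; linarith
    · exact main r hr hre hv0 hvre (by by_contra! h7; nlinarith [mul_pos h6 h7])
  · push Not at hc
    have hm : modulus s z = max (lowMod s z) (highMod s z) := if_neg (not_le.2 hc)
    have h5 : 0 < (coord s z r).re * (coord s z r).im := by
      have h6 := mul_pos hek hc
      rw [← h2] at h6
      have := (pos_iff_pos_of_mul_pos h6).2 h3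
      linarith
    have h6 : 0 < (coord s z r).re := by
      rcases hvre.eq_or_lt with h7 | h7
      · rw [← h7, zero_mul] at h5; exact absurd h5 (lt_irrefl _)
      · exact h7
    have h7 : 0 < (coord s z r).im := (pos_iff_pos_of_mul_pos h5).1 h6
    have hdU := discU_coord hs hs1 hr hr0
    have hr4 : 0 < ‖r‖ ^ 4 := by have := norm_pos_iff.2 hr0; positivity
    have hne := h.shift_sq_sub_quad_ne_of_im him
    have hcr : 0 < cross s z := by
      rw [cross_eq_root]
      have h8 := mul_pos h6 (coord_factor_pos (s := s) (z := z) hr0)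
      rw [h1] at h8
      exact (pos_iff_pos_of_mul_pos h8).1 (uniE_pos hs hs1)
    have he2 : 0 < uniE s ^ 2 := by have := uniE_pos hs hs1; positivity
    rcases le_or_gt 0 (disc s z) with h9 | h9
    · refine ⟨r, hr, h.separated_of_discU_nonneg h6 h7.le ?_ ?_, hsl _ (Or.inr h6.ne'), ?_⟩
      · have : 0 ≤ discU s (coord s z r) * ‖r‖ ^ 4 := by rw [hdU]; positivity
        exact nonneg_of_mul_nonneg_left this hr4
      · intro t ht h10
        have hxt : xi s γ t ^ 2 - uniTau s ^ 2 ≠ 0 := by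
          have := xi_sq_sub_ne h.separated_neg_tau ht; rwa [neg_sq] at this
        have e1 := eq_unif hs hs1 hxt (h.xi_sq_mul_denom ht)
        have e2 := eq_unif hs hs1 hxt (by rw [h10]; exact coord_sq hs hs1 hr hr0)
        exact hz ⟨t, Ioo_subset_Icc_self ht, e1.trans e2.symm⟩
      · rw [hm, max_eq_left ((highMod_le_lowMod_iff hs hne).2 (by positivity)), lowMod_eq hr hre]
    · refine ⟨-r, by rw [neg_sq, hr], ?_, ?_, ?_⟩
      · rw [coord_neg]
        refine h.separated_neg_of_discU_neg h6 h7 ?_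
        have : discU s (coord s z r) * ‖r‖ ^ 4 < 0 := by
          rw [hdU]; exact mul_neg_of_pos_of_neg he2 h9
        by_contra! h10
        nlinarith
      · rw [coord_neg]; exact hsl _ (Or.inr (by rw [Complex.neg_re]; linarith))
      · rw [hm, max_eq_right ((lowMod_le_highMod_iff hs hne).2
          (mul_nonpos_of_nonneg_of_nonpos hcr.le h9.le)), highMod_eq hs hr hre]
        congr 2
        ring_nf

/-- The additive constant in the formula for the potential. -/
def _root_.HexagonMVOP.potConst (s : ℝ) (γ : ℝ → ℂ) : ℝ :=
  potential (arcMeasure s γ) (unif s (-Complex.I)) - Real.log ‖expPot s (-Complex.I)‖ +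
    Real.log (uniK s * s)

theorem potential_eq_of_im_ne_zero (h : CriticalArc s γ) {z : ℂ} (hz : z ∉ arc γ)
    (him : z.im ≠ 0) : 0 < modulus s z ∧
    potential (arcMeasure s γ) z = Real.log (modulus s z) + potConst s γ := by
  have hs := h.s_gt
  have hs1 := h.s_le
  obtain ⟨r, hr, hv, hsl, hm⟩ := h.exists_lift hz him
  have hr0 : r ≠ 0 := by
    intro h0
    exact h.quad_ne_zero_of_notMem hz (by rw [← hr, h0]; simp)
  have hn : ‖coord s z r‖ ≠ 1 := fun h0 => him (norm_coord_eq_one hs hs1 hr hr0 h0)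
  have hreg := h.regular_of_norm_ne_one hn
  have h1 := h.potential_unif hv hn hsl
  have ht0 : coord s z r ^ 2 - uniTau s ^ 2 ≠ 0 := by
    have := hreg 3; simp only [pole, Matrix.cons_val, neg_sq] at this; exact this
  have hF0 := norm_pos_iff.2 (hasDerivAt_expPot hreg).1
  rw [← eq_unif hs hs1 ht0 (coord_sq hs hs1 hr hr0)] at h1
  have h2 := norm_expPot_coord hs hs1 hr hr0 hreg
  rw [← hm] at h2
  have hks : 0 < uniK s * s := mul_pos (uniK_pos hs) (by linarith)
  rw [h2] at hF0
  have hpos := (pos_iff_pos_of_mul_pos hF0).1 hks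
  refine ⟨hpos, ?_⟩
  rw [h2, Real.log_mul hks.ne' hpos.ne'] at h1
  unfold potConst
  linarith

end CriticalArc

/-! ### Continuity of the modulus -/

theorem lowMod_le_modulus (s : ℝ) (z : ℂ) : lowMod s z ≤ modulus s z := by
  unfold modulus
  split_ifs
  · exact le_rfl
  · exact le_max_left _ _

theorem modulus_pos {s : ℝ} (hs : 1 / 3 < s) (z : ℂ) : 0 < modulus s z :=
  (lowMod_pos hs z).trans_le (lowMod_le_modulus s z)

theorem continuous_circ (s : ℝ) : Continuous (circ s) := by
  have := continuous_shift s
  unfold circ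
  exact ((by fun_prop : Continuous fun z => ‖shift s z‖ ^ 2)).sub
    ((Complex.continuous_re.comp this).const_mul _)

theorem shift_sq_sub_quad_ne_of_circ {s : ℝ} (hs : 1 / 3 < s) {z : ℂ} (hz : 0 ≤ circ s z) :
    shift s z ^ 2 - quad s z ≠ 0 := by
  intro h0
  rw [shift_sq_sub_quad] at h0
  have := ctr_pos hs
  have h1 := (mul_eq_zero.1 h0).resolve_left (Complex.ofReal_ne_zero.2 (by positivity))
  have h2 : shift s z = (s : ℂ) := by
    unfold shift ctr
    push_cast at h1 ⊢
    linear_combination h1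
  unfold circ at hz
  rw [h2, Complex.norm_real, Complex.ofReal_re, Real.norm_eq_abs, sq_abs] at hz
  nlinarith

theorem discU_pos_of_im_eq_zero {s : ℝ} (hs : 1 / 3 < s) (hs1 : s ≤ 1) {w : ℂ} (h0 : w ≠ 0)
    (him : w.im = 0) : 0 < discU s w := by
  have hre : w.re ≠ 0 := fun h1 => h0 (Complex.ext h1 him)
  unfold discU
  rw [← Complex.normSq_eq_norm_sq, Complex.normSq_apply, him]
  generalize w.re = x at *
  have e : x ^ 2 * (1 + (x * x + 0 * 0)⁻¹) ^ 2 = 4 + (x - x⁻¹) ^ 2 := by field_simp; ring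
  rw [e]
  have := uniE_le_one hs hs1
  nlinarith [sq_nonneg (x - x⁻¹)]

/-- Makes the two cases in `modulus` agree on their interface. There `ξ²` is real: an imaginary `ξ`
gives `cross = 0`, and a real one gives a positive discriminant. -/
theorem highMod_le_lowMod_of_circ {s : ℝ} (hs : 1 / 3 < s) (hs1 : s ≤ 1) {z : ℂ}
    (hz : circ s z = 0) : highMod s z ≤ lowMod s z := by
  rw [highMod_le_lowMod_iff hs (shift_sq_sub_quad_ne_of_circ hs hz.ge)]
  by_cases hq : quad s z = 0
  · rw [cross_eq_zero_of_quad hq, zero_mul]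
  have hr := root_sq s z
  have hr0 := root_ne_zero hq
  have h2 := coord_sq_im_mul hs hs1 hr hr0
  have h3 := normSq_denom_pos hs hs1 hr hr0
  rw [hz, mul_zero] at h2
  have h4 : (coord s z (root s z)).re * (coord s z (root s z)).im = 0 := by
    have := (mul_eq_zero.1 h2).resolve_right h3.ne'
    linarith
  rcases mul_eq_zero.1 h4 with h5 | h5
  · have h1 := coord_re_mul hs hs1 hr hr0
    rw [h5, zero_mul, ← cross_eq_root] at h1
    rw [(mul_eq_zero.1 h1.symm).resolve_left (uniE_pos hs hs1).ne', zero_mul]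
  · have h6 := discU_pos_of_im_eq_zero hs hs1 (coord_ne_zero hs hs1 hr hr0) h5
    have h7 := discU_coord hs hs1 hr hr0
    have h8 : 0 < ‖root s z‖ ^ 4 := by have := norm_pos_iff.2 hr0; positivity
    have h9 := mul_pos h6 h8
    rw [h7] at h9
    have h10 : 0 < disc s z := (pos_iff_pos_of_mul_pos h9).1 (by
      have := uniE_pos hs hs1; positivity)
    exact mul_nonneg (cross_nonneg s z) h10.le

theorem continuous_modulus {s : ℝ} (hs : 1 / 3 < s) (hs1 : s ≤ 1) : Continuous (modulus s) := by
  unfold modulus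
  refine continuous_if_le (continuous_circ s) continuous_const
    (continuous_lowMod hs).continuousOn ?_ ?_
  · refine (continuous_lowMod hs).continuousOn.sup fun z hz => ?_
    exact (continuousAt_highMod hs (shift_sq_sub_quad_ne_of_circ hs hz)).continuousWithinAt
  · intro z hz
    exact (max_eq_left (highMod_le_lowMod_of_circ hs hs1 hz)).symm

theorem norm_ratio_eq_one {s : ℝ} (hs : 1 / 3 < s) {z : ℂ} (h : lowMod s z = highMod s z) :
    ‖ratio (shift s z) (root s z)‖ = 1 := by
  rw [norm_ratio hs (root_sq s z) (root_re_nonneg s z), ← h, div_self (lowMod_pos hs z).ne']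

namespace CriticalArc

variable {s : ℝ} {γ : ℝ → ℂ}

/-! ### The potential formula off the arc -/

/-- Real points correspond to the unit circle, which carries the poles and was avoided by the
rotation. They are reached by vertical approach, since both sides are continuous off the arc. -/
theorem potential_eq_of_notMem (h : CriticalArc s γ) {z : ℂ} (hz : z ∉ arc γ) :
    potential (arcMeasure s γ) z = Real.log (modulus s z) + potConst s γ := by
  by_cases him : z.im ≠ 0
  · exact (h.potential_eq_of_im_ne_zero hz him).2
  push Not at him
  have := h.isProbabilityMeasure
  set l : ℕ → ℂ := fun n => z + ((1 / ((n : ℝ) + 1) : ℝ) : ℂ) * Complex.I with hl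
  have hlt : Tendsto l atTop (𝓝 z) := by
    have := ((Complex.continuous_ofReal.tendsto 0).comp
      (tendsto_one_div_add_atTop_nhds_zero_nat (𝕜 := ℝ))).mul_const Complex.I |>.const_add z
    rw [Complex.ofReal_zero, zero_mul, add_zero] at this
    exact this
  obtain ⟨Φ, hΦ, hΦ0, hΦe⟩ := exists_analytic_potential h.isCompact_arc h.ae_mem_arc hz
  have h1 : Tendsto (fun n => potential (arcMeasure s γ) (l n)) atTop
      (𝓝 (potential (arcMeasure s γ) z)) := by
    have h2 : Tendsto (fun n => potential (arcMeasure s γ) z + (Φ (l n)).re) atTop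
        (𝓝 (potential (arcMeasure s γ) z + (Φ z).re)) :=
      ((Complex.continuous_re.tendsto _).comp
        (hΦ.self_of_nhds.continuousAt.tendsto.comp hlt)).const_add _
    rw [hΦ0, Complex.zero_re, add_zero] at h2
    exact h2.congr' ((hlt.eventually hΦe).mono fun n hn => hn.symm)
  have h3 : Tendsto (fun n => Real.log (modulus s (l n)) + potConst s γ) atTop
      (𝓝 (Real.log (modulus s z) + potConst s γ)) :=
    ((((continuous_modulus h.s_gt h.s_le).tendsto z).comp hlt).log
      (modulus_pos h.s_gt z).ne').add_const _
  refine tendsto_nhds_unique h1 (h3.congr' ?_)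
  filter_upwards [hlt.eventually (h.isCompact_arc.isClosed.isOpen_compl.mem_nhds hz)] with n hn
  refine (h.potential_eq_of_im_ne_zero hn ?_).2.symm
  simp only [hl, Complex.add_im, him, Complex.im_ofReal_mul, Complex.I_im, mul_one, zero_add]
  positivity

theorem ae_ne (h : CriticalArc s γ) (z : ℂ) : ∀ᵐ x ∂arcMeasure s γ, x ≠ z := by
  unfold arcMeasure
  rw [ae_map_iff (p := fun x => x ≠ z) (h.aemeasurable _)
    (measurableSet_singleton z).compl]
  refine (withDensity_absolutelyContinuous _ _).ae_le ?_
  by_cases hz : ∃ t₀ ∈ Icc (0 : ℝ) 1, γ t₀ = z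
  · obtain ⟨t₀, ht₀, rfl⟩ := hz
    have h1 : ∀ᵐ t : ℝ, t ≠ t₀ := by simp [ae_iff]
    filter_upwards [ae_restrict_mem measurableSet_Ioo, ae_restrict_of_ae h1] with t ht ht1
    exact fun h2 => ht1 (h.inj (Ioo_subset_Icc_self ht) ht₀ h2)
  · filter_upwards [ae_restrict_mem measurableSet_Ioo] with t ht
    exact fun h2 => hz ⟨t, Ioo_subset_Icc_self ht, h2⟩

theorem endpoint_re (h : CriticalArc s γ) {z : ℂ} (hz : quad s z = 0) : z.re < 0 := by
  have h1 := (root_re_im h.s_gt h.s_le hz).1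
  have := ctr_pos h.s_gt
  simp only [shift, Complex.add_re, Complex.ofReal_re] at h1
  linarith

/-- Near an interior point the arc is approached nontangentially along a segment. -/
theorem exists_approach (h : CriticalArc s γ) {t₀ : ℝ} (ht₀ : t₀ ∈ Ioo (0 : ℝ) 1) :
    ∃ (v : ℂ) (K : ℝ), v ≠ 0 ∧ 0 < K ∧ ∀ᶠ ε : ℝ in 𝓝[>] 0, ∀ x ∈ arc γ,
      ‖γ t₀ - x‖ ≤ K * ‖γ t₀ + ε * v - x‖ := by
  have hs := h.s_gt
  set z₀ := γ t₀ with hz₀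
  have hc := h.cross_pos ht₀
  obtain ⟨n0, n1, n4⟩ := h.nondeg ht₀
  set F : ℂ → ℂ := fun z => ratio (shift s z) (root s z) with hF
  have hFd := hasDerivAt_ratio hs (analyticAt_root hc) (Eventually.of_forall (root_sq s)) n0 n1 n4
  have hF1 : ∀ x ∈ arc γ, ‖F x‖ = 1 := by
    rintro x ⟨t, ht, rfl⟩
    exact norm_ratio_eq_one hs (h.moduli_eq ht)
  have hFz := hF1 z₀ ⟨t₀, Ioo_subset_Icc_self ht₀, rfl⟩
  have hF0 : F z₀ ≠ 0 := by rw [← norm_ne_zero_iff, hFz]; norm_num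
  have hq0 : rootQ s z₀ (root s z₀) ≠ 0 := (mul_ne_zero_iff.1 (h.ne_zero t₀ ht₀)).1
  set F' := -2 * rootQ s z₀ (root s z₀) * ratio (shift s z₀) (root s z₀) with hF'
  have hF'0 : F' ≠ 0 := mul_ne_zero (mul_ne_zero (by norm_num) hq0) hF0
  -- With this direction the derivative of `F` along `v` equals `F z₀`, so `‖F‖²` grows at rate 2
  -- from its value 1. As `‖F‖ = 1` on the arc and `F` is Lipschitz near `z₀`, the distance to
  -- nearby arc points is at least proportional to `ε`.
  set v := F z₀ / F' with hv
  have hv0 : v ≠ 0 := div_ne_zero hF0 hF'0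
  have hFa : AnalyticAt ℂ F z₀ := by
    have a1 := analyticAt_shift s z₀
    have a2 := analyticAt_root hc
    have hd : (shift s z₀ - 2 * root s z₀) * (shift s z₀ + root s z₀) ^ 2 ≠ 0 := by
      rw [← root_sq] at n1 n4
      rw [show shift s z₀ ^ 2 - root s z₀ ^ 2 =
        (shift s z₀ + root s z₀) * (shift s z₀ - root s z₀) by ring] at n1
      rw [show shift s z₀ ^ 2 - 4 * root s z₀ ^ 2 =
        (shift s z₀ + 2 * root s z₀) * (shift s z₀ - 2 * root s z₀) by ring] at n4
      exact mul_ne_zero (mul_ne_zero_iff.1 n4).2 (pow_ne_zero 2 (mul_ne_zero_iff.1 n1).1)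
    have a3 : AnalyticAt ℂ (fun z => 2 * root s z) z₀ := analyticAt_const.fun_mul a2
    exact (((a1.fun_add a3).fun_mul ((a1.fun_sub a2).fun_pow 2)).fun_div
      ((a1.fun_sub a3).fun_mul ((a1.fun_add a2).fun_pow 2)) hd)
  obtain ⟨L, U, hU, hLip⟩ := (hFa.contDiffAt (n := 1)).exists_lipschitzOnWith
  obtain ⟨δ, hδ, hball⟩ := Metric.mem_nhds_iff.1 hU
  refine ⟨v, max 2 (3 * L * ‖v‖ + 1), hv0, by positivity, ?_⟩
  have hp : HasDerivAt (fun ε : ℝ => F (z₀ + ε * v)) (F z₀) 0 := by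
    have h1 : HasDerivAt (fun ε : ℝ => z₀ + ε * v) v 0 := by
      have := ((hasDerivAt_id (0 : ℝ)).ofReal_comp.mul_const v).const_add z₀
      exact this.congr_deriv (by simp)
    have h2 := HasDerivAt.comp_of_eq (0 : ℝ) (h₂ := F) hFd h1 (by simp [hz₀])
    refine h2.congr_deriv ?_
    rw [hv]; field_simp
  have hn := hp.norm_sq
  have hsq : ∀ᶠ ε : ℝ in 𝓝[>] 0, 1 + ε ≤ ‖F (z₀ + ε * v)‖ ^ 2 := by
    have h0 : ‖F (z₀ + ((0 : ℝ) : ℂ) * v)‖ ^ 2 = 1 := by simp [hFz]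
    have hd : HasDerivAt (fun ε : ℝ => ‖F (z₀ + ε * v)‖ ^ 2) 2 0 := by
      refine hn.congr_deriv ?_
      rw [Complex.ofReal_zero, zero_mul, add_zero, real_inner_self_eq_norm_sq, hFz]; norm_num
    have hsl := hasDerivAt_iff_tendsto_slope.1 hd
    have hsl2 := hsl.mono_left (nhdsWithin_mono 0 (fun x (hx : 0 < x) => hx.ne'))
    filter_upwards [hsl2.eventually (lt_mem_nhds (show (1 : ℝ) < 2 by norm_num)),
      self_mem_nhdsWithin] with ε h1 h2
    have h2' : 0 < ε := h2
    rw [slope_def_field, h0, sub_zero, lt_div_iff₀ h2', one_mul] at h1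
    linarith
  have hnear : ∀ᶠ ε : ℝ in 𝓝[>] 0, ε * ‖v‖ < δ / 2 ∧ ε ≤ 1 := by
    have : Tendsto (fun ε : ℝ => ε * ‖v‖) (𝓝[>] 0) (𝓝 (0 * ‖v‖)) :=
      (tendsto_id.mul_const ‖v‖).mono_left nhdsWithin_le_nhds
    rw [zero_mul] at this
    refine (this.eventually (gt_mem_nhds (by positivity))).and ?_
    exact nhdsWithin_le_nhds (Iic_mem_nhds (by norm_num))
  have hlt : ∀ᶠ ε : ℝ in 𝓝[>] 0, ‖F (z₀ + ε * v)‖ < 2 := by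
    refine nhdsWithin_le_nhds (hp.continuousAt.norm.eventually (gt_mem_nhds ?_))
    simp [hFz]
  filter_upwards [hsq, hnear, hlt, self_mem_nhdsWithin] with ε h1 h2 hF2 h3 x hx
  have h3' : 0 < ε := h3
  have hvε : ‖(ε : ℂ) * v‖ = ε * ‖v‖ := by
    rw [norm_mul, Complex.norm_real, Real.norm_eq_abs, abs_of_pos h3']
  have htri : ‖z₀ - x‖ ≤ ε * ‖v‖ + ‖z₀ + ε * v - x‖ := by
    rw [← hvε, show z₀ - x = -((ε : ℂ) * v) + (z₀ + ε * v - x) by ring]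
    refine (norm_add_le _ _).trans ?_
    rw [norm_neg]
  have hnn := norm_nonneg (z₀ + ε * v - x)
  rcases lt_or_ge ‖z₀ - x‖ δ with h4 | h4
  · have hxU : x ∈ U := hball (by rwa [Metric.mem_ball, dist_comm, dist_eq_norm])
    have hzU : z₀ + ε * v ∈ U := hball (by
      rw [Metric.mem_ball, dist_eq_norm, add_sub_cancel_left, hvε]; linarith [h2.1])
    have h5 := hLip.dist_le_mul _ hzU _ hxU
    rw [dist_eq_norm, dist_eq_norm] at h5
    have h6 : ‖F (z₀ + ε * v)‖ - 1 ≤ L * ‖z₀ + ε * v - x‖ := by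
      rw [← hF1 x hx]
      exact (norm_sub_norm_le _ _).trans h5
    have h7 : ε ≤ 3 * (L * ‖z₀ + ε * v - x‖) := by
      have h8 := norm_nonneg (F (z₀ + ε * v))
      nlinarith
    have h8 : ‖z₀ - x‖ ≤ (3 * L * ‖v‖ + 1) * ‖z₀ + ε * v - x‖ := by
      nlinarith [mul_le_mul_of_nonneg_right h7 (norm_nonneg v)]
    exact h8.trans (mul_le_mul_of_nonneg_right (le_max_right _ _) hnn)
  · have : ‖z₀ - x‖ ≤ 2 * ‖z₀ + ε * v - x‖ := by linarith [h2.1]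
    exact this.trans (mul_le_mul_of_nonneg_right (le_max_left _ _) hnn)

/-- Interior points of the arc are limits of the transversal segments above, and the endpoints are
limits of interior points. -/
theorem dense_compl_arc (h : CriticalArc s γ) : Dense (arc γ)ᶜ := by
  have hint : ∀ t ∈ Ioo (0 : ℝ) 1, γ t ∈ closure (arc γ)ᶜ := by
    intro t ht
    obtain ⟨v, K, hv, hK, hev⟩ := h.exists_approach ht
    have hlim : Tendsto (fun ε : ℝ => γ t + ε * v) (𝓝[>] 0) (𝓝 (γ t)) := by
      have : Continuous fun ε : ℝ => γ t + ε * v := by fun_prop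
      have h1 := this.tendsto 0
      rw [Complex.ofReal_zero, zero_mul, add_zero] at h1
      exact h1.mono_left nhdsWithin_le_nhds
    refine mem_closure_of_tendsto hlim ?_
    filter_upwards [hev, self_mem_nhdsWithin] with ε h1 h2 h3
    have h2' : (0 : ℝ) < ε := h2
    have h4 := h1 _ h3
    rw [sub_self, norm_zero, mul_zero, norm_le_zero_iff, sub_add_cancel_left, neg_eq_zero] at h4
    simp [hv, h2'.ne'] at h4
  intro z
  by_cases hz : z ∈ arc γ
  · obtain ⟨t, ht, rfl⟩ := hz
    have h1 : γ '' closure (Ioo 0 1) ⊆ closure (γ '' Ioo 0 1) := by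
      rw [← closure_Ioo (zero_ne_one' ℝ)] at *
      refine ContinuousOn.image_closure ?_
      rw [closure_Ioo (zero_ne_one' ℝ)]; exact h.cont
    rw [closure_Ioo (zero_ne_one' ℝ)] at h1
    have h2 : closure (γ '' Ioo 0 1) ⊆ closure (arc γ)ᶜ :=
      closure_minimal (by rintro _ ⟨t, ht, rfl⟩; exact hint t ht) isClosed_closure
    exact h2 (h1 (mem_image_of_mem γ ht))
  · exact subset_closure hz

theorem exists_norm_le_of_tendsto (h : CriticalArc s γ) {z : ℂ} {l : ℕ → ℂ}
    (hl : Tendsto l atTop (𝓝 z)) : ∃ R : ℝ, 0 ≤ R ∧ ∀ n, ∀ x ∈ arc γ, ‖l n - x‖ ≤ R := by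
  obtain ⟨C, hC⟩ := h.isCompact_arc.isBounded.exists_norm_le
  obtain ⟨D, hD⟩ := (Metric.isBounded_range_of_tendsto l hl).exists_norm_le
  have hC0 : 0 ≤ C := (norm_nonneg _).trans (hC (γ 0) ⟨0, by simp, rfl⟩)
  have hD0 : 0 ≤ D := (norm_nonneg _).trans (hD (l 0) ⟨0, rfl⟩)
  refine ⟨D + C, by positivity, fun n x hx => (norm_sub_le _ _).trans (add_le_add ?_ (hC x hx))⟩
  exact hD _ ⟨n, rfl⟩

/-- Integrability of the logarithmic kernel and the lower bound for the potential. -/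
theorem integrable_log_and_le_potential (h : CriticalArc s γ) (z : ℂ) :
    Integrable (fun x => Real.log ‖z - x‖) (arcMeasure s γ) ∧
      Real.log (modulus s z) + potConst s γ ≤ potential (arcMeasure s γ) z := by
  have := h.isProbabilityMeasure
  obtain ⟨l, hlm, hl⟩ := mem_closure_iff_seq_limit.1 (h.dense_compl_arc z)
  obtain ⟨R, hR0, hR⟩ := h.exists_norm_le_of_tendsto hl
  have hRz : ∀ x ∈ arc γ, ‖z - x‖ ≤ R := fun x hx =>
    le_of_tendsto ((hl.sub_const x).norm) (Eventually.of_forall fun n => hR n x hx)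
  have hlog : ∀ w x : ℂ, ‖w - x‖ ≤ R → 0 ≤ R - Real.log ‖w - x‖ := fun w x hwx => by
    have := Real.log_le_self (norm_nonneg (w - x)); linarith
  have hmeas : ∀ w : ℂ, Measurable fun x : ℂ => R - Real.log ‖w - x‖ := fun w =>
    (Real.measurable_log.comp (by fun_prop)).const_sub R
  have hae := h.ae_mem_arc
  have hint : ∀ n, Integrable (fun x => R - Real.log ‖l n - x‖) (arcMeasure s γ) := fun n =>
    (integrable_const R).sub (integrable_log_norm_sub h.isCompact_arc h.ae_mem_arc (hlm n))
  have hval : ∀ n, ∫⁻ x, ENNReal.ofReal (R - Real.log ‖l n - x‖) ∂arcMeasure s γ =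
      ENNReal.ofReal (R - (Real.log (modulus s (l n)) + potConst s γ)) := by
    intro n
    rw [← ofReal_integral_eq_lintegral_ofReal (hint n)
      (hae.mono fun x hx => hlog _ _ (hR n x hx)), ← h.potential_eq_of_notMem (hlm n),
      integral_sub (integrable_const R)
        (integrable_log_norm_sub h.isCompact_arc h.ae_mem_arc (hlm n)), potential]
    simp
  have hlimreal : Tendsto (fun n => R - (Real.log (modulus s (l n)) + potConst s γ)) atTop
      (𝓝 (R - (Real.log (modulus s z) + potConst s γ))) :=
    (((((continuous_modulus h.s_gt h.s_le).tendsto z).comp hl).log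
      (modulus_pos h.s_gt z).ne').add_const _).const_sub _
  have hlimval := ENNReal.tendsto_ofReal hlimreal
  have hX : 0 ≤ R - (Real.log (modulus s z) + potConst s γ) := by
    refine ge_of_tendsto' hlimreal fun n => ?_
    have h1 : 0 ≤ ∫ x, R - Real.log ‖l n - x‖ ∂arcMeasure s γ :=
      integral_nonneg_of_ae (hae.mono fun x hx => hlog _ _ (hR n x hx))
    rw [integral_sub (integrable_const R)
      (integrable_log_norm_sub h.isCompact_arc h.ae_mem_arc (hlm n))] at h1
    rw [← h.potential_eq_of_notMem (hlm n), potential]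
    simpa using h1
  -- Fatou for the nonnegative functions `R - log ‖l n - x‖`, whose integrals are known off the arc.
  -- One inequality gives both integrability at `z` and the lower bound for the potential.
  have hfatou : ∫⁻ x, ENNReal.ofReal (R - Real.log ‖z - x‖) ∂arcMeasure s γ ≤
      ENNReal.ofReal (R - (Real.log (modulus s z) + potConst s γ)) := by
    rw [← hlimval.liminf_eq]
    have h1 := lintegral_liminf_le (μ := arcMeasure s γ) (u := atTop)
      (f := fun (n : ℕ) x => ENNReal.ofReal (R - Real.log ‖l n - x‖))
      (fun n => (hmeas (l n)).ennreal_ofReal)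
    simp only [hval] at h1
    refine le_trans (le_of_eq (lintegral_congr_ae ?_)) h1
    filter_upwards [h.ae_ne z] with x hx
    refine (Tendsto.liminf_eq ?_).symm
    refine ENNReal.tendsto_ofReal (Tendsto.const_sub _ (((hl.sub_const x).norm).log ?_))
    exact norm_ne_zero_iff.2 (sub_ne_zero.2 hx.symm)
  have hnn : 0 ≤ᵐ[arcMeasure s γ] fun x => R - Real.log ‖z - x‖ :=
    hae.mono fun x hx => hlog _ _ (hRz x hx)
  have hI : Integrable (fun x => R - Real.log ‖z - x‖) (arcMeasure s γ) :=
    (lintegral_ofReal_ne_top_iff_integrable (hmeas z).aestronglyMeasurable hnn).1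
      (hfatou.trans_lt ENNReal.ofReal_lt_top).ne
  have hI2 : Integrable (fun x => Real.log ‖z - x‖) (arcMeasure s γ) := by
    refine ((integrable_const R).sub hI).congr (Eventually.of_forall fun x => ?_)
    simp
  refine ⟨hI2, ?_⟩
  rw [← ofReal_integral_eq_lintegral_ofReal hI hnn] at hfatou
  have hv : ∫ x, R - Real.log ‖z - x‖ ∂arcMeasure s γ = R - potential (arcMeasure s γ) z := by
    rw [integral_sub (integrable_const R) hI2, potential]; simp
  rw [hv, ENNReal.ofReal_le_ofReal_iff hX] at hfatou
  linarith

/-- The potential formula away from the endpoints of the arc. -/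
theorem potential_eq (h : CriticalArc s γ) {z : ℂ} (hz : quad s z ≠ 0) :
    potential (arcMeasure s γ) z = Real.log (modulus s z) + potConst s γ := by
  have := h.isProbabilityMeasure
  by_cases hza : z ∈ arc γ
  swap
  · exact h.potential_eq_of_notMem hza
  obtain ⟨t, ht, rfl⟩ := hza
  have ht' : t ∈ Ioo (0 : ℝ) 1 := by
    refine ⟨lt_of_le_of_ne ht.1 ?_, lt_of_le_of_ne ht.2 ?_⟩
    · rintro rfl; exact hz h.source
    · rintro rfl; exact hz h.target
  obtain ⟨v, K, hv, hK, hev⟩ := h.exists_approach ht'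
  set e : ℕ → ℝ := fun n => 1 / ((n : ℝ) + 1) with he
  have hepos : ∀ n, 0 < e n := fun n => by simp only [he]; positivity
  have hetend : Tendsto e atTop (𝓝[>] 0) :=
    tendsto_nhdsWithin_iff.2 ⟨tendsto_one_div_add_atTop_nhds_zero_nat, Eventually.of_forall hepos⟩
  set l : ℕ → ℂ := fun n => γ t + e n * v with hl
  have hlt : Tendsto l atTop (𝓝 (γ t)) := by
    have hc : Continuous fun ε : ℝ => γ t + ε * v := by fun_prop
    have h1 := hc.tendsto 0
    rw [Complex.ofReal_zero, zero_mul, add_zero] at h1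
    exact h1.comp (hetend.mono_right nhdsWithin_le_nhds)
  obtain ⟨R, hR0, hR⟩ := h.exists_norm_le_of_tendsto hlt
  have hevl : ∀ᶠ n in atTop, ∀ x ∈ arc γ, ‖γ t - x‖ ≤ K * ‖l n - x‖ := hetend.eventually hev
  have hlim : Tendsto (fun n => potential (arcMeasure s γ) (l n)) atTop
      (𝓝 (potential (arcMeasure s γ) (γ t))) := by
    unfold potential
    -- The nontangential estimate bounds `log ‖l n - x‖` from below by `log ‖γ t - x‖ - log K`, and
    -- `R` bounds it from above; the kernel at `γ t` is already known to be integrable.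
    refine tendsto_integral_filter_of_dominated_convergence
      (fun x => R + |Real.log ‖γ t - x‖| + |Real.log K|) ?_ ?_ ?_ ?_
    · exact Eventually.of_forall fun n =>
        (Real.measurable_log.comp (by fun_prop)).aestronglyMeasurable
    · filter_upwards [hevl] with n hn
      filter_upwards [h.ae_mem_arc, h.ae_ne (γ t)] with x hx hxne
      have h1 := hn x hx
      have h2 : 0 < ‖γ t - x‖ := norm_pos_iff.2 (sub_ne_zero.2 hxne.symm)
      have h3 : 0 < ‖l n - x‖ := by
        by_contra! h4
        have h5 : ‖l n - x‖ = 0 := le_antisymm h4 (norm_nonneg _)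
        rw [h5, mul_zero] at h1; linarith
      have h4 := Real.log_le_log h2 h1
      rw [Real.log_mul hK.ne' h3.ne'] at h4
      have h5 := (Real.log_le_self (norm_nonneg (l n - x))).trans (hR n x hx)
      rw [Real.norm_eq_abs, abs_le]
      have := neg_abs_le (Real.log ‖γ t - x‖)
      have := abs_nonneg (Real.log ‖γ t - x‖)
      have := abs_nonneg (Real.log K)
      have := le_abs_self (Real.log K)
      constructor <;> linarith
    · exact ((integrable_const R).add (h.integrable_log_and_le_potential (γ t)).1.abs).add
        (integrable_const _)
    · filter_upwards [h.ae_ne (γ t)] with x hx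
      exact ((hlt.sub_const x).norm).log (norm_ne_zero_iff.2 (sub_ne_zero.2 hx.symm))
  have h3 : Tendsto (fun n => Real.log (modulus s (l n)) + potConst s γ) atTop
      (𝓝 (Real.log (modulus s (γ t)) + potConst s γ)) :=
    ((((continuous_modulus h.s_gt h.s_le).tendsto _).comp hlt).log
      (modulus_pos h.s_gt _).ne').add_const _
  refine tendsto_nhds_unique hlim (h3.congr' ?_)
  filter_upwards [hevl] with n hn
  refine (h.potential_eq_of_notMem fun hmem => ?_).symm
  have h4 := hn _ hmem
  rw [sub_self, norm_zero, mul_zero, norm_le_zero_iff] at h4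
  simp only [hl, sub_add_cancel_left, neg_eq_zero] at h4
  simp [hv, (hepos n).ne'] at h4

end CriticalArc

/-! ### The discriminant on the imaginary axis -/

theorem highMod_conj (s : ℝ) (z : ℂ) : highMod s (conj z) = highMod s z := by
  unfold highMod
  have e1 (b : ℝ) : conj z ^ 2 - (b : ℂ) ^ 2 = conj (z ^ 2 - (b : ℂ) ^ 2) := by
    rw [map_sub, map_pow, map_pow, Complex.conj_ofReal]
  have e2 (b : ℝ) : conj z + (b : ℂ) = conj (z + b) := by
    rw [map_add, Complex.conj_ofReal]
  rw [lowMod_conj, e1, e2, RCLike.norm_conj, RCLike.norm_conj]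

theorem disc_conj (s : ℝ) (z : ℂ) : disc s (conj z) = disc s z := by
  unfold disc
  rw [cross_conj, shift_conj, quad_conj, RCLike.norm_conj, RCLike.norm_conj]

theorem modulus_conj (s : ℝ) (z : ℂ) : modulus s (conj z) = modulus s z := by
  unfold modulus circ
  rw [lowMod_conj, highMod_conj, shift_conj, RCLike.norm_conj, Complex.conj_re]

theorem disc_eq (s : ℝ) (z : ℂ) : disc s z =
    2 * (shift s z ^ 2 * conj (quad s z)).re - ‖shift s z‖ ^ 2 * ‖quad s z‖ -
      3 * ‖quad s z‖ ^ 2 := by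
  unfold disc
  rw [cross_sq]; ring

/-- The linear comparison term of the discriminant on the imaginary axis. -/
def axisL (g Y : ℝ) : ℝ := 2 * g - 3 * g ^ 2 + (4 * g - 3 / 4) * Y - Y ^ 2

/-- Scaling by `E` leaves one parameter: on the axis `A = E(1 + iη)` and `S = E²(g - η² + iη/2)`. -/
theorem disc_imag_axis {s : ℝ} (η : ℝ) {g : ℝ}
    (hg : s = 2 / 3 * ctr s * (g + 1 / 2)) :
    ‖quad s ((ctr s * η : ℝ) * Complex.I)‖ ^ 2 =
      ctr s ^ 4 * ((g - η ^ 2) ^ 2 + η ^ 2 / 4) ∧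
    disc s ((ctr s * η : ℝ) * Complex.I) = ctr s ^ 4 * axisL g (η ^ 2) -
      ctr s ^ 2 * (1 + η ^ 2) * ‖quad s ((ctr s * η : ℝ) * Complex.I)‖ := by
  have hA : shift s ((ctr s * η : ℝ) * Complex.I) = (ctr s : ℂ) + ((ctr s * η : ℝ) : ℂ) * Complex.I :=
    by unfold shift; ring
  have hq : quad s ((ctr s * η : ℝ) * Complex.I) =
      ((ctr s ^ 2 * (g - η ^ 2) : ℝ) : ℂ) + ((ctr s ^ 2 * η / 2 : ℝ) : ℂ) * Complex.I := by
    unfold quad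
    rw [hA]
    have : 3 / 2 * ctr s * s = ctr s ^ 2 * (g + 1 / 2) := by
      linear_combination 3 / 2 * ctr s * hg
    rw [this]
    push_cast
    linear_combination ((ctr s : ℂ) * η) ^ 2 * Complex.I_sq
  have hqn : ‖quad s ((ctr s * η : ℝ) * Complex.I)‖ ^ 2 =
      ctr s ^ 4 * ((g - η ^ 2) ^ 2 + η ^ 2 / 4) := by
    rw [hq, ← Complex.normSq_eq_norm_sq, Complex.normSq_add_mul_I]; ring
  refine ⟨hqn, ?_⟩
  have hAn : ‖shift s ((ctr s * η : ℝ) * Complex.I)‖ ^ 2 = ctr s ^ 2 * (1 + η ^ 2) := by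
    rw [hA, ← Complex.normSq_eq_norm_sq, Complex.normSq_add_mul_I]; ring
  rw [disc_eq, hAn, hqn]
  have hre : (shift s ((ctr s * η : ℝ) * Complex.I) ^ 2 *
      conj (quad s ((ctr s * η : ℝ) * Complex.I))).re =
      ctr s ^ 4 * ((1 - η ^ 2) * (g - η ^ 2) + η ^ 2) := by
    rw [hA, hq, pow_two]
    simp only [Complex.mul_re, Complex.mul_im, Complex.add_re, Complex.add_im, Complex.conj_re,
      Complex.conj_im, Complex.ofReal_re, Complex.ofReal_im, Complex.I_re, Complex.I_im]
    ring
  rw [hre]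
  unfold axisL
  ring

/-- The squared comparison term of the discriminant on the imaginary axis. -/
def axisD (g Y : ℝ) : ℝ := axisL g Y ^ 2 - ((g - Y) ^ 2 + Y / 4) * (1 + Y) ^ 2

/-- For each polynomial `f`, the quotient `f(Y)/Y` decreases: the constant coefficient is
nonnegative and all coefficients of degree at least 2 are nonpositive when `0 < g ≤ 1/4`. Thus `Y'
f(Y) - Y f(Y')` is `Y' - Y` times a nonnegative expression. -/
theorem axis_nonneg_of_le {g Y Y' : ℝ} (hg0 : 0 < g) (hg1 : g ≤ 1 / 4) (hY : 0 ≤ Y)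
    (hη : Y ≤ Y') (h0 : 0 < Y') (hL' : 0 ≤ axisL g Y') (hD' : 0 ≤ axisD g Y') :
    0 ≤ axisL g Y ∧ 0 ≤ axisD g Y := by
  have hgg := mul_nonneg hg0.le (sub_nonneg.2 hg1)
  have h2 := mul_nonneg hY h0.le
  constructor
  · have hL : 0 ≤ Y' * axisL g Y := by
      have e : Y' * axisL g Y = Y * axisL g Y' + (Y' - Y) * (Y * Y' + (2 * g - 3 * g ^ 2)) := by
        unfold axisL; ring
      rw [e]
      have h1 : 0 ≤ 2 * g - 3 * g ^ 2 := by linarith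
      exact add_nonneg (mul_nonneg hY hL') (mul_nonneg (sub_nonneg.2 hη) (add_nonneg h2 h1))
    exact nonneg_of_mul_nonneg_right hL h0
  · have hDD : 0 ≤ Y' * axisD g Y := by
      have e : Y' * axisD g Y = Y * axisD g Y' + (Y' - Y) * ((3 / 4 + 6 * g) *
          (Y * Y' * (Y + Y')) + (15 / 16 + 6 * g - 21 * g ^ 2) * (Y * Y') +
          g ^ 2 * ((1 - 3 * g) * (3 - 3 * g))) := by
        unfold axisD axisL; ring
      rw [e]
      have h5 : 0 ≤ 15 / 16 + 6 * g - 21 * g ^ 2 := by linarith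
      have h6 : 0 ≤ g ^ 2 * ((1 - 3 * g) * (3 - 3 * g)) :=
        mul_nonneg (sq_nonneg g) (mul_nonneg (by linarith) (by linarith))
      have h7 : 0 ≤ (3 / 4 + 6 * g) * (Y * Y' * (Y + Y')) := by positivity
      exact add_nonneg (mul_nonneg hY hD') (mul_nonneg (sub_nonneg.2 hη)
        (add_nonneg (add_nonneg h7 (mul_nonneg h5 h2)) h6))
    exact nonneg_of_mul_nonneg_right hDD h0

/-- On the imaginary axis the discriminant stays negative away from the origin. -/
theorem disc_neg_of_le {s : ℝ} (hs : 1 / 3 < s) (hs1 : s ≤ 1) {η η' : ℝ} (hη : η ^ 2 ≤ η' ^ 2)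
    (h : disc s ((ctr s * η : ℝ) * Complex.I) < 0) :
    disc s ((ctr s * η' : ℝ) * Complex.I) < 0 := by
  have hE := ctr_pos hs
  set g := 3 / 2 * s / ctr s - 1 / 2 with hgd
  have hg : s = 2 / 3 * ctr s * (g + 1 / 2) := by rw [hgd]; field_simp; ring
  have hg0 : 0 < g := by
    rw [hgd, sub_pos, lt_div_iff₀ hE]; have := three_mul_ctr_lt hs hs1; linarith
  have hg1 : g ≤ 1 / 4 := by
    rw [hgd, tsub_le_iff_right, div_le_iff₀ hE]; have := two_mul_le_ctr s; linarith
  obtain ⟨m1, d1⟩ := disc_imag_axis η hg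
  obtain ⟨m2, d2⟩ := disc_imag_axis η' hg
  have n1 := norm_nonneg (quad s ((ctr s * η : ℝ) * Complex.I))
  have n2 := norm_nonneg (quad s ((ctr s * η' : ℝ) * Complex.I))
  by_contra! hcon
  rw [d1] at h
  rw [d2] at hcon
  generalize ‖quad s ((ctr s * η : ℝ) * Complex.I)‖ = q at *
  generalize ‖quad s ((ctr s * η' : ℝ) * Complex.I)‖ = q' at *
  have hY : 0 ≤ η ^ 2 := sq_nonneg η
  generalize η ^ 2 = Y at *
  generalize η' ^ 2 = Y' at *
  generalize ctr s = E at *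
  have hE2 : 0 < E ^ 2 := by positivity
  have hc : (1 + Y') * q' ≤ E ^ 2 * axisL g Y' := by
    have : 0 ≤ E ^ 2 * (E ^ 2 * axisL g Y' - (1 + Y') * q') := by linarith
    have := nonneg_of_mul_nonneg_right this hE2
    linarith
  have hc1 : E ^ 2 * axisL g Y < (1 + Y) * q := by
    have : E ^ 2 * (E ^ 2 * axisL g Y - (1 + Y) * q) < 0 := by linarith
    by_contra! h0
    nlinarith
  have hq'0 : 0 ≤ (1 + Y') * q' := mul_nonneg (by linarith) n2
  have hL' : 0 ≤ axisL g Y' := nonneg_of_mul_nonneg_right (hq'0.trans hc) hE2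
  have hD' : 0 ≤ axisD g Y' := by
    have h1 := pow_le_pow_left₀ hq'0 hc 2
    have h2 : 0 ≤ E ^ 4 * axisD g Y' := by
      unfold axisD
      have e : E ^ 4 * (axisL g Y' ^ 2 - ((g - Y') ^ 2 + Y' / 4) * (1 + Y') ^ 2) =
        (E ^ 2 * axisL g Y') ^ 2 - ((1 + Y') * q') ^ 2 := by
        rw [mul_pow (1 + Y'), m2]; ring
      rw [e]; linarith
    exact nonneg_of_mul_nonneg_right h2 (by positivity)
  rcases (hY.trans hη).eq_or_lt with h0 | h0
  · have hY0 : Y = 0 := le_antisymm (by rw [h0]; exact hη) hY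
    have hYY : Y = Y' := by rw [hY0, h0]
    subst hYY
    have hqq : q = q' := by
      have : q ^ 2 = q' ^ 2 := by rw [m1, m2]
      exact (pow_left_inj₀ n1 n2 two_ne_zero).1 this
    rw [hqq] at hc1
    linarith
  -- With the norm of `S` isolated, `disc ≥ 0` is equivalent to `axisL ≥ 0` together with the
  -- squared condition `axisD ≥ 0`; both pass from `Y'` down to `Y`.
  · obtain ⟨hL2, hD2⟩ := axis_nonneg_of_le hg0 hg1 hY hη h0 hL' hD'
    have h1 : ((1 + Y) * q) ^ 2 ≤ (E ^ 2 * axisL g Y) ^ 2 := by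
      have e : (E ^ 2 * axisL g Y) ^ 2 - ((1 + Y) * q) ^ 2 = E ^ 4 * axisD g Y := by
        unfold axisD
        rw [mul_pow (1 + Y), m1]; ring
      have := mul_nonneg (show 0 ≤ E ^ 4 by positivity) hD2
      linarith
    have h2 := (pow_le_pow_iff_left₀ (mul_nonneg (by linarith) n1)
      (mul_nonneg hE2.le hL2) two_ne_zero).1 h1
    linarith

/-! ### The reflected arc and the symmetrized domain -/

theorem shift_sq_sub_quad_ne_of_re {s : ℝ} (hs : 1 / 3 < s) {z : ℂ} (hz : 0 ≤ z.re) :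
    shift s z ^ 2 - quad s z ≠ 0 := by
  rw [shift_sq_sub_quad]
  have := ctr_pos hs
  refine mul_ne_zero (Complex.ofReal_ne_zero.2 (by positivity)) fun h0 => ?_
  have h1 := congrArg Complex.re h0
  rw [Complex.add_re, Complex.ofReal_re, Complex.zero_re] at h1
  nlinarith

/-- The quotient of the moduli has holomorphic supports in the right half-plane. -/
theorem hasHolSupport_mod_div {s : ℝ} (hs : 1 / 3 < s) (hs1 : s ≤ 1) {z : ℂ} (hz : 0 < z.re) :
    HasHolSupport (fun z => highMod s z / lowMod s z) z := by
  have hcp : ∀ w : ℂ, 0 < w.re → 0 < cross s w := fun w hw => cross_pos_of_re_nonneg hs hs1 hw.le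
  have hval : ∀ w : ℂ, ‖ratio (shift s w) (-root s w)‖ = highMod s w / lowMod s w := by
    intro w
    rw [ratio_neg, norm_inv, norm_ratio hs (root_sq s w) (root_re_nonneg s w), inv_div]
  have a1 := analyticAt_shift s z
  have a2 := analyticAt_root (hcp z hz)
  have a4 : AnalyticAt ℂ (fun z => -root s z) z := a2.fun_neg
  have a3 : AnalyticAt ℂ (fun z => 2 * -root s z) z := analyticAt_const.fun_mul a4
  have n1 := shift_sq_sub_quad_ne_of_re hs hz.le
  rw [← root_sq, show shift s z ^ 2 - root s z ^ 2 =
    (shift s z + root s z) * (shift s z - root s z) by ring] at n1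
  have n2 := add_root_ne_zero hs (root_sq s z) (root_re_nonneg s z) (t := 2) (by norm_num)
  have hd : (shift s z - 2 * -root s z) * (shift s z + -root s z) ^ 2 ≠ 0 := by
    refine mul_ne_zero ?_ (pow_ne_zero 2 ?_)
    · rw [mul_neg, sub_neg_eq_add]; exact_mod_cast n2
    · rw [← sub_eq_add_neg]; exact (mul_ne_zero_iff.1 n1).2
  refine ⟨fun w => ratio (shift s w) (-root s w), ?_, hval z,
    Eventually.of_forall fun w => (hval w).le⟩
  exact ((a1.fun_add a3).fun_mul ((a1.fun_sub a4).fun_pow 2)).fun_div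
      ((a1.fun_sub a3).fun_mul ((a1.fun_add a4).fun_pow 2)) hd

theorem mem_connectedComponentIn_of_mem_closure {X : Type*} [TopologicalSpace X] {F : Set X}
    {x y : X} (hx : x ∈ F) (hy : y ∈ F) (h : y ∈ closure (connectedComponentIn F x)) :
    y ∈ connectedComponentIn F x := by
  have h1 : IsPreconnected (insert y (connectedComponentIn F x)) :=
    isPreconnected_connectedComponentIn.subset_closure (subset_insert _ _)
      (insert_subset h subset_closure)
  exact h1.subset_connectedComponentIn (mem_insert_of_mem _ (mem_connectedComponentIn hx))
    (insert_subset hy (connectedComponentIn_subset F x)) (mem_insert _ _)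

namespace CriticalArc

variable {s : ℝ} {γ : ℝ → ℂ}

theorem disc_eq_zero_of_mem (h : CriticalArc s γ) {z : ℂ} (hz : z ∈ arc γ) (hre : 0 ≤ z.re) :
    disc s z = 0 := by
  obtain ⟨t, ht, rfl⟩ := hz
  refine h.disc_eq_zero ⟨lt_of_le_of_ne ht.1 ?_, lt_of_le_of_ne ht.2 ?_⟩
  · rintro rfl; have := h.endpoint_re h.source; linarith
  · rintro rfl; have := h.endpoint_re h.target; linarith

/-- The boundary curve of the symmetrized domain. -/
def _root_.HexagonMVOP.symCurve (S : Set ℂ) : Set ℂ :=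
  {z | z ∈ S ∧ 0 ≤ z.re} ∪ {z | -z ∈ S ∧ z.re ≤ 0}

theorem _root_.HexagonMVOP.neg_mem_symCurve {S : Set ℂ} {z : ℂ} :
    -z ∈ symCurve S ↔ z ∈ symCurve S := by
  simp only [symCurve, mem_union, mem_ofPred_eq, neg_neg, Complex.neg_re, Left.nonneg_neg_iff,
    Left.neg_nonpos_iff]
  tauto

theorem isClosed_symCurve (h : CriticalArc s γ) : IsClosed (symCurve (arc γ)) := by
  have hc := h.isCompact_arc.isClosed
  refine IsClosed.union (hc.inter (isClosed_le continuous_const Complex.continuous_re))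
    ((hc.preimage continuous_neg).inter (isClosed_le Complex.continuous_re continuous_const))

theorem notMem_symCurve (h : CriticalArc s γ) {z : ℂ} (hz : 0 ≤ z.re) (hd : disc s z ≠ 0) :
    z ∉ symCurve (arc γ) := by
  rintro (⟨h1, -⟩ | ⟨h1, h2⟩)
  · exact hd (h.disc_eq_zero_of_mem h1 hz)
  · have h3 : z.re = 0 := le_antisymm h2 hz
    have h4 := h.disc_eq_zero_of_mem h1 (by rw [Complex.neg_re, h3, neg_zero])
    rw [neg_eq_conj h3, disc_conj] at h4
    exact hd h4

/-- A component of the complement of the curve meeting the imaginary axis where the discriminant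
is negative is unbounded. -/
theorem not_isBounded_component (h : CriticalArc s γ) {z w : ℂ} (hw : w.re = 0)
    (hd : disc s w < 0) (hmem : w ∈ connectedComponentIn (symCurve (arc γ))ᶜ z) :
    ¬ Bornology.IsBounded (connectedComponentIn (symCurve (arc γ))ᶜ z) := by
  intro hb
  have hE := ctr_pos h.s_gt
  rw [connectedComponentIn_eq hmem] at hb
  set η := w.im / ctr s with hη
  have hwη : w = ((ctr s * η : ℝ) : ℂ) * Complex.I := by
    have : ctr s * η = w.im := by rw [hη]; field_simp
    rw [this]
    exact Complex.ext (by simp [hw]) (by simp)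
  set f : ℝ → ℂ := fun t => ((ctr s * (η * t) : ℝ) : ℂ) * Complex.I with hf
  set f2 : ℝ → ℂ := fun t => ((ctr s * t : ℝ) : ℂ) * Complex.I with hf2
  have hneg : ∀ t : ℝ, η ^ 2 ≤ t ^ 2 → f2 t ∈ (symCurve (arc γ))ᶜ := by
    intro t ht
    refine h.notMem_symCurve (by simp [hf2]) (disc_neg_of_le h.s_gt h.s_le ht ?_).ne
    rw [← hwη]; exact hd
  have hcont : Continuous f2 := by simp only [hf2]; fun_prop
  -- The ray along the axis from `w` away from the origin keeps `disc < 0`, hence misses the curve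
  -- and stays in the component.
  have key : ∀ T : Set ℝ, IsPreconnected T → η ∈ T → (∀ t ∈ T, η ^ 2 ≤ t ^ 2) →
      f2 '' T ⊆ connectedComponentIn (symCurve (arc γ))ᶜ w := by
    intro T hT h1 h2
    refine (hT.image f2 hcont.continuousOn).subset_connectedComponentIn ⟨η, h1, hwη.symm⟩ ?_
    rintro _ ⟨t, ht, rfl⟩
    exact hneg t (h2 t ht)
  obtain ⟨C, hC⟩ := hb.exists_norm_le
  have hnorm : ∀ t : ℝ, ‖f2 t‖ = ctr s * |t| := by
    intro t
    simp only [hf2]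
    rw [norm_mul, Complex.norm_I, mul_one, Complex.norm_real, Real.norm_eq_abs, abs_mul,
      abs_of_pos hE]
  rcases le_total 0 η with h0 | h0
  · have h1 := key (Ici η) isPreconnected_Ici self_mem_Ici fun t ht => pow_le_pow_left₀ h0 ht 2
    have h2 := hC _ (h1 ⟨max η ((|C| + 1) / ctr s), mem_Ici.2 (le_max_left _ _), rfl⟩)
    rw [hnorm] at h2
    have h3 : (|C| + 1) / ctr s ≤ |max η ((|C| + 1) / ctr s)| :=
      (le_max_right _ _).trans (le_abs_self _)
    rw [div_le_iff₀ hE] at h3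
    have := le_abs_self C
    linarith
  · have h1 := key (Iic η) isPreconnected_Iic self_mem_Iic fun t ht => by
      have : t ≤ η := ht
      nlinarith
    have h2 := hC _ (h1 ⟨min η (-((|C| + 1) / ctr s)), mem_Iic.2 (min_le_left _ _), rfl⟩)
    rw [hnorm] at h2
    have h3 : (|C| + 1) / ctr s ≤ |min η (-((|C| + 1) / ctr s))| := by
      rw [le_abs]; right
      have := min_le_right η (-((|C| + 1) / ctr s))
      linarith
    rw [div_le_iff₀ hE] at h3
    have := le_abs_self C
    linarith

theorem isBounded_component_neg {S : Set ℂ} {z : ℂ} (hz : z ∈ (symCurve S)ᶜ)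
    (h : Bornology.IsBounded (connectedComponentIn (symCurve S)ᶜ (-z))) :
    Bornology.IsBounded (connectedComponentIn (symCurve S)ᶜ z) := by
  refine h.neg.subset fun w hw => ?_
  rw [Set.mem_neg]
  have himg : IsPreconnected (Neg.neg '' connectedComponentIn (symCurve S)ᶜ z) :=
    isPreconnected_connectedComponentIn.image _ continuous_neg.continuousOn
  refine himg.subset_connectedComponentIn ⟨z, mem_connectedComponentIn hz, rfl⟩ ?_ ⟨w, hw, rfl⟩
  rintro _ ⟨y, hy, rfl⟩
  intro h1
  exact connectedComponentIn_subset _ _ hy (neg_mem_symCurve.1 h1)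

/-- The reflected arc avoids the part of the right half-plane with negative discriminant. -/
theorem neg_notMem_arc (h : CriticalArc s γ)
    (hΩ : ∀ z ∈ arc γ, z.re < 0 → z ∈ OmegaZero (arc γ)) {z : ℂ} (hz : 0 < z.re)
    (hd : disc s z < 0) : -z ∉ arc γ := by
  intro hmem
  have hs := h.s_gt
  have hs1 := h.s_le
  obtain ⟨h1, h2⟩ := hΩ _ hmem (by rw [Complex.neg_re]; linarith)
  change -z ∈ (symCurve (arc γ))ᶜ at h1
  change Bornology.IsBounded (connectedComponentIn (symCurve (arc γ))ᶜ (-z)) at h2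
  have hzC : z ∈ (symCurve (arc γ))ᶜ := fun h3 => h1 (neg_mem_symCurve.2 h3)
  have hb := isBounded_component_neg hzC h2
  set K := connectedComponentIn (symCurve (arc γ))ᶜ z with hK
  have hKo : IsOpen K := h.isClosed_symCurve.isOpen_compl.connectedComponentIn
  set u : ℂ → ℝ := fun z => highMod s z / lowMod s z with hu
  have huc : ContinuousOn u {w | 0 ≤ w.re} := fun w hw =>
    ((continuousAt_highMod hs (shift_sq_sub_quad_ne_of_re hs hw)).div
      (continuous_lowMod hs).continuousAt (lowMod_pos hs w).ne').continuousWithinAt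
  have hdisc : ∀ w : ℂ, 0 ≤ w.re → 1 < u w → disc s w < 0 := by
    intro w hw h3
    by_contra! h4
    have h5 := (highMod_le_lowMod_iff hs (shift_sq_sub_quad_ne_of_re hs hw)).2
      (mul_nonneg (cross_nonneg s w) h4)
    rw [lt_div_iff₀ (lowMod_pos hs w)] at h3
    linarith
  have hU : IsOpen ({w : ℂ | 0 < w.re} ∩ K) := isOpen_rightHalf.inter hKo
  -- The maximum principle on the right half of the bounded component gives `u ≤ 1`, whereas `disc z
  -- < 0` means `u z > 1`.
  have hle := le_one_of_hasHolSupport hU (u := u)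
    (huc.mono fun w hw => (show 0 < w.re from hw.1).le)
    (fun w hw _ => hasHolSupport_mod_div hs hs1 hw.1) (fun c hc => ?_)
    (z := z) ⟨hz, mem_connectedComponentIn hzC⟩
  · have h3 : 0 < cross s z := cross_pos_of_re_nonneg hs hs1 hz.le
    have h4 : ¬ highMod s z ≤ lowMod s z := fun h5 => by
      have := (highMod_le_lowMod_iff hs (shift_sq_sub_quad_ne_of_re hs hz.le)).1 h5
      nlinarith [mul_pos h3 (neg_pos.2 hd)]
    rw [div_le_one (lowMod_pos hs z)] at hle
    exact h4 hle
  · have hcl : IsClosed ({w : ℂ | 0 ≤ w.re} ∩ u ⁻¹' Ici c) :=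
      huc.preimage_isClosed_of_isClosed (isClosed_le continuous_const Complex.continuous_re)
        isClosed_Ici
    -- A point of the closure with `u ≥ c > 1` has `disc < 0`, so it is off the curve and belongs to
    -- `K`. It cannot lie on the imaginary axis, since the component would then be unbounded.
    have heq : {w | w ∈ {w : ℂ | 0 < w.re} ∩ K ∧ c ≤ u w} =
        closure K ∩ ({w : ℂ | 0 ≤ w.re} ∩ u ⁻¹' Ici c) := by
      ext w
      constructor
      · rintro ⟨⟨h3, h4⟩, h5⟩
        exact ⟨subset_closure h4, (show 0 < w.re from h3).le, h5⟩
      · rintro ⟨h3, h4, h5⟩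
        have h4' : 0 ≤ w.re := h4
        have h5' : c ≤ u w := h5
        have h6 := hdisc w h4 (by linarith)
        have h7 : w ∈ K := mem_connectedComponentIn_of_mem_closure hzC
          (h.notMem_symCurve h4 h6.ne) h3
        rcases h4'.eq_or_lt with h8 | h8
        · exact absurd hb (h.not_isBounded_component h8.symm h6 h7)
        · exact ⟨⟨h8, h7⟩, h5⟩
    rw [heq]
    exact Metric.isCompact_of_isClosed_isBounded (isClosed_closure.inter hcl)
      (hb.closure.subset inter_subset_left)

end CriticalArc

/-! ### Comparison of the moduli under reflection -/

theorem modulus_eq_lowMod {s : ℝ} (hs : 1 / 3 < s) {z : ℂ} (hz : 0 ≤ z.re) (hd : 0 ≤ disc s z) :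
    modulus s z = lowMod s z := by
  unfold modulus
  split_ifs
  · rfl
  · exact max_eq_left ((highMod_le_lowMod_iff hs (shift_sq_sub_quad_ne_of_re hs hz)).2
      (mul_nonneg (cross_nonneg s z) hd))

theorem modulus_lt_of_disc_nonneg {s : ℝ} (hs : 1 / 3 < s) (hs1 : s ≤ 1) {z : ℂ} (hz : 0 < z.re)
    (hd : 0 ≤ disc s z) : modulus s z < modulus s (-z) := by
  rw [modulus_eq_lowMod hs hz.le hd]
  exact (lowMod_lt hs hs1 hz).trans_le (lowMod_le_modulus s _)

/-- The product over the sheets has a numerator even in `z`, while its denominator contains `|z + (1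
+ s²)/2|²`, which is not larger at `-z` when `Re z ≥ 0`. The excluded point is the pole for `-z`. -/
theorem highMod_mul_lowMod_le {s : ℝ} (hs : 1 / 3 < s) {z : ℂ} (hz : 0 ≤ z.re)
    (hc : z ≠ (((1 + s ^ 2) / 2 : ℝ) : ℂ)) :
    highMod s z * lowMod s z ≤ highMod s (-z) * lowMod s (-z) := by
  have hE := ctr_pos hs
  have hl := lowMod_pos hs z
  have hl' := lowMod_pos hs (-z)
  unfold highMod
  have e (a b : ℝ) {l : ℝ} (h : 0 < l) : a / (b * l) * l = a / b := by
    rw [← div_div, div_mul_cancel₀ _ h.ne']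
  rw [e _ _ hl, e _ _ hl', neg_sq]
  have h1 : 0 < ‖-z + (((1 + s ^ 2) / 2 : ℝ) : ℂ)‖ := by
    rw [norm_pos_iff]
    intro h0
    exact hc (by linear_combination -h0)
  have h2 : ‖-z + (((1 + s ^ 2) / 2 : ℝ) : ℂ)‖ ^ 2 ≤ ‖z + (((1 + s ^ 2) / 2 : ℝ) : ℂ)‖ ^ 2 := by
    have hb : 0 ≤ (1 + s ^ 2) / 2 := by positivity
    generalize (1 + s ^ 2) / 2 = b at *
    rw [← Complex.normSq_eq_norm_sq, ← Complex.normSq_eq_norm_sq, Complex.normSq_apply,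
      Complex.normSq_apply]
    simp only [Complex.add_re, Complex.add_im, Complex.neg_re, Complex.neg_im, Complex.ofReal_re,
      Complex.ofReal_im]
    nlinarith [mul_nonneg hz hb]
  gcongr

/-- Used near infinity, where `circ` is positive at `-z`. Both sheet values at `z` must be bounded:
the low one directly, the high one through the product inequality and the reversed bound on
`lowMod`. -/
theorem modulus_quotient_le {s : ℝ} (hs : 1 / 3 < s) {z : ℂ} {c : ℝ} (hz : 0 ≤ z.re)
    (hb : z ≠ (((1 + s ^ 2) / 2 : ℝ) : ℂ)) (hc : 0 < circ s (-z))
    (h1 : lowMod s z < c * lowMod s (-z)) (h2 : lowMod s (-z) < c * lowMod s z) :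
    modulus s z < c * modulus s (-z) := by
  have hl := lowMod_pos hs z
  have hl' := lowMod_pos hs (-z)
  have hm : modulus s (-z) = max (lowMod s (-z)) (highMod s (-z)) := if_neg (not_le.2 hc)
  have hc0 : 0 < c := pos_of_mul_pos_left (hl'.trans h2) hl.le
  have hlow : lowMod s z < c * modulus s (-z) :=
    h1.trans_le (mul_le_mul_of_nonneg_left (lowMod_le_modulus s _) hc0.le)
  have hhigh : highMod s z < c * modulus s (-z) := by
    have h3 := highMod_mul_lowMod_le hs hz hb
    have h4 := highMod_nonneg hs (-z)
    have h5 : highMod s z ≤ c * highMod s (-z) := by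
      have : highMod s z * lowMod s z ≤ c * highMod s (-z) * lowMod s z := by
        nlinarith [mul_le_mul_of_nonneg_left h2.le h4]
      exact le_of_mul_le_mul_right this hl
    rcases h4.eq_or_lt with h6 | h6
    · rw [← h6, mul_zero] at h5
      exact h5.trans_lt (mul_pos hc0 (modulus_pos hs _))
    · have : highMod s z < c * highMod s (-z) := by
        have : highMod s z * lowMod s z < c * highMod s (-z) * lowMod s z := by
          nlinarith [mul_lt_mul_of_pos_left h2 h6]
        exact lt_of_mul_lt_mul_right this hl.le
      exact this.trans_le (mul_le_mul_of_nonneg_left (by rw [hm]; exact le_max_right _ _) hc0.le)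
  unfold modulus at hlow hhigh ⊢
  split_ifs at hlow hhigh ⊢ <;> first | exact hlow | exact max_lt hlow hhigh

theorem eventually_circ_pos {s : ℝ} (hs : 1 / 3 < s) :
    ∀ᶠ z in Bornology.cobounded ℂ, 0 < circ s (-z) := by
  have h1 : Tendsto (fun z : ℂ => ‖z‖) (Bornology.cobounded ℂ) atTop := tendsto_norm_cobounded_atTop
  have hE := ctr_pos hs
  filter_upwards [h1.eventually_gt_atTop (ctr s + 2 * s)] with z hz
  unfold circ
  have h2 : ‖z‖ - ctr s ≤ ‖shift s (-z)‖ := by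
    unfold shift
    have := norm_sub_norm_le z (ctr s : ℂ)
    rw [Complex.norm_real, Real.norm_eq_abs, abs_of_pos hE, ← norm_neg (z - _)] at this
    rwa [show -z + (ctr s : ℂ) = -(z - ctr s) by ring]
  have h3 := Complex.re_le_norm (shift s (-z))
  nlinarith

theorem eventually_modulus_quotient_lt {s : ℝ} (hs : 1 / 3 < s) {c : ℝ} (hc : 1 < c) :
    ∀ᶠ z in Bornology.cobounded ℂ, 0 ≤ z.re → modulus s z * (modulus s (-z))⁻¹ < c := by
  have h1 := tendsto_lowMod_ratio s
  have h2 := (h1.inv₀ one_ne_zero)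
  rw [inv_one] at h2
  filter_upwards [h1.eventually (gt_mem_nhds hc), h2.eventually (gt_mem_nhds hc),
    eventually_circ_pos hs, Bornology.eventually_ne_cobounded (((1 + s ^ 2) / 2 : ℝ) : ℂ)]
    with z h3 h4 h5 h6 hz
  have hl := lowMod_pos hs z
  have hl' := lowMod_pos hs (-z)
  rw [← div_eq_mul_inv, div_lt_iff₀ hl'] at h3
  rw [mul_inv, inv_inv, mul_comm, ← div_eq_mul_inv, div_lt_iff₀ hl] at h4
  rw [← div_eq_mul_inv, div_lt_iff₀ (modulus_pos hs _)]
  exact modulus_quotient_le hs hz h6 h5 h3 h4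

namespace CriticalArc

variable {s : ℝ} {γ : ℝ → ℂ}

/-- Off the arc the potential is locally the real part of a holomorphic function `Φ` plus a
constant, so `modulus` is locally the modulus of a nonvanishing holomorphic function. -/
theorem hasHolSupport_modulus (h : CriticalArc s γ) {z : ℂ} (hz : z ∉ arc γ) :
    HasHolSupport (modulus s) z ∧ HasHolSupport (fun w => (modulus s w)⁻¹) z := by
  have := h.isProbabilityMeasure
  obtain ⟨Φ, hΦ, hΦ0, hΦe⟩ := exists_analytic_potential h.isCompact_arc h.ae_mem_arc hz
  have hΦa : AnalyticAt ℂ Φ z :=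
    Complex.analyticAt_iff_eventually_differentiableAt.2 (hΦ.mono fun v hv => hv.differentiableAt)
  have hpos := fun w => modulus_pos h.s_gt w
  have hval : ∀ᶠ v in 𝓝 z, ‖(modulus s z : ℂ) * Complex.exp (Φ v)‖ = modulus s v := by
    filter_upwards [hΦe, h.isCompact_arc.isClosed.isOpen_compl.mem_nhds hz] with v hv hva
    rw [h.potential_eq_of_notMem hva, h.potential_eq_of_notMem hz] at hv
    rw [norm_mul, Complex.norm_exp, Complex.norm_real, Real.norm_eq_abs, abs_of_pos (hpos z)]
    have h1 : (Φ v).re = Real.log (modulus s v) - Real.log (modulus s z) := by linarith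
    rw [h1, Real.exp_sub, Real.exp_log (hpos v), Real.exp_log (hpos z)]
    have := (hpos z).ne'
    field_simp
  have ha : AnalyticAt ℂ (fun v => (modulus s z : ℂ) * Complex.exp (Φ v)) z :=
    analyticAt_const.fun_mul hΦa.cexp
  refine ⟨⟨_, ha, hval.self_of_nhds, hval.mono fun v hv => hv.le⟩,
    ⟨fun v => ((modulus s z : ℂ) * Complex.exp (Φ v))⁻¹, ha.fun_inv ?_, ?_,
      hval.mono fun v hv => ?_⟩⟩
  · exact mul_ne_zero (Complex.ofReal_ne_zero.2 (hpos z).ne') (Complex.exp_ne_zero _)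
  · rw [norm_inv, hval.self_of_nhds]
  · rw [norm_inv, hv]

/-- The modulus increases under reflection from the right half-plane to the left one. -/
theorem modulus_lt (h : CriticalArc s γ)
    (hΩ : ∀ z ∈ arc γ, z.re < 0 → z ∈ OmegaZero (arc γ)) {z : ℂ} (hz : 0 < z.re) :
    modulus s z < modulus s (-z) := by
  have hs := h.s_gt
  have hs1 := h.s_le
  have hpos := fun w => modulus_pos hs w
  set u : ℂ → ℝ := fun z => modulus s z * (modulus s (-z))⁻¹ with hu
  have hcu : Continuous u := (continuous_modulus hs hs1).mul
    (((continuous_modulus hs hs1).comp continuous_neg).inv₀ fun z => (hpos _).ne')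
  have hlt : ∀ w, u w < 1 ↔ modulus s w < modulus s (-w) := fun w => by
    rw [hu]; simp only; rw [← div_eq_mul_inv, div_lt_one (hpos _)]
  -- Where `disc < 0` neither `w` nor `-w` is on the arc, so numerator and denominator both have
  -- supports. The region `disc ≥ 0` is settled separately by `lowMod_lt`.
  have hsup : ∀ w : ℂ, 0 < w.re → disc s w < 0 → HasHolSupport u w := by
    intro w hw hd
    refine (h.hasHolSupport_modulus fun h1 => hd.ne (h.disc_eq_zero_of_mem h1 hw.le)).1.mul ?_
    exact HasHolSupport.comp_neg (u := fun z => (modulus s z)⁻¹)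
      (h.hasHolSupport_modulus (h.neg_notMem_arc hΩ hw hd)).2
  have haxis : ∀ w : ℂ, w.re = 0 → u w = 1 := by
    intro w hw
    simp only [hu]
    rw [neg_eq_conj hw, modulus_conj, mul_inv_cancel₀ (hpos _).ne']
  have hnonneg : ∀ w : ℂ, 0 < w.re → 0 ≤ disc s w → u w < 1 := fun w hw hd =>
    (hlt w).2 (modulus_lt_of_disc_nonneg hs hs1 hw hd)
  have hG : IsOpen ({w : ℂ | 0 < w.re} ∩ {w | disc s w < 0}) :=
    isOpen_rightHalf.inter (isOpen_lt (continuous_disc s) continuous_const)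
  have hle : ∀ w : ℂ, 0 < w.re → u w ≤ 1 := by
    intro w hw
    rcases le_or_gt 0 (disc s w) with hd | hd
    · exact (hnonneg w hw hd).le
    refine le_one_of_hasHolSupport hG hcu.continuousOn
      (fun y hy _ => hsup y hy.1 hy.2) (fun c hc => ?_) ⟨hw, hd⟩
    have := isCompact_superlevel (u := u) (T := {z : ℂ | 0 ≤ z.re})
      (isClosed_le continuous_const Complex.continuous_re) hcu.continuousOn
      (fun c hc => eventually_modulus_quotient_lt hs hc) hc
    convert this using 1
    ext y
    simp only [mem_ofPred_eq, mem_inter_iff]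
    constructor
    · rintro ⟨⟨h1, -⟩, h2⟩; exact ⟨h1.le, h2⟩
    · rintro ⟨h1, h2⟩
      have h3 : 0 < y.re := lt_of_le_of_ne h1 fun h3 => by
        rw [haxis y h3.symm] at h2; linarith
      refine ⟨⟨h3, ?_⟩, h2⟩
      by_contra! h4
      have := hnonneg y h3 h4
      linarith
  rw [← hlt]
  by_contra! hcon
  have hO1 : IsOpen {w : ℂ | u w < 1} := isOpen_lt hcu continuous_const
  have hO2 : IsOpen {w : ℂ | 0 < w.re ∧ u w = 1} := by
    rw [isOpen_iff_mem_nhds]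
    rintro w ⟨hw, hw1⟩
    have hd : disc s w < 0 := by
      by_contra! h0
      exact (hnonneg w hw h0).ne hw1
    have := (hsup w hw hd).eventually_eq (by
      filter_upwards [isOpen_rightHalf.mem_nhds hw] with y hy
      rw [hw1]; exact hle y hy)
    filter_upwards [this, isOpen_rightHalf.mem_nhds hw] with y h1 h2
    exact ⟨h2, by rw [h1, hw1]⟩
  -- The crossing of the positive axis lies in the half-plane with `disc = 0`, so it provides the
  -- point of strict inequality for the connectedness argument.
  obtain ⟨t, ht, -, hre⟩ := h.meets
  obtain ⟨y, -, hy1, hy2⟩ := isPreconnected_rightHalf _ _ hO1 hO2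
    (fun w hw => (hle w hw).lt_or_eq.imp id fun h => ⟨hw, h⟩)
    ⟨γ t, hre, hnonneg _ hre (h.disc_eq_zero ht).ge⟩
    ⟨z, hz, hz, le_antisymm (hle z hz) hcon⟩
  exact absurd hy2.2 hy1.ne

/-! ### Conclusion for the potential and for `g` -/

/-- Both endpoints of the arc have negative real part, so the exact formula holds at `z`. The point
`-z` may be an endpoint, and there the lower bound suffices. -/
theorem potential_lt (h : CriticalArc s γ)
    (hΩ : ∀ z ∈ arc γ, z.re < 0 → z ∈ OmegaZero (arc γ)) {z : ℂ} (hz : 0 < z.re) :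
    potential (arcMeasure s γ) z < potential (arcMeasure s γ) (-z) := by
  have hq : quad s z ≠ 0 := fun h0 => by have := h.endpoint_re h0; linarith
  rw [h.potential_eq hq]
  refine lt_of_lt_of_le ?_ (h.integrable_log_and_le_potential (-z)).2
  have := Real.log_lt_log (modulus_pos h.s_gt z) (h.modulus_lt hΩ hz)
  linarith

/-- The real part is the logarithmic kernel, and the imaginary part is bounded by `π` on a finite
measure. -/
theorem integrable_clog (h : CriticalArc s γ) (z : ℂ) :
    Integrable (fun x => Complex.log (z - x)) (arcMeasure s γ) := by
  have := h.isProbabilityMeasure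
  have h1 := (h.integrable_log_and_le_potential z).1.ofReal (𝕜 := ℂ)
  have h2 : Integrable (fun x => (z - x).arg) (arcMeasure s γ) :=
    Integrable.of_bound (Complex.measurable_arg.comp (by fun_prop)).aestronglyMeasurable Real.pi
      (Eventually.of_forall fun x => by rw [Real.norm_eq_abs]; exact Complex.abs_arg_le_pi _)
  exact h1.add (h2.ofReal.mul_const Complex.I)

theorem gFunction_re (h : CriticalArc s γ) (z : ℂ) :
    (gFunction (arcMeasure s γ) z).re = potential (arcMeasure s γ) z := by
  have h1 := integral_re (𝕜 := ℂ) (h.integrable_clog z)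
  unfold gFunction potential
  simp only [RCLike.re_eq_complex_re, Complex.log_re] at h1
  exact h1.symm

end CriticalArc

theorem trajectoryMeasure_eq {α : ℝ} (hα : 1 / 9 < α) (hα' : α ≤ 1) (γ : ℝ → ℂ) :
    trajectoryMeasure α γ = arcMeasure (√α) γ := by
  unfold trajectoryMeasure arcMeasure weight
  congr 2
  funext t
  rw [Q_eq hα hα' (root_sq (√α) (γ t)), norm_pow, Real.sqrt_sq (norm_nonneg _), norm_mul]

end HexagonMVOP

end

theorem theorem2p6 (α : ℝ) (hα : 1 / 9 < α) (hα' : α ≤ 1)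
    (γ : ℝ → ℂ) (hγ : HexagonMVOP.ParametrizesSigmaZero α γ)
    (hΩ : ∀ z ∈ HexagonMVOP.arc γ, z.re < 0 → z ∈ HexagonMVOP.OmegaZero (HexagonMVOP.arc γ)) :
    (∀ z : ℂ, Integrable (fun s => Complex.log (z - s)) (HexagonMVOP.trajectoryMeasure α γ)) ∧
    ∀ z : ℂ, 0 < z.re →
      (HexagonMVOP.gFunction (HexagonMVOP.trajectoryMeasure α γ) z).re <
        (HexagonMVOP.gFunction (HexagonMVOP.trajectoryMeasure α γ) (-z)).re := by
  have h := hγ.criticalArc hα hα'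
  rw [HexagonMVOP.trajectoryMeasure_eq hα hα']
  refine ⟨h.integrable_clog, fun z hz => ?_⟩
  rw [h.gFunction_re, h.gFunction_re]
  exact h.potential_lt hΩ hz
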